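/- Let $d\ge 1$, let $\Omega\subset\mathbb{R}^d$ be a bounded open set with smooth boundary and outward unit normal $\nu$, let $\mathbf{x}_0\in\mathbb{R}^d\setminus\overline\Omega$ be such that $r(\mathbf{x})=|\mathbf{x}-\mathbf{x}_0|>1$ for all $\mathbf{x}\in\Omega$, and let $b>\max_{\overline\Omega} r$. There is a number $\beta_0>0$, depending only on $b,\mathbf{x}_0,\Omega,d$, such that for every fixed $\beta\ge\beta_0$ (in particular for $\beta=\beta_0$) there are constants $C>0$ and $\lambda_0>1$, depending only on $b,\mathbf{x}_0,\Omega,d,\beta$, with the following property. For every real-valued $v\in H^2(\Omega)$ with $v=\partial_\nu v=0$ on $\partial\Omega$ in the sense of traces, and every $\lambda\ge\lambda_0$, $$ \int_\Omega e^{2\lambda b^{-\beta}r^\beta(\mathbf{x})}|\Delta v(\mathbf{x})|^2\,d\mathbf{x} \;\ge\; C\lambda^{-1}\sum_{i,j=1}^d\int_\Omega e^{2\lambda b^{-\beta}r^\beta(\mathbf{x})}|\partial^2_{x_ix_j}v(\mathbf{x})|^2\,d\mathbf{x} +C\lambda^3\int_\Omega e^{2\lambda b^{-\beta}r^\beta(\mathbf{x})}|v(\mathbf{x})|^2\,d\mathbf{x}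 +C\lambda\int_\Omega e^{2\lambda b^{-\beta}r^\beta(\mathbf{x})}|\nabla v(\mathbf{x})|^2\,d\mathbf{x}. $$ -/

import Mathlib

open MeasureTheory Filter Topology
open scoped ContDiff ENNReal

noncomputable section

namespace CarlemanH2

variable {d : ℕ}

/-- The classical partial derivative `∂φ/∂x_i` of a function on `ℝ^d`. -/
def partialDeriv (i : Fin d) (φ : EuclideanSpace ℝ (Fin d) → ℝ)
    (x : EuclideanSpace ℝ (Fin d)) : ℝ :=
  fderiv ℝ φ x (EuclideanSpace.single i 1)

/-! ### Open sets with smooth boundary and their outward normal -/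

/-- On the open set `U`, the set `Ω` is the sublevel set `{ρ < 0}` of a smooth function `ρ`
without critical points in `U`. (Then `∂Ω ∩ U = {ρ = 0} ∩ U`.) -/
structure IsLocalDefiningFunction (Ω U : Set (EuclideanSpace ℝ (Fin d)))
    (ρ : EuclideanSpace ℝ (Fin d) → ℝ) : Prop where
  isOpen : IsOpen U
  contDiffOn : ContDiffOn ℝ ∞ ρ U
  gradient_ne_zero : ∀ x ∈ U, gradient ρ x ≠ 0
  inter_eq : Ω ∩ U = {x ∈ U | ρ x < 0}

/-- The boundary of `Ω` is smooth (of class `C^∞`), with `Ω` lying locally on one side of it. -/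
def HasSmoothBoundary (Ω : Set (EuclideanSpace ℝ (Fin d))) : Prop :=
  ∀ p ∈ frontier Ω, ∃ (U : Set (EuclideanSpace ℝ (Fin d))) (ρ : EuclideanSpace ℝ (Fin d) → ℝ),
    p ∈ U ∧ IsLocalDefiningFunction Ω U ρ

/-- `n` is the outward unit normal vector to `∂Ω` at the boundary point `p`: the normalized
gradient at `p` of a local defining function. -/
def IsOutwardUnitNormal (Ω : Set (EuclideanSpace ℝ (Fin d)))
    (p n : EuclideanSpace ℝ (Fin d)) : Prop :=
  p ∈ frontier Ω ∧
    ∃ (U : Set (EuclideanSpace ℝ (Fin d))) (ρ : EuclideanSpace ℝ (Fin d) → ℝ),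
      p ∈ U ∧ IsLocalDefiningFunction Ω U ρ ∧ n = ‖gradient ρ p‖⁻¹ • gradient ρ p

/-- Surface measure on `∂Ω`: the `(d-1)`-dimensional Hausdorff measure restricted to `∂Ω`. -/
def surfaceMeasure (Ω : Set (EuclideanSpace ℝ (Fin d))) : Measure (EuclideanSpace ℝ (Fin d)) :=
  (Measure.hausdorffMeasure ((d : ℝ) - 1)).restrict (frontier Ω)

/-! ### Weak derivatives and the Sobolev space `H²(Ω)` -/

/-- `w` is the weak partial derivative `∂u/∂x_i` in `Ω` (used for `u, w ∈ L²(Ω)`). -/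
def HasWeakPartial (Ω : Set (EuclideanSpace ℝ (Fin d))) (i : Fin d)
    (u w : EuclideanSpace ℝ (Fin d) → ℝ) : Prop :=
  ∀ φ : EuclideanSpace ℝ (Fin d) → ℝ, ContDiff ℝ ∞ φ → HasCompactSupport φ → tsupport φ ⊆ Ω →
    ∫ x in Ω, u x * partialDeriv i φ x = -∫ x in Ω, w x * φ x

/-- `v ∈ H²(Ω)`, with weak gradient `(Dv i)_i` and weak second derivatives
`D2v i j = ∂_j ∂_i v`. -/
structure IsSobolevH2 (Ω : Set (EuclideanSpace ℝ (Fin d)))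
    (v : EuclideanSpace ℝ (Fin d) → ℝ) (Dv : Fin d → EuclideanSpace ℝ (Fin d) → ℝ)
    (D2v : Fin d → Fin d → EuclideanSpace ℝ (Fin d) → ℝ) : Prop where
  memLp : MemLp v 2 (volume.restrict Ω)
  memLp_grad : ∀ i, MemLp (Dv i) 2 (volume.restrict Ω)
  memLp_hess : ∀ i j, MemLp (D2v i j) 2 (volume.restrict Ω)
  weak_grad : ∀ i, HasWeakPartial Ω i v (Dv i)
  weak_hess : ∀ i j, HasWeakPartial Ω j (Dv i) (D2v i j)

/-! ### Traces -/

/-- `g ∈ L²(∂Ω)` is the trace on `∂Ω` of the function `u ∈ H¹(Ω)` with weak gradient `Du`.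
The trace operator is the continuous extension to `H¹(Ω)` of the restriction map
`u ↦ u|_{∂Ω} ∈ L²(∂Ω)` on functions smooth up to the boundary: there are smooth functions `φ n`
that converge to `u` in `H¹(Ω)` and whose restrictions to `∂Ω` converge to `g` in `L²(∂Ω)`. -/
def HasTrace (Ω : Set (EuclideanSpace ℝ (Fin d))) (u : EuclideanSpace ℝ (Fin d) → ℝ)
    (Du : Fin d → EuclideanSpace ℝ (Fin d) → ℝ) (g : EuclideanSpace ℝ (Fin d) → ℝ) : Prop :=
  MemLp g 2 (surfaceMeasure Ω) ∧
  ∃ φ : ℕ → EuclideanSpace ℝ (Fin d) → ℝ,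
    (∀ n, ContDiff ℝ ∞ (φ n)) ∧
    Tendsto (fun n => eLpNorm (fun x => φ n x - u x) 2 (volume.restrict Ω)) atTop (𝓝 0) ∧
    (∀ i, Tendsto (fun n => eLpNorm (fun x => partialDeriv i (φ n) x - Du i x) 2
      (volume.restrict Ω)) atTop (𝓝 0)) ∧
    Tendsto (fun n => eLpNorm (fun x => φ n x - g x) 2 (surfaceMeasure Ω)) atTop (𝓝 0)

/-- `h` is the normal derivative `∂_ν v = ∑ ν_i (∂_i v)|_{∂Ω}` on `∂Ω` of the function
`v ∈ H²(Ω)` with weak gradient `Dv` and weak second derivatives `D2v`, the functions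
`∂_i v ∈ H¹(Ω)` being restricted to `∂Ω` in the sense of traces. -/
def HasNormalDerivative (Ω : Set (EuclideanSpace ℝ (Fin d)))
    (Dv : Fin d → EuclideanSpace ℝ (Fin d) → ℝ)
    (D2v : Fin d → Fin d → EuclideanSpace ℝ (Fin d) → ℝ)
    (h : EuclideanSpace ℝ (Fin d) → ℝ) : Prop :=
  ∃ g : Fin d → EuclideanSpace ℝ (Fin d) → ℝ,
    (∀ i, HasTrace Ω (Dv i) (D2v i) (g i)) ∧
    ∀ᵐ p ∂(surfaceMeasure Ω), ∀ n, IsOutwardUnitNormal Ω p n → ∑ i, n i * g i p = h p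

/-- The Carleman weight `exp(2 λ b^{-β} r(x)^β)` with `r(x) = |x - x₀|`. -/
def carlemanWeight (x₀ : EuclideanSpace ℝ (Fin d)) (b β lam : ℝ)
    (x : EuclideanSpace ℝ (Fin d)) : ℝ :=
  Real.exp (2 * lam * b ^ (-β) * dist x x₀ ^ β)

end CarlemanH2

end

namespace CarlemanH2

/-! ### Calculus of partial derivatives -/

section Calculus

variable {d : ℕ} {f g : EuclideanSpace ℝ (Fin d) → ℝ} {x : EuclideanSpace ℝ (Fin d)}

/-! The proof has three independent ingredients: an estimate for test functions, a zero extension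
theorem, and mollification.

Test functions. Let `φ` be the weight exponent and `w = exp(l φ) u`. Then `exp(l φ) Δu = A + B` with
the symmetric part `A = Δw + l² |∇φ|² w` and the skew part `B = -2 l ∇φ·∇w - l Δφ w`. Since `(A +
B)² ≥ 2AB`, the task is to bound `∫ 2AB` from below. Integrating by parts turns it into the integral
of a quadratic form (`carlemanForm`) whose main terms are `4 l D²φ(∇w, ∇w) + 4 l³ D²φ(∇φ, ∇φ) w²`.
When `φ` is uniformly convex without critical points these dominate `l |∇w|² + l³ w²` for large `l`,
and the remaining term is absorbed. The second derivatives come from `∫ (Δw)² = ∫ |D²w|²`, with `Δw`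
expressed through `A + B`, `∇w` and `w`; the factor `l⁻¹` pays for the powers of `l` lost there. All
this is arranged as one pointwise inequality (`carleman_pointwise_inequality`) whose right side is a
multiple of `(A + B)²` plus terms of integral zero. For `φ = b^(-β) r^β` convexity on a shell around
`x₀` needs only `β ≥ 2`, so `β₀ = 2` works and no second large parameter enters.

Zero extension. An `H²(Ω)` function with vanishing Cauchy data, extended by zero, lies in `H²(ℝᵈ)`.
The obstruction is the functional `weakDefect`, formally `ψ ↦ ∫_{∂Ω} u ψ ν_i`. It is treated locally
without a divergence theorem: the integral over `Ω` of a derivative is controlled by the `L²(∂Ω)`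
norm, using slices in a direction transversal to `∂Ω` and, for the other directions, the fact that
fields tangential to the level sets of `ρ` integrate to zero
(`exists_bound_setIntegral_partialDeriv`). For `v` itself the zero trace suffices. For `∂_i v`, with
formal trace `g_i`, only `∑ ν_j g_j = 0` is given; the zero trace of `v` adds `g_i ν_j = g_j ν_i`,
and the two together give `g_i ν_l = ∑_j g_i ν_j ν_j ν_l = ν_i ν_l ∑_j g_j ν_j = 0`.
`weakDefect_grad_eq_zero` is this computation at the level of functionals.

Conclusion. Mollifications of the extension are test functions supported in the shell, their
derivatives are the mollified weak derivatives, and every integral converges for fixed `l`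
(`carleman_of_zeroExtension`). -/

lemma differentiableAt_of_smooth (hf : ContDiff ℝ ∞ f) : DifferentiableAt ℝ f x :=
  hf.contDiffAt.differentiableAt (by simp)

lemma contDiff_partialDeriv (i : Fin d) (hf : ContDiff ℝ ∞ f) :
    ContDiff ℝ ∞ (partialDeriv i f) :=
  (hf.fderiv_right (m := ∞) (by simp)).clm_apply contDiff_const

lemma contDiffAt_partialDeriv (i : Fin d) (hf : ContDiffAt ℝ ∞ f x) :
    ContDiffAt ℝ ∞ (partialDeriv i f) x :=
  (hf.fderiv_right (m := ∞) (by simp)).clm_apply contDiffAt_const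

lemma tsupport_partialDeriv_subset (i : Fin d) (f : EuclideanSpace ℝ (Fin d) → ℝ) :
    tsupport (partialDeriv i f) ⊆ tsupport f :=
  tsupport_fderiv_apply_subset ℝ _

lemma hasCompactSupport_partialDeriv (i : Fin d) (hf : HasCompactSupport f) :
    HasCompactSupport (partialDeriv i f) :=
  hf.fderiv_apply ℝ _

lemma partialDeriv_eq_zero_of_notMem (i : Fin d) (hx : x ∉ tsupport f) :
    partialDeriv i f x = 0 :=
  image_eq_zero_of_notMem_tsupport fun h => hx (tsupport_partialDeriv_subset i f h)

lemma partialDeriv_add (i : Fin d) (hf : DifferentiableAt ℝ f x) (hg : DifferentiableAt ℝ g x) :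
    partialDeriv i (fun y => f y + g y) x = partialDeriv i f x + partialDeriv i g x := by
  simp only [partialDeriv]
  rw [fderiv_fun_add hf hg]; rfl

lemma partialDeriv_const_mul (i : Fin d) (c : ℝ) (hf : DifferentiableAt ℝ f x) :
    partialDeriv i (fun y => c * f y) x = c * partialDeriv i f x := by
  simp only [partialDeriv]
  rw [fderiv_const_mul hf]; rfl

lemma partialDeriv_mul (i : Fin d) (hf : DifferentiableAt ℝ f x) (hg : DifferentiableAt ℝ g x) :
    partialDeriv i (fun y => f y * g y) x
      = partialDeriv i f x * g x + f x * partialDeriv i g x := by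
  simp only [partialDeriv]
  rw [fderiv_fun_mul hf hg]
  simp [mul_comm, add_comm]

lemma partialDeriv_sum {ι : Type*} (s : Finset ι) (i : Fin d)
    {F : ι → EuclideanSpace ℝ (Fin d) → ℝ} (hF : ∀ k ∈ s, DifferentiableAt ℝ (F k) x) :
    partialDeriv i (fun y => ∑ k ∈ s, F k y) x = ∑ k ∈ s, partialDeriv i (F k) x := by
  simp only [partialDeriv]
  rw [fderiv_fun_sum hF]; simp

lemma partialDeriv_comp (i : Fin d) {h : ℝ → ℝ} {h' : ℝ} (hh : HasDerivAt h h' (f x))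
    (hf : DifferentiableAt ℝ f x) :
    partialDeriv i (fun y => h (f y)) x = h' * partialDeriv i f x := by
  have := (hh.comp_hasFDerivAt x hf.hasFDerivAt).fderiv
  simp only [partialDeriv]
  rw [show (fun y => h (f y)) = h ∘ f from rfl, this]; rfl

lemma partialDeriv_congr (i : Fin d) (h : f =ᶠ[𝓝 x] g) :
    partialDeriv i f x = partialDeriv i g x := by
  simp only [partialDeriv, h.fderiv_eq]

lemma partialDeriv_comm (i j : Fin d) (hf : ContDiffAt ℝ ∞ f x) :
    partialDeriv i (partialDeriv j f) x = partialDeriv j (partialDeriv i f) x := by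
  have hd : DifferentiableAt ℝ (fderiv ℝ f) x :=
    (hf.fderiv_right (m := ∞) (by simp)).differentiableAt (by simp)
  have key : ∀ a b : Fin d, partialDeriv a (partialDeriv b f) x
      = fderiv ℝ (fderiv ℝ f) x (EuclideanSpace.single a 1) (EuclideanSpace.single b 1) := by
    intro a b
    change fderiv ℝ (fun y => fderiv ℝ f y (EuclideanSpace.single b 1)) x _ = _
    rw [fderiv_clm_apply hd (differentiableAt_const _)]
    simp
  rw [key, key]
  exact (hf.isSymmSndFDerivAt (by simp only [minSmoothness_of_isRCLikeNormedField]; exact WithTop.coe_le_coe.2 (le_top (a := (2 : ℕ∞))))) _ _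

lemma gradient_apply (f : EuclideanSpace ℝ (Fin d) → ℝ) (x : EuclideanSpace ℝ (Fin d))
    (i : Fin d) : gradient f x i = partialDeriv i f x := by
  have : inner ℝ (gradient f x) (EuclideanSpace.single i (1 : ℝ)) = partialDeriv i f x := by
    simp [gradient, partialDeriv]
  rw [← this, EuclideanSpace.inner_single_right]; simp

lemma integrable_of_test (hf : Continuous f) (hc : HasCompactSupport f) : Integrable f :=
  hf.integrable_of_hasCompactSupport hc

lemma integral_partialDeriv (i : Fin d) (hf : ContDiff ℝ ∞ f) (hc : HasCompactSupport f) :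
    ∫ x, partialDeriv i f x = 0 := by
  have := integral_mul_fderiv_eq_neg_fderiv_mul_of_integrable (μ := volume)
    (f := fun _ : EuclideanSpace ℝ (Fin d) => (1 : ℝ)) (g := f)
    (v := EuclideanSpace.single i (1 : ℝ)) (by simp)
    (by simp only [one_mul]; exact integrable_of_test (contDiff_partialDeriv i hf).continuous
          (hasCompactSupport_partialDeriv i hc))
    (by simpa using integrable_of_test hf.continuous hc)
    (fun _ _ => differentiableAt_const _) (fun _ _ => differentiableAt_of_smooth hf)
  simpa [partialDeriv] using this

/-- The product of a smooth function supported in `Q` with a function smooth near each point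
of `Q` is smooth. -/
lemma contDiff_mul_of_tsupport_subset {Q : Set (EuclideanSpace ℝ (Fin d))}
    (hf : ContDiff ℝ ∞ f) (hQ : tsupport f ⊆ Q) (hg : ∀ x ∈ Q, ContDiffAt ℝ ∞ g x) :
    ContDiff ℝ ∞ (fun x => f x * g x) := by
  rw [contDiff_iff_contDiffAt]
  intro x
  by_cases hx : x ∈ tsupport f
  · exact hf.contDiffAt.mul (hg x (hQ hx))
  · have : (fun x => f x * g x) =ᶠ[𝓝 x] fun _ => 0 := by
      filter_upwards [notMem_tsupport_iff_eventuallyEq.1 hx] with y hy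
      simp [hy]
    exact contDiffAt_const.congr_of_eventuallyEq this

lemma tsupport_mul_subset_left' (f g : EuclideanSpace ℝ (Fin d) → ℝ) :
    tsupport (fun x => f x * g x) ⊆ tsupport f := tsupport_mul_subset_left

lemma tsupport_mul_subset_right' (f g : EuclideanSpace ℝ (Fin d) → ℝ) :
    tsupport (fun x => f x * g x) ⊆ tsupport g := tsupport_mul_subset_right

end Calculus

/-! ### The pointwise algebra of the Carleman estimate -/

section Algebra

variable {d : ℕ}

/-- The quadratic form left over after integrating the cross term by parts. -/
noncomputable def carlemanForm (l w : ℝ) (w1 p1 : Fin d → ℝ) (p2 p3 : Fin d → Fin d → ℝ) : ℝ :=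
  ∑ i, ∑ j, (4 * l * (w1 i * p2 i j * w1 j) + 4 * l ^ 3 * (p1 i * p2 i j * p1 j) * w ^ 2
    + 2 * l * (w * w1 i * p3 i j))

/-- The symmetric part of the conjugated Laplacian. -/
noncomputable def symmPart (l w : ℝ) (p1 : Fin d → ℝ) (w2 : Fin d → Fin d → ℝ) : ℝ :=
  ∑ i, (w2 i i + l ^ 2 * p1 i ^ 2 * w)

/-- The antisymmetric part of the conjugated Laplacian. -/
noncomputable def skewPart (l w : ℝ) (w1 p1 : Fin d → ℝ) (p2 : Fin d → Fin d → ℝ) : ℝ :=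
  ∑ j, (-2 * l * (p1 j * w1 j) - l * p2 j j * w)

lemma carlemanForm_lower_bound {m M l w : ℝ} {w1 p1 : Fin d → ℝ} {p2 p3 : Fin d → Fin d → ℝ}
    (hd : 1 ≤ d) (hm : 0 < m) (hl : 1 ≤ l) (hp3 : ∀ i j, |p3 i j| ≤ M)
    (hw : m * ∑ i, w1 i ^ 2 ≤ ∑ i, ∑ j, w1 i * p2 i j * w1 j)
    (hp : m * ∑ i, p1 i ^ 2 ≤ ∑ i, ∑ j, p1 i * p2 i j * p1 j)
    (hp1 : m ≤ ∑ i, p1 i ^ 2) (hlarge : d ^ 3 * M ^ 2 ≤ l ^ 2 * m ^ 3) :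
    l * m * ∑ i, w1 i ^ 2 + l ^ 3 * m ^ 2 * w ^ 2 ≤ carlemanForm l w w1 p1 p2 p3 := by
  have hd' : (1 : ℝ) ≤ d := by exact_mod_cast hd
  have hdpos : (0 : ℝ) < d := by linarith
  have hl0 : 0 < l := by linarith
  -- Young's inequality with weight `m / d`: summed over all pairs, the gradient part costs `m
  -- |∇w|²`, which the convexity term can afford, and the zeroth order part costs `d³ M² / m w²`,
  -- which `hlarge` absorbs.
  have hterm : ∀ i j, -(m / d * w1 i ^ 2 + d * M ^ 2 / m * w ^ 2) ≤ 2 * (w * w1 i * p3 i j) := by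
    intro i j
    have h1 : p3 i j ^ 2 ≤ M ^ 2 := sq_le_sq' (neg_le_of_abs_le (hp3 i j)) (le_of_abs_le (hp3 i j))
    have h2 : 0 ≤ d / m * (m / d * w1 i + w * p3 i j) ^ 2 := by positivity
    have h3 : d / m * (m / d * w1 i + w * p3 i j) ^ 2
        = m / d * w1 i ^ 2 + 2 * (w * w1 i * p3 i j) + d / m * w ^ 2 * p3 i j ^ 2 := by
      field_simp
      ring
    have h4 : d / m * w ^ 2 * p3 i j ^ 2 ≤ d / m * w ^ 2 * M ^ 2 :=
      mul_le_mul_of_nonneg_left h1 (by positivity)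
    have h5 : d / m * w ^ 2 * M ^ 2 = d * M ^ 2 / m * w ^ 2 := by ring
    linarith
  have hsum : -(m * ∑ i, w1 i ^ 2 + d ^ 3 * M ^ 2 / m * w ^ 2)
      ≤ ∑ i, ∑ j, 2 * (w * w1 i * p3 i j) := by
    calc -(m * ∑ i, w1 i ^ 2 + d ^ 3 * M ^ 2 / m * w ^ 2)
        = ∑ i : Fin d, ∑ _j : Fin d, -(m / d * w1 i ^ 2 + d * M ^ 2 / m * w ^ 2) := by
          simp only [Finset.sum_neg_distrib, Finset.sum_const, Finset.card_univ, Fintype.card_fin,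
            nsmul_eq_mul, ← Finset.mul_sum, Finset.sum_add_distrib]
          field_simp
      _ ≤ _ := Finset.sum_le_sum fun i _ => Finset.sum_le_sum fun j _ => hterm i j
  have hform : carlemanForm l w w1 p1 p2 p3 = 4 * l * (∑ i, ∑ j, w1 i * p2 i j * w1 j)
      + 4 * l ^ 3 * (∑ i, ∑ j, p1 i * p2 i j * p1 j) * w ^ 2
      + l * ∑ i, ∑ j, 2 * (w * w1 i * p3 i j) := by
    simp only [carlemanForm, Finset.mul_sum, Finset.sum_mul, ← Finset.sum_add_distrib]
    refine Finset.sum_congr rfl fun i _ => Finset.sum_congr rfl fun j _ => ?_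
    ring
  rw [hform]
  have e1 := mul_le_mul_of_nonneg_left hw hl0.le
  have e2 : m ^ 2 ≤ ∑ i, ∑ j, p1 i * p2 i j * p1 j := by nlinarith
  have e3 : l ^ 3 * w ^ 2 * m ^ 2 ≤ l ^ 3 * w ^ 2 * ∑ i, ∑ j, p1 i * p2 i j * p1 j :=
    mul_le_mul_of_nonneg_left e2 (by positivity)
  have e4 := mul_le_mul_of_nonneg_left hsum hl0.le
  have e5 : d ^ 3 * M ^ 2 / m ≤ l ^ 2 * m ^ 2 := by
    rw [div_le_iff₀ hm]; nlinarith
  have e6 : l * w ^ 2 * (d ^ 3 * M ^ 2 / m) ≤ l * w ^ 2 * (l ^ 2 * m ^ 2) :=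
    mul_le_mul_of_nonneg_left e5 (by positivity)
  have e7 : 0 ≤ ∑ i, w1 i ^ 2 := Finset.sum_nonneg fun i _ => sq_nonneg _
  have e8 : 0 ≤ l * m * ∑ i, w1 i ^ 2 := by positivity
  have e9 : 0 ≤ l ^ 3 * m ^ 2 * w ^ 2 := by positivity
  nlinarith

lemma sq_add_five_le (a b c e f : ℝ) :
    (a - b - c - e + f) ^ 2 ≤ 5 * (a ^ 2 + b ^ 2 + c ^ 2 + e ^ 2 + f ^ 2) := by
  nlinarith [sq_nonneg (a + b), sq_nonneg (a + c), sq_nonneg (a + e), sq_nonneg (a - f),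
    sq_nonneg (b - c), sq_nonneg (b - e), sq_nonneg (b + f), sq_nonneg (c - e), sq_nonneg (c + f),
    sq_nonneg (e + f)]

lemma sq_add_four_le (a b c e : ℝ) :
    (a + b + c - e) ^ 2 ≤ 4 * (a ^ 2 + b ^ 2 + c ^ 2 + e ^ 2) := by
  nlinarith [sq_nonneg (a - b), sq_nonneg (a - c), sq_nonneg (a + e), sq_nonneg (b - c),
    sq_nonneg (b + e), sq_nonneg (c + e)]

lemma gradient_term_le {M l w : ℝ} {w1 p1 : Fin d → ℝ} (hp1 : ∀ i, |p1 i| ≤ M) :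
    ∑ i, (w1 i - l * p1 i * w) ^ 2
      ≤ 2 * ∑ i, w1 i ^ 2 + 2 * d * M ^ 2 * l ^ 2 * w ^ 2 := by
  have h : ∀ i, (w1 i - l * p1 i * w) ^ 2 ≤ 2 * w1 i ^ 2 + 2 * M ^ 2 * l ^ 2 * w ^ 2 := by
    intro i
    have h1 : p1 i ^ 2 ≤ M ^ 2 := sq_le_sq' (neg_le_of_abs_le (hp1 i)) (le_of_abs_le (hp1 i))
    have h2 : l ^ 2 * w ^ 2 * p1 i ^ 2 ≤ l ^ 2 * w ^ 2 * M ^ 2 :=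
      mul_le_mul_of_nonneg_left h1 (by positivity)
    nlinarith [sq_nonneg (w1 i + l * p1 i * w)]
  refine (Finset.sum_le_sum fun i _ => h i).trans (le_of_eq ?_)
  simp only [Finset.sum_add_distrib, ← Finset.mul_sum, Finset.sum_const, Finset.card_univ,
    Fintype.card_fin, nsmul_eq_mul]
  ring

/-- Solving `A + B` for `Δw` leaves first and zeroth order terms with coefficients `l` and `l²`;
after squaring and multiplication by `l⁻¹` these have the orders `l |∇w|²` and `l³ w²` that the
quadratic form controls. -/
lemma laplacian_term_le {M l w : ℝ} {w1 p1 : Fin d → ℝ} {w2 p2 : Fin d → Fin d → ℝ}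
    (hM : 1 ≤ M) (hl : 1 ≤ l) (hp1 : ∀ i, |p1 i| ≤ M) (hp2 : ∀ i j, |p2 i j| ≤ M) :
    (∑ i, w2 i i) ^ 2 ≤ 4 * (symmPart l w p1 w2 + skewPart l w w1 p1 p2) ^ 2
      + 16 * d * M ^ 2 * l ^ 2 * ∑ i, w1 i ^ 2 + 8 * d ^ 2 * M ^ 4 * l ^ 4 * w ^ 2 := by
  have hsq : ∀ i, p1 i ^ 2 ≤ M ^ 2 := fun i =>
    sq_le_sq' (neg_le_of_abs_le (hp1 i)) (le_of_abs_le (hp1 i))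
  have hP : ∑ i, p1 i ^ 2 ≤ d * M ^ 2 := by
    refine (Finset.sum_le_sum fun i _ => hsq i).trans (le_of_eq ?_)
    simp
  have hP0 : 0 ≤ ∑ i, p1 i ^ 2 := Finset.sum_nonneg fun i _ => sq_nonneg _
  have hT : |∑ i, p2 i i| ≤ d * M := by
    refine (Finset.abs_sum_le_sum_abs _ _).trans ((Finset.sum_le_sum fun i _ => hp2 i i).trans
      (le_of_eq ?_))
    simp
  have hT2 : (∑ i, p2 i i) ^ 2 ≤ (d * M) ^ 2 :=
    sq_le_sq' (neg_le_of_abs_le hT) (le_of_abs_le hT)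
  have hcs : (∑ i, p1 i * w1 i) ^ 2 ≤ (d * M ^ 2) * ∑ i, w1 i ^ 2 :=
    (Finset.sum_mul_sq_le_sq_mul_sq _ _ _).trans
      (mul_le_mul_of_nonneg_right hP (Finset.sum_nonneg fun i _ => sq_nonneg _))
  have hsplit : ∑ i, w2 i i = (symmPart l w p1 w2 + skewPart l w w1 p1 p2)
      + 2 * l * (∑ i, p1 i * w1 i) + l * (∑ i, p2 i i) * w - l ^ 2 * (∑ i, p1 i ^ 2) * w := by
    simp only [symmPart, skewPart, Finset.mul_sum, Finset.sum_mul, ← Finset.sum_add_distrib,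
      ← Finset.sum_sub_distrib]
    exact Finset.sum_congr rfl fun i _ => by ring
  rw [hsplit]
  refine (sq_add_four_le _ _ _ _).trans ?_
  have hP2 : (∑ i, p1 i ^ 2) ^ 2 ≤ (d * M ^ 2) ^ 2 := pow_le_pow_left₀ hP0 hP 2
  have h1 : (l ^ 2 * w ^ 2) * (∑ i, p2 i i) ^ 2 ≤ (l ^ 2 * w ^ 2) * (d * M) ^ 2 :=
    mul_le_mul_of_nonneg_left hT2 (by positivity)
  have h2 : (l ^ 4 * w ^ 2) * (∑ i, p1 i ^ 2) ^ 2 ≤ (l ^ 4 * w ^ 2) * (d * M ^ 2) ^ 2 :=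
    mul_le_mul_of_nonneg_left hP2 (by positivity)
  have h3 := mul_le_mul_of_nonneg_left hcs (sq_nonneg l)
  have hl24 : l ^ 2 ≤ l ^ 4 := pow_le_pow_right₀ hl (by norm_num)
  have hM24 : M ^ 2 ≤ M ^ 4 := pow_le_pow_right₀ hM (by norm_num)
  have h4 : l ^ 2 * M ^ 2 * (d ^ 2 * w ^ 2) ≤ l ^ 4 * M ^ 4 * (d ^ 2 * w ^ 2) :=
    mul_le_mul_of_nonneg_right (mul_le_mul hl24 hM24 (by positivity) (by positivity))
      (by positivity)
  linarith

/-- The squared expression is `exp(l φ) ∂_i ∂_j u` written in terms of `w`. -/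
lemma hessian_term_le {M l w : ℝ} {w1 p1 : Fin d → ℝ} {w2 p2 : Fin d → Fin d → ℝ}
    (hM : 1 ≤ M) (hl : 1 ≤ l) (hp1 : ∀ i, |p1 i| ≤ M) (hp2 : ∀ i j, |p2 i j| ≤ M) :
    ∑ i, ∑ j, (w2 i j - l * p1 i * w1 j - l * p1 j * w1 i - l * p2 i j * w
        + l ^ 2 * p1 i * p1 j * w) ^ 2
      ≤ 5 * (∑ i, ∑ j, w2 i j ^ 2) + 10 * d * M ^ 2 * l ^ 2 * ∑ i, w1 i ^ 2
        + 10 * d ^ 2 * M ^ 4 * l ^ 4 * w ^ 2 := by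
  have hsq : ∀ i, p1 i ^ 2 ≤ M ^ 2 := fun i =>
    sq_le_sq' (neg_le_of_abs_le (hp1 i)) (le_of_abs_le (hp1 i))
  have hl24 : l ^ 2 ≤ l ^ 4 := pow_le_pow_right₀ hl (by norm_num)
  have hM24 : M ^ 2 ≤ M ^ 4 := pow_le_pow_right₀ hM (by norm_num)
  have h : ∀ i j, (w2 i j - l * p1 i * w1 j - l * p1 j * w1 i - l * p2 i j * w
        + l ^ 2 * p1 i * p1 j * w) ^ 2 ≤ 5 * w2 i j ^ 2 + 5 * M ^ 2 * l ^ 2 * w1 j ^ 2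
        + 5 * M ^ 2 * l ^ 2 * w1 i ^ 2 + 10 * M ^ 4 * l ^ 4 * w ^ 2 := by
    intro i j
    refine (sq_add_five_le _ _ _ _ _).trans ?_
    have a1 : (l ^ 2 * w1 j ^ 2) * p1 i ^ 2 ≤ (l ^ 2 * w1 j ^ 2) * M ^ 2 :=
      mul_le_mul_of_nonneg_left (hsq i) (by positivity)
    have a2 : (l ^ 2 * w1 i ^ 2) * p1 j ^ 2 ≤ (l ^ 2 * w1 i ^ 2) * M ^ 2 :=
      mul_le_mul_of_nonneg_left (hsq j) (by positivity)
    have a3 : (l ^ 2 * w ^ 2) * p2 i j ^ 2 ≤ (l ^ 2 * w ^ 2) * M ^ 2 :=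
      mul_le_mul_of_nonneg_left (sq_le_sq' (neg_le_of_abs_le (hp2 i j)) (le_of_abs_le (hp2 i j)))
        (by positivity)
    have a4 : (l ^ 4 * w ^ 2) * (p1 i ^ 2 * p1 j ^ 2) ≤ (l ^ 4 * w ^ 2) * (M ^ 2 * M ^ 2) :=
      mul_le_mul_of_nonneg_left (mul_le_mul (hsq i) (hsq j) (sq_nonneg _) (by positivity))
        (by positivity)
    have a5 : l ^ 2 * M ^ 2 * w ^ 2 ≤ l ^ 4 * M ^ 4 * w ^ 2 :=
      mul_le_mul_of_nonneg_right (mul_le_mul hl24 hM24 (by positivity) (by positivity))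
        (by positivity)
    nlinarith
  refine (Finset.sum_le_sum fun i _ => Finset.sum_le_sum fun j _ => h i j).trans (le_of_eq ?_)
  simp only [Finset.sum_add_distrib, ← Finset.mul_sum, Finset.sum_const, Finset.card_univ,
    Fintype.card_fin, nsmul_eq_mul]
  ring

/-- The constant in the pointwise Carleman inequality. -/
noncomputable def carlemanConst (d : ℕ) (m M : ℝ) : ℝ :=
  (2 + 90 * d * M ^ 2) / m + (1 + 2 * d * M ^ 2 + 50 * d ^ 2 * M ^ 4) / m ^ 2

/-- The left side is the integrand of the three terms to be bounded, written in `w`. On the right,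
the differences `2AB - carlemanForm` and `(Δw)² - |D²w|²` are divergences when the arguments come
from functions, so only the multiple of `(A + B)²` survives integration. -/
lemma carleman_pointwise_inequality {m M l w : ℝ} {w1 p1 : Fin d → ℝ}
    {w2 p2 p3 : Fin d → Fin d → ℝ}
    (hd : 1 ≤ d) (hm : 0 < m) (hM : 1 ≤ M) (hl : 1 ≤ l) (hp1 : ∀ i, |p1 i| ≤ M)
    (hp2 : ∀ i j, |p2 i j| ≤ M)
    (hform : l * m * ∑ i, w1 i ^ 2 + l ^ 3 * m ^ 2 * w ^ 2 ≤ carlemanForm l w w1 p1 p2 p3) :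
    l⁻¹ * (∑ i, ∑ j, (w2 i j - l * p1 i * w1 j - l * p1 j * w1 i - l * p2 i j * w
        + l ^ 2 * p1 i * p1 j * w) ^ 2) + l ^ 3 * w ^ 2 + l * ∑ i, (w1 i - l * p1 i * w) ^ 2
      ≤ (20 + carlemanConst d m M) * (symmPart l w p1 w2 + skewPart l w w1 p1 p2) ^ 2
        - carlemanConst d m M * (2 * (symmPart l w p1 w2 * skewPart l w w1 p1 p2)
            - carlemanForm l w w1 p1 p2 p3)
        - 5 * l⁻¹ * ((∑ i, w2 i i) ^ 2 - ∑ i, ∑ j, w2 i j ^ 2) := by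
  have hl0 : 0 < l := by linarith
  set A := symmPart l w p1 w2
  set B := skewPart l w w1 p1 p2
  set Q := carlemanForm l w w1 p1 p2 p3
  set j1 := ∑ i, w1 i ^ 2 with hj1
  have hj1n : 0 ≤ j1 := Finset.sum_nonneg fun i _ => sq_nonneg _
  have hH := hessian_term_le (w := w) (w1 := w1) (w2 := w2) hM hl hp1 hp2
  have hG := gradient_term_le (l := l) (w := w) (w1 := w1) hp1
  have hL := laplacian_term_le (w := w) (w1 := w1) (w2 := w2) hM hl hp1 hp2
  set H := ∑ i, ∑ j, (w2 i j - l * p1 i * w1 j - l * p1 j * w1 i - l * p2 i j * w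
        + l ^ 2 * p1 i * p1 j * w) ^ 2
  set G := ∑ i, (w1 i - l * p1 i * w) ^ 2
  set h2 := ∑ i, ∑ j, w2 i j ^ 2
  set T := (∑ i, w2 i i) ^ 2
  set K := carlemanConst d m M with hK
  have hli : 0 < l⁻¹ := inv_pos.2 hl0
  have hli1 : l⁻¹ ≤ 1 := inv_le_one_of_one_le₀ hl
  -- Here `(A + B)² - 2AB = A² + B²` is discarded, being nonnegative.
  have hS : l * m * j1 + l ^ 3 * m ^ 2 * w ^ 2 ≤ (A + B) ^ 2 - (2 * (A * B) - Q) := by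
    nlinarith [sq_nonneg A, sq_nonneg B]
  -- The Hessian bound is split as `5 h2 = 5 (h2 - T) + 5 T`, and `T` is replaced by its bound;
  -- hence `20 = 5·4`, `90 = 10 + 5·16` and `50 = 10 + 5·8`.
  have b1 : l⁻¹ * H ≤ l⁻¹ * (5 * (h2 - T) + 20 * (A + B) ^ 2 + 90 * d * M ^ 2 * l ^ 2 * j1
      + 50 * d ^ 2 * M ^ 4 * l ^ 4 * w ^ 2) := by
    refine mul_le_mul_of_nonneg_left ?_ hli.le
    linarith
  have b2 : l⁻¹ * (5 * (h2 - T) + 20 * (A + B) ^ 2 + 90 * d * M ^ 2 * l ^ 2 * j1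
      + 50 * d ^ 2 * M ^ 4 * l ^ 4 * w ^ 2) = 5 * l⁻¹ * (h2 - T) + l⁻¹ * (20 * (A + B) ^ 2)
      + 90 * d * M ^ 2 * l * j1 + 50 * d ^ 2 * M ^ 4 * l ^ 3 * w ^ 2 := by
    field_simp
  have b3 : l⁻¹ * (20 * (A + B) ^ 2) ≤ 20 * (A + B) ^ 2 :=
    mul_le_of_le_one_left (by positivity) hli1
  have b4 : l * G ≤ l * (2 * j1 + 2 * d * M ^ 2 * l ^ 2 * w ^ 2) :=
    mul_le_mul_of_nonneg_left hG hl0.le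
  have hKn : 0 ≤ K := by rw [hK, carlemanConst]; positivity
  have b5 := mul_le_mul_of_nonneg_left hS hKn
  have b6 : (2 + 90 * d * M ^ 2) * l * j1 + (1 + 2 * d * M ^ 2 + 50 * d ^ 2 * M ^ 4) * l ^ 3 * w ^ 2
      ≤ K * (l * m * j1 + l ^ 3 * m ^ 2 * w ^ 2) := by
    have k1 : (2 + 90 * d * M ^ 2) / m ≤ K := by
      rw [hK, carlemanConst]; exact le_add_of_nonneg_right (by positivity)
    have k2 : (1 + 2 * d * M ^ 2 + 50 * d ^ 2 * M ^ 4) / m ^ 2 ≤ K := by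
      rw [hK, carlemanConst]; exact le_add_of_nonneg_left (by positivity)
    rw [div_le_iff₀ (by positivity)] at k1 k2
    have k3 := mul_le_mul_of_nonneg_right k1 (show 0 ≤ l * j1 by positivity)
    have k4 := mul_le_mul_of_nonneg_right k2 (show 0 ≤ l ^ 3 * w ^ 2 by positivity)
    linarith
  linarith

end Algebra

/-! ### The Carleman estimate for smooth functions -/

section Smooth

variable {d : ℕ} {w p : EuclideanSpace ℝ (Fin d) → ℝ}

lemma integral_partialDeriv_add (i j : Fin d) {f g : EuclideanSpace ℝ (Fin d) → ℝ}
    (hf : ContDiff ℝ ∞ f) (hfc : HasCompactSupport f) (hg : ContDiff ℝ ∞ g)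
    (hgc : HasCompactSupport g) :
    Integrable (fun x => partialDeriv i f x + partialDeriv j g x) ∧
      ∫ x, (partialDeriv i f x + partialDeriv j g x) = 0 := by
  have h1 := integrable_of_test (contDiff_partialDeriv i hf).continuous
    (hasCompactSupport_partialDeriv i hfc)
  have h2 := integrable_of_test (contDiff_partialDeriv j hg).continuous
    (hasCompactSupport_partialDeriv j hgc)
  refine ⟨h1.add h2, ?_⟩
  rw [integral_add h1 h2, integral_partialDeriv i hf hfc, integral_partialDeriv j hg hgc, add_zero]

/-- With subscripts for derivatives, the integrand is the divergence `∂_i F + ∂_j G`, where `F = w_i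
(-4 l p_j w_j - 2 l p_jj w)` and `G = 2 l p_j w_i² - 2 l³ p_j p_i² w²`. Third derivatives of `p`
remain because `p_jj` is differentiated instead of moving another derivative onto `w`. -/
lemma integral_cross_term (hw : ContDiff ℝ ∞ w) (hwc : HasCompactSupport w)
    (hp : ContDiff ℝ ∞ p) (l : ℝ) (i j : Fin d) :
    Integrable (fun x => 2 * ((partialDeriv i (partialDeriv i w) x
          + l ^ 2 * partialDeriv i p x ^ 2 * w x)
        * (-2 * l * (partialDeriv j p x * partialDeriv j w x)
          - l * partialDeriv j (partialDeriv j p) x * w x))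
      - (4 * l * (partialDeriv i w x * partialDeriv j (partialDeriv i p) x * partialDeriv j w x)
        + 4 * l ^ 3 * (partialDeriv i p x * partialDeriv j (partialDeriv i p) x
            * partialDeriv j p x) * w x ^ 2
        + 2 * l * (w x * partialDeriv i w x
            * partialDeriv i (partialDeriv j (partialDeriv j p)) x))) ∧
    ∫ x, (2 * ((partialDeriv i (partialDeriv i w) x
          + l ^ 2 * partialDeriv i p x ^ 2 * w x)
        * (-2 * l * (partialDeriv j p x * partialDeriv j w x)
          - l * partialDeriv j (partialDeriv j p) x * w x))
      - (4 * l * (partialDeriv i w x * partialDeriv j (partialDeriv i p) x * partialDeriv j w x)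
        + 4 * l ^ 3 * (partialDeriv i p x * partialDeriv j (partialDeriv i p) x
            * partialDeriv j p x) * w x ^ 2
        + 2 * l * (w x * partialDeriv i w x
            * partialDeriv i (partialDeriv j (partialDeriv j p)) x))) = 0 := by
  have wi := contDiff_partialDeriv i hw
  have wj := contDiff_partialDeriv j hw
  have pi := contDiff_partialDeriv i hp
  have pj := contDiff_partialDeriv j hp
  have pjj := contDiff_partialDeriv j pj
  have wic := hasCompactSupport_partialDeriv i hwc
  have hF : ContDiff ℝ ∞ (fun x => partialDeriv i w x *
      (-4 * l * (partialDeriv j p x * partialDeriv j w x)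
        + -2 * l * (partialDeriv j (partialDeriv j p) x * w x))) :=
    wi.mul ((contDiff_const.mul (pj.mul wj)).add (contDiff_const.mul (pjj.mul hw)))
  have hG : ContDiff ℝ ∞ (fun x => (2 * l) * (partialDeriv i w x *
        (partialDeriv j p x * partialDeriv i w x))
      + (-2 * l ^ 3) * (w x * (w x * (partialDeriv j p x
        * (partialDeriv i p x * partialDeriv i p x))))) :=
    (contDiff_const.mul (wi.mul (pj.mul wi))).add
      (contDiff_const.mul (hw.mul (hw.mul (pj.mul (pi.mul pi)))))
  have key := integral_partialDeriv_add i j hF wic.mul_right hG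
    ((HasCompactSupport.mul_left wic.mul_right).add
      (HasCompactSupport.mul_left hwc.mul_right))
  have hpt : ∀ x, partialDeriv i (fun x => partialDeriv i w x *
      (-4 * l * (partialDeriv j p x * partialDeriv j w x)
        + -2 * l * (partialDeriv j (partialDeriv j p) x * w x))) x
      + partialDeriv j (fun x => (2 * l) * (partialDeriv i w x *
        (partialDeriv j p x * partialDeriv i w x))
      + (-2 * l ^ 3) * (w x * (w x * (partialDeriv j p x
        * (partialDeriv i p x * partialDeriv i p x))))) x
      = 2 * ((partialDeriv i (partialDeriv i w) x
          + l ^ 2 * partialDeriv i p x ^ 2 * w x)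
        * (-2 * l * (partialDeriv j p x * partialDeriv j w x)
          - l * partialDeriv j (partialDeriv j p) x * w x))
      - (4 * l * (partialDeriv i w x * partialDeriv j (partialDeriv i p) x * partialDeriv j w x)
        + 4 * l ^ 3 * (partialDeriv i p x * partialDeriv j (partialDeriv i p) x
            * partialDeriv j p x) * w x ^ 2
        + 2 * l * (w x * partialDeriv i w x
            * partialDeriv i (partialDeriv j (partialDeriv j p)) x)) := by
    intro x
    have dw := differentiableAt_of_smooth (x := x) hw
    have dwi := differentiableAt_of_smooth (x := x) wi
    have dwj := differentiableAt_of_smooth (x := x) wj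
    have dpi := differentiableAt_of_smooth (x := x) pi
    have dpj := differentiableAt_of_smooth (x := x) pj
    have dpjj := differentiableAt_of_smooth (x := x) pjj
    rw [partialDeriv_mul i dwi (((dpj.fun_mul dwj).const_mul _).fun_add
        ((dpjj.fun_mul dw).const_mul _)),
      partialDeriv_add i ((dpj.fun_mul dwj).const_mul _) ((dpjj.fun_mul dw).const_mul _),
      partialDeriv_const_mul i _ (dpj.fun_mul dwj), partialDeriv_const_mul i _ (dpjj.fun_mul dw),
      partialDeriv_mul i dpj dwj, partialDeriv_mul i dpjj dw,
      partialDeriv_add j ((dwi.fun_mul (dpj.fun_mul dwi)).const_mul _)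
        ((dw.fun_mul (dw.fun_mul (dpj.fun_mul (dpi.fun_mul dpi)))).const_mul _),
      partialDeriv_const_mul j _ (dwi.fun_mul (dpj.fun_mul dwi)),
      partialDeriv_const_mul j _ (dw.fun_mul (dw.fun_mul (dpj.fun_mul (dpi.fun_mul dpi)))),
      partialDeriv_mul j dwi (dpj.fun_mul dwi), partialDeriv_mul j dpj dwi,
      partialDeriv_mul j dw (dw.fun_mul (dpj.fun_mul (dpi.fun_mul dpi))),
      partialDeriv_mul j dw (dpj.fun_mul (dpi.fun_mul dpi)),
      partialDeriv_mul j dpj (dpi.fun_mul dpi), partialDeriv_mul j dpi dpi,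
      partialDeriv_comm i j hw.contDiffAt, partialDeriv_comm i j hp.contDiffAt]
    ring
  simpa only [hpt] using key

/-- The integrand equals `∂_i (w_i w_jj) - ∂_j (w_i w_ij)`; the third derivatives of `w` cancel. -/
lemma integral_hessian_term (hw : ContDiff ℝ ∞ w) (hwc : HasCompactSupport w) (i j : Fin d) :
    Integrable (fun x => partialDeriv i (partialDeriv i w) x * partialDeriv j (partialDeriv j w) x
      - partialDeriv j (partialDeriv i w) x ^ 2) ∧
    ∫ x, (partialDeriv i (partialDeriv i w) x * partialDeriv j (partialDeriv j w) x
      - partialDeriv j (partialDeriv i w) x ^ 2) = 0 := by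
  have wi := contDiff_partialDeriv i hw
  have wj := contDiff_partialDeriv j hw
  have wjj := contDiff_partialDeriv j wj
  have wij := contDiff_partialDeriv i wj
  have wic := hasCompactSupport_partialDeriv i hwc
  have key := integral_partialDeriv_add i j (wi.mul wjj) wic.mul_right
    (contDiff_const (c := (-1 : ℝ)).mul (wi.mul wij)) (HasCompactSupport.mul_left wic.mul_right)
  have hpt : ∀ x, partialDeriv i (fun x => partialDeriv i w x
        * partialDeriv j (partialDeriv j w) x) x
      + partialDeriv j (fun x => -1 * (partialDeriv i w x * partialDeriv i (partialDeriv j w) x)) x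
      = partialDeriv i (partialDeriv i w) x * partialDeriv j (partialDeriv j w) x
      - partialDeriv j (partialDeriv i w) x ^ 2 := by
    intro x
    have dwi := differentiableAt_of_smooth (x := x) wi
    have dwij := differentiableAt_of_smooth (x := x) wij
    have dwjj := differentiableAt_of_smooth (x := x) wjj
    rw [partialDeriv_mul i dwi dwjj, partialDeriv_const_mul j _ (dwi.fun_mul dwij),
      partialDeriv_mul j dwi dwij, partialDeriv_comm j i wj.contDiffAt,
      partialDeriv_comm i j hw.contDiffAt]
    ring
  simpa only [hpt] using key

lemma integral_carleman_remainder (hw : ContDiff ℝ ∞ w) (hwc : HasCompactSupport w)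
    (hp : ContDiff ℝ ∞ p) (l : ℝ) :
    Integrable (fun x => 2 * (symmPart l (w x) (fun i => partialDeriv i p x)
          (fun i j => partialDeriv j (partialDeriv i w) x)
        * skewPart l (w x) (fun i => partialDeriv i w x) (fun i => partialDeriv i p x)
          (fun i j => partialDeriv j (partialDeriv i p) x))
      - carlemanForm l (w x) (fun i => partialDeriv i w x) (fun i => partialDeriv i p x)
          (fun i j => partialDeriv j (partialDeriv i p) x)
          (fun i j => partialDeriv i (partialDeriv j (partialDeriv j p)) x)) ∧
    ∫ x, (2 * (symmPart l (w x) (fun i => partialDeriv i p x)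
          (fun i j => partialDeriv j (partialDeriv i w) x)
        * skewPart l (w x) (fun i => partialDeriv i w x) (fun i => partialDeriv i p x)
          (fun i j => partialDeriv j (partialDeriv i p) x))
      - carlemanForm l (w x) (fun i => partialDeriv i w x) (fun i => partialDeriv i p x)
          (fun i j => partialDeriv j (partialDeriv i p) x)
          (fun i j => partialDeriv i (partialDeriv j (partialDeriv j p)) x)) = 0 := by
  simp only [symmPart, skewPart, carlemanForm, Finset.sum_mul_sum]
  simp only [Finset.mul_sum, ← Finset.sum_sub_distrib]
  refine ⟨integrable_finsetSum _ fun i _ => integrable_finsetSum _ fun j _ =>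
    (integral_cross_term hw hwc hp l i j).1, ?_⟩
  rw [integral_finsetSum _ fun i _ => integrable_finsetSum _ fun j _ =>
    (integral_cross_term hw hwc hp l i j).1]
  refine Finset.sum_eq_zero fun i _ => ?_
  rw [integral_finsetSum _ fun j _ => (integral_cross_term hw hwc hp l i j).1]
  exact Finset.sum_eq_zero fun j _ => (integral_cross_term hw hwc hp l i j).2

lemma integral_laplacian_sub_hessian (hw : ContDiff ℝ ∞ w) (hwc : HasCompactSupport w) :
    Integrable (fun x => (∑ i, partialDeriv i (partialDeriv i w) x) ^ 2
      - ∑ i, ∑ j, partialDeriv j (partialDeriv i w) x ^ 2) ∧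
    ∫ x, ((∑ i, partialDeriv i (partialDeriv i w) x) ^ 2
      - ∑ i, ∑ j, partialDeriv j (partialDeriv i w) x ^ 2) = 0 := by
  simp only [pow_two (∑ i, partialDeriv i (partialDeriv i w) _), Finset.sum_mul_sum,
    ← Finset.sum_sub_distrib]
  refine ⟨integrable_finsetSum _ fun i _ => integrable_finsetSum _ fun j _ =>
    (integral_hessian_term hw hwc i j).1, ?_⟩
  rw [integral_finsetSum _ fun i _ => integrable_finsetSum _ fun j _ =>
    (integral_hessian_term hw hwc i j).1]
  refine Finset.sum_eq_zero fun i _ => ?_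
  rw [integral_finsetSum _ fun j _ => (integral_hessian_term hw hwc i j).1]
  exact Finset.sum_eq_zero fun j _ => (integral_hessian_term hw hwc i j).2

end Smooth

/-! ### Conjugation of derivatives with the exponential weight. -/

section Conjugation

variable {d : ℕ} {u p : EuclideanSpace ℝ (Fin d) → ℝ}

lemma contDiff_exp_mul (hp : ContDiff ℝ ∞ p) (l : ℝ) :
    ContDiff ℝ ∞ (fun x => Real.exp (l * p x)) :=
  Real.contDiff_exp.comp (contDiff_const.mul hp)

lemma partialDeriv_exp_mul (hp : ContDiff ℝ ∞ p) (l : ℝ) (i : Fin d)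
    (x : EuclideanSpace ℝ (Fin d)) :
    partialDeriv i (fun x => Real.exp (l * p x)) x
      = Real.exp (l * p x) * (l * partialDeriv i p x) := by
  have dp := differentiableAt_of_smooth (x := x) hp
  rw [partialDeriv_comp (f := fun x => l * p x) i (Real.hasDerivAt_exp _) (dp.const_mul l),
    partialDeriv_const_mul i l dp]

lemma partialDeriv_conj (hu : ContDiff ℝ ∞ u) (hp : ContDiff ℝ ∞ p) (l : ℝ) (i : Fin d) :
    partialDeriv i (fun x => Real.exp (l * p x) * u x)
      = fun x => Real.exp (l * p x) * (partialDeriv i u x + l * (partialDeriv i p x * u x)) := by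
  ext x
  rw [partialDeriv_mul i (differentiableAt_of_smooth (contDiff_exp_mul hp l))
    (differentiableAt_of_smooth hu), partialDeriv_exp_mul hp]
  ring

lemma partialDeriv_partialDeriv_conj (hu : ContDiff ℝ ∞ u) (hp : ContDiff ℝ ∞ p) (l : ℝ)
    (i j : Fin d) (x : EuclideanSpace ℝ (Fin d)) :
    partialDeriv j (partialDeriv i (fun x => Real.exp (l * p x) * u x)) x
      = Real.exp (l * p x) * (partialDeriv j (partialDeriv i u) x
        + l * (partialDeriv j (partialDeriv i p) x * u x + partialDeriv i p x * partialDeriv j u x)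
        + l * partialDeriv j p x * (partialDeriv i u x + l * (partialDeriv i p x * u x))) := by
  have du := differentiableAt_of_smooth (x := x) hu
  have dui := differentiableAt_of_smooth (x := x) (contDiff_partialDeriv i hu)
  have dpi := differentiableAt_of_smooth (x := x) (contDiff_partialDeriv i hp)
  rw [partialDeriv_conj hu hp, partialDeriv_mul j (differentiableAt_of_smooth (contDiff_exp_mul hp l))
    (dui.fun_add ((dpi.fun_mul du).const_mul l)), partialDeriv_exp_mul hp,
    partialDeriv_add j dui ((dpi.fun_mul du).const_mul l),
    partialDeriv_const_mul j l (dpi.fun_mul du), partialDeriv_mul j dpi du]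
  ring

lemma exists_bound_of_hasCompactSupport {ι : Type*} [Finite ι]
    {f : ι → EuclideanSpace ℝ (Fin d) → ℝ}
    (hf : ∀ i, Continuous (f i)) (hc : ∀ i, HasCompactSupport (f i)) :
    ∃ M : ℝ, 1 ≤ M ∧ ∀ i x, |f i x| ≤ M := by
  have h : ∀ i, ∃ C, ∀ x, ‖f i x‖ ≤ C := fun i => (hc i).exists_bound_of_continuous (hf i)
  choose C hC using h
  obtain ⟨B, hB⟩ := (Set.finite_range C).bddAbove
  exact ⟨max 1 B, le_max_left _ _, fun i x =>
    (hC i x).trans ((hB ⟨i, rfl⟩).trans (le_max_right _ _))⟩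

lemma integral_add_three {f g h : EuclideanSpace ℝ (Fin d) → ℝ} (hf : Integrable f)
    (hg : Integrable g) (hh : Integrable h) {a b c : ℝ} :
    ∫ x, (a * f x + b * g x + c * h x) = a * (∫ x, f x) + b * (∫ x, g x) + c * ∫ x, h x := by
  have h1 := hf.const_mul a
  have h2 := hg.const_mul b
  rw [integral_add (h1.fun_add h2) (hh.const_mul c), integral_add h1 h2, integral_const_mul,
    integral_const_mul, integral_const_mul]

lemma integrable_sub_three {f g h : EuclideanSpace ℝ (Fin d) → ℝ} (hf : Integrable f)
    (hg : Integrable g) (hh : Integrable h) {a b c : ℝ} :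
    Integrable fun x => a * f x - b * g x - c * h x :=
  ((hf.const_mul a).sub (hg.const_mul b)).sub (hh.const_mul c)

lemma integral_sub_three {f g h : EuclideanSpace ℝ (Fin d) → ℝ} (hf : Integrable f)
    (hg : Integrable g) (hh : Integrable h) {a b c : ℝ} :
    ∫ x, (a * f x - b * g x - c * h x) = a * (∫ x, f x) - b * (∫ x, g x) - c * ∫ x, h x := by
  have h1 := hf.const_mul a
  have h2 := hg.const_mul b
  have h12 : Integrable fun x => a * f x - b * g x := h1.sub h2
  rw [integral_sub h12 (hh.const_mul c), integral_sub h1 h2, integral_const_mul,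
    integral_const_mul, integral_const_mul]

end Conjugation

/-! ### Integration of the pointwise inequality for test functions. -/

section SmoothEstimate

variable {d : ℕ} {φ : EuclideanSpace ℝ (Fin d) → ℝ} {K : Set (EuclideanSpace ℝ (Fin d))} {m : ℝ}

lemma carleman_smooth_pointwise (hd : 1 ≤ d) (hφ : ContDiff ℝ ∞ φ) (hm : 0 < m) {M : ℝ} (hM : 1 ≤ M)
    (hM1 : ∀ i x, |partialDeriv i φ x| ≤ M)
    (hM2 : ∀ i j x, |partialDeriv j (partialDeriv i φ) x| ≤ M)
    (hM3 : ∀ i j x, |partialDeriv i (partialDeriv j (partialDeriv j φ)) x| ≤ M)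
    (hconv : ∀ x ∈ K, ∀ ξ : Fin d → ℝ,
      m * ∑ i, ξ i ^ 2 ≤ ∑ i, ∑ j, ξ i * partialDeriv j (partialDeriv i φ) x * ξ j)
    (hgrad : ∀ x ∈ K, m ≤ ∑ i, partialDeriv i φ x ^ 2)
    {u w : EuclideanSpace ℝ (Fin d) → ℝ} (hu : ContDiff ℝ ∞ u) (huK : tsupport u ⊆ K)
    {l : ℝ} (hl : 1 ≤ l) (hlarge : d ^ 3 * M ^ 2 ≤ l ^ 2 * m ^ 3)
    (hw : w = fun x => Real.exp (l * φ x) * u x) (x : EuclideanSpace ℝ (Fin d)) :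
    l⁻¹ * (∑ i, ∑ j, Real.exp (2 * l * φ x) * partialDeriv j (partialDeriv i u) x ^ 2)
        + l ^ 3 * (Real.exp (2 * l * φ x) * u x ^ 2)
        + l * (Real.exp (2 * l * φ x) * ∑ i, partialDeriv i u x ^ 2)
      ≤ (20 + carlemanConst d m M)
          * (Real.exp (2 * l * φ x) * (∑ i, partialDeriv i (partialDeriv i u) x) ^ 2)
        - carlemanConst d m M *
          (2 * (symmPart l (w x) (fun i => partialDeriv i φ x)
              (fun i j => partialDeriv j (partialDeriv i w) x)
            * skewPart l (w x) (fun i => partialDeriv i w x) (fun i => partialDeriv i φ x)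
              (fun i j => partialDeriv j (partialDeriv i φ) x))
          - carlemanForm l (w x) (fun i => partialDeriv i w x) (fun i => partialDeriv i φ x)
              (fun i j => partialDeriv j (partialDeriv i φ) x)
              (fun i j => partialDeriv i (partialDeriv j (partialDeriv j φ)) x))
        - 5 * l⁻¹ * ((∑ i, partialDeriv i (partialDeriv i w) x) ^ 2
          - ∑ i, ∑ j, partialDeriv j (partialDeriv i w) x ^ 2) := by
  have hform : l * m * ∑ i, partialDeriv i w x ^ 2 + l ^ 3 * m ^ 2 * w x ^ 2
      ≤ carlemanForm l (w x) (fun i => partialDeriv i w x) (fun i => partialDeriv i φ x)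
              (fun i j => partialDeriv j (partialDeriv i φ) x)
              (fun i j => partialDeriv i (partialDeriv j (partialDeriv j φ)) x) := by
    -- Convexity is available only on `K`. Off the support of `u` the function `w` and its gradient
    -- vanish, so both sides are zero and the inequality holds on all of `ℝᵈ`, where it is
    -- integrated.
    by_cases hx : x ∈ tsupport u
    · exact carlemanForm_lower_bound hd hm hl (fun i j => hM3 i j x) (hconv x (huK hx) _)
        (hconv x (huK hx) _) (hgrad x (huK hx)) hlarge
    · have hwx : x ∉ tsupport w := fun h => hx (by
        rw [hw] at h
        exact tsupport_mul_subset_right' _ _ h)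
      have h0 : w x = 0 := image_eq_zero_of_notMem_tsupport hwx
      have h1 : ∀ i, partialDeriv i w x = 0 := fun i => partialDeriv_eq_zero_of_notMem i hwx
      simp [carlemanForm, h0, h1]
  have main := carleman_pointwise_inequality (w2 := fun i j => partialDeriv j (partialDeriv i w) x)
    hd hm hM hl (fun i => hM1 i x) (fun i j => hM2 i j x) hform
  have hexp : Real.exp (2 * l * φ x) = Real.exp (l * φ x) ^ 2 := by
    rw [← Real.exp_nat_mul]; congr 1; push_cast; ring
  have e0 : Real.exp (2 * l * φ x) * u x ^ 2 = w x ^ 2 := by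
    rw [hexp, hw, mul_pow]
  have e1 : Real.exp (2 * l * φ x) * ∑ i, partialDeriv i u x ^ 2
      = ∑ i, (partialDeriv i w x - l * partialDeriv i φ x * w x) ^ 2 := by
    rw [Finset.mul_sum]
    refine Finset.sum_congr rfl fun i _ => ?_
    rw [hw, partialDeriv_conj hu hφ, hexp, ← mul_pow]
    congr 1; ring
  have e2 : ∑ i, ∑ j, Real.exp (2 * l * φ x) * partialDeriv j (partialDeriv i u) x ^ 2
      = ∑ i, ∑ j, (partialDeriv j (partialDeriv i w) x - l * partialDeriv i φ x * partialDeriv j w x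
        - l * partialDeriv j φ x * partialDeriv i w x
        - l * partialDeriv j (partialDeriv i φ) x * w x
        + l ^ 2 * partialDeriv i φ x * partialDeriv j φ x * w x) ^ 2 := by
    refine Finset.sum_congr rfl fun i _ => Finset.sum_congr rfl fun j _ => ?_
    rw [hw, partialDeriv_partialDeriv_conj hu hφ, partialDeriv_conj hu hφ, partialDeriv_conj hu hφ,
      hexp, ← mul_pow]
    congr 1; ring
  have e3 : Real.exp (2 * l * φ x) * (∑ i, partialDeriv i (partialDeriv i u) x) ^ 2
      = (symmPart l (w x) (fun i => partialDeriv i φ x)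
              (fun i j => partialDeriv j (partialDeriv i w) x)
            + skewPart l (w x) (fun i => partialDeriv i w x) (fun i => partialDeriv i φ x)
              (fun i j => partialDeriv j (partialDeriv i φ) x)) ^ 2 := by
    rw [hexp, ← mul_pow]
    congr 1
    simp only [symmPart, skewPart, Finset.mul_sum, ← Finset.sum_add_distrib]
    refine Finset.sum_congr rfl fun i _ => ?_
    rw [hw, partialDeriv_partialDeriv_conj hu hφ, partialDeriv_conj hu hφ]
    ring
  rw [e0, e1, e2, e3]
  exact main

/-- The Carleman estimate for smooth functions supported in a set on which the weight function is
uniformly convex without critical points. -/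
theorem carleman_smooth (hd : 1 ≤ d) (hφ : ContDiff ℝ ∞ φ) (hφc : HasCompactSupport φ)
    (hm : 0 < m)
    (hconv : ∀ x ∈ K, ∀ ξ : Fin d → ℝ,
      m * ∑ i, ξ i ^ 2 ≤ ∑ i, ∑ j, ξ i * partialDeriv j (partialDeriv i φ) x * ξ j)
    (hgrad : ∀ x ∈ K, m ≤ ∑ i, partialDeriv i φ x ^ 2) :
    ∃ C : ℝ, 0 < C ∧ ∃ l₀ : ℝ, 1 < l₀ ∧ ∀ u : EuclideanSpace ℝ (Fin d) → ℝ, ContDiff ℝ ∞ u →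
      HasCompactSupport u → tsupport u ⊆ K → ∀ l : ℝ, l₀ ≤ l →
        l⁻¹ * (∑ i, ∑ j, ∫ x, Real.exp (2 * l * φ x) * partialDeriv j (partialDeriv i u) x ^ 2)
          + l ^ 3 * (∫ x, Real.exp (2 * l * φ x) * u x ^ 2)
          + l * (∫ x, Real.exp (2 * l * φ x) * ∑ i, partialDeriv i u x ^ 2)
        ≤ C * ∫ x, Real.exp (2 * l * φ x) * (∑ i, partialDeriv i (partialDeriv i u) x) ^ 2 := by
  have s1 := fun i => contDiff_partialDeriv i hφ
  have s2 := fun i j => contDiff_partialDeriv j (s1 i)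
  have s3 := fun i j => contDiff_partialDeriv i (s2 j j)
  have c1 := fun i => hasCompactSupport_partialDeriv i hφc
  have c2 := fun i j => hasCompactSupport_partialDeriv j (c1 i)
  have c3 := fun i j => hasCompactSupport_partialDeriv i (c2 j j)
  obtain ⟨M1, hM1, hb1⟩ := exists_bound_of_hasCompactSupport (fun i => (s1 i).continuous) c1
  obtain ⟨M2, hM2, hb2⟩ := exists_bound_of_hasCompactSupport
    (f := fun q : Fin d × Fin d => partialDeriv q.2 (partialDeriv q.1 φ))
    (fun q => (s2 q.1 q.2).continuous) (fun q => c2 q.1 q.2)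
  obtain ⟨M3, hM3, hb3⟩ := exists_bound_of_hasCompactSupport
    (f := fun q : Fin d × Fin d => partialDeriv q.1 (partialDeriv q.2 (partialDeriv q.2 φ)))
    (fun q => (s3 q.1 q.2).continuous) (fun q => c3 q.1 q.2)
  set M := M1 + M2 + M3 with hMdef
  have hM : 1 ≤ M := by linarith
  set c := d ^ 3 * M ^ 2 / m ^ 3 with hc
  have hc0 : 0 ≤ c := by positivity
  have hK0 : 0 ≤ carlemanConst d m M := by rw [carlemanConst]; positivity
  -- The threshold `2 + c` exceeds 1 and forces `l² ≥ c`, which is exactly the largeness condition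
  -- `d³ M² ≤ l² m³`. The bound `M` on three derivatives of `φ` is global because `φ` has compact
  -- support.
  refine ⟨20 + carlemanConst d m M, by positivity, 2 + c, by linarith, ?_⟩
  intro u hu huc huK l hl
  have hl1 : 1 ≤ l := by linarith
  have hlarge : d ^ 3 * M ^ 2 ≤ l ^ 2 * m ^ 3 := by
    rw [← div_le_iff₀ (by positivity), ← hc]
    nlinarith
  set w : EuclideanSpace ℝ (Fin d) → ℝ := fun x => Real.exp (l * φ x) * u x with hw
  have hws : ContDiff ℝ ∞ w := (contDiff_exp_mul hφ l).mul hu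
  have hwc : HasCompactSupport w := huc.mul_left
  have hpt := carleman_smooth_pointwise hd hφ hm hM
    (fun i x => (hb1 i x).trans (by linarith)) (fun i j x => (hb2 (i, j) x).trans (by linarith))
    (fun i j x => (hb3 (i, j) x).trans (by linarith)) hconv hgrad hu huK hl1 hlarge hw
  obtain ⟨hR, hR0⟩ := integral_carleman_remainder hws hwc hφ l
  obtain ⟨hD, hD0⟩ := integral_laplacian_sub_hessian hws hwc
  have he := (contDiff_exp_mul hφ (2 * l)).continuous
  have i0 : Integrable fun x => Real.exp (2 * l * φ x) * u x ^ 2 :=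
    integrable_of_test (he.mul (hu.continuous.pow 2))
      (HasCompactSupport.mul_left (by simp only [pow_two]; exact huc.mul_left))
  have u1 := fun i => contDiff_partialDeriv i hu
  have u2 := fun i j => contDiff_partialDeriv j (u1 i)
  have k1 := fun i => hasCompactSupport_partialDeriv i huc
  have k2 := fun i j => hasCompactSupport_partialDeriv j (k1 i)
  have i2 : ∀ i j, Integrable fun x =>
      Real.exp (2 * l * φ x) * partialDeriv j (partialDeriv i u) x ^ 2 := fun i j =>
    integrable_of_test (he.mul ((u2 i j).continuous.pow 2))
      (HasCompactSupport.mul_left (by simp only [pow_two]; exact (k2 i j).mul_left))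
  have i1 : Integrable fun x => Real.exp (2 * l * φ x) * ∑ i, partialDeriv i u x ^ 2 := by
    simp only [Finset.mul_sum]
    exact integrable_finsetSum _ fun i _ =>
      integrable_of_test (he.mul ((u1 i).continuous.pow 2))
      (HasCompactSupport.mul_left (by simp only [pow_two]; exact (k1 i).mul_left))
  have i3 : Integrable fun x =>
      Real.exp (2 * l * φ x) * (∑ i, partialDeriv i (partialDeriv i u) x) ^ 2 := by
    simp only [pow_two, Finset.sum_mul_sum]
    simp only [Finset.mul_sum]
    exact integrable_finsetSum _ fun i _ => integrable_finsetSum _ fun j _ =>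
      integrable_of_test (he.mul ((u2 i i).continuous.mul (u2 j j).continuous))
      (HasCompactSupport.mul_left (k2 i i).mul_right)
  have i2' : Integrable fun x =>
      ∑ i, ∑ j, Real.exp (2 * l * φ x) * partialDeriv j (partialDeriv i u) x ^ 2 :=
    integrable_finsetSum _ fun i _ => integrable_finsetSum _ fun j _ => i2 i j
  have hint := integral_mono (((i2'.const_mul l⁻¹).fun_add (i0.const_mul (l ^ 3))).fun_add (i1.const_mul l))
    (integrable_sub_three i3 hR hD) hpt
  rw [integral_add_three i2' i0 i1, integral_sub_three i3 hR hD, hR0, hD0,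
    integral_finsetSum _ fun i _ => integrable_finsetSum _ fun j _ => i2 i j] at hint
  simp only [integral_finsetSum _ fun j _ => i2 _ j] at hint
  linarith

end SmoothEstimate

/-! ### Slicing along a coordinate direction -/

section OneDim

lemma setIntegral_Ioo_deriv {f f' : ℝ → ℝ} (hf : ∀ t, HasDerivAt f (f' t) t)
    (hf' : Continuous f') {a b : ℝ} (hab : a ≤ b) : ∫ t in Set.Ioo a b, f' t = f b - f a := by
  rw [← integral_Ioc_eq_integral_Ioo, ← intervalIntegral.integral_of_le hab]
  exact intervalIntegral.integral_eq_sub_of_hasDerivAt (fun t _ => hf t)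
    (hf'.intervalIntegrable a b)

/-- Integrating the derivative of a function that vanishes at the ends of an interval over the
sublevel set of a strictly monotone function leaves at most one boundary value. -/
lemma setIntegral_deriv_sublevel {f f' σ : ℝ → ℝ} (hf : ∀ t, HasDerivAt f (f' t) t)
    (hf' : Continuous f') {a b : ℝ} (hab : a ≤ b) (ha : f a = 0) (hb : f b = 0)
    (hσc : ContinuousOn σ (Set.Ioo a b))
    (hσ : StrictMonoOn σ (Set.Ioo a b) ∨ StrictAntiOn σ (Set.Ioo a b)) :
    (∫ t in {t ∈ Set.Ioo a b | σ t < 0}, f' t = 0) ∨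
      ∃ t ∈ Set.Ioo a b, σ t = 0 ∧ |∫ t in {t ∈ Set.Ioo a b | σ t < 0}, f' t| ≤ |f t| := by
  by_cases hz : ∃ t ∈ Set.Ioo a b, σ t = 0
  · obtain ⟨t, ht, ht0⟩ := hz
    refine Or.inr ⟨t, ht, ht0, le_of_eq ?_⟩
    rcases hσ with h | h
    · have : {s ∈ Set.Ioo a b | σ s < 0} = Set.Ioo a t := by
        ext s
        constructor
        · rintro ⟨hs, hs0⟩
          exact ⟨hs.1, (h.lt_iff_lt hs ht).1 (by rw [ht0]; exact hs0)⟩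
        · intro hs
          have hs' : s ∈ Set.Ioo a b := ⟨hs.1, hs.2.trans ht.2⟩
          exact ⟨hs', by rw [← ht0]; exact h hs' ht hs.2⟩
      rw [this, setIntegral_Ioo_deriv hf hf' ht.1.le, ha, sub_zero]
    · have : {s ∈ Set.Ioo a b | σ s < 0} = Set.Ioo t b := by
        ext s
        constructor
        · rintro ⟨hs, hs0⟩
          exact ⟨(h.lt_iff_gt hs ht).1 (by rw [ht0]; exact hs0), hs.2⟩
        · intro hs
          have hs' : s ∈ Set.Ioo a b := ⟨ht.1.trans hs.1, hs.2⟩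
          exact ⟨hs', by rw [← ht0]; exact h ht hs' hs.1⟩
      rw [this, setIntegral_Ioo_deriv hf hf' ht.2.le, hb, zero_sub, abs_neg]
  · left
    by_cases hneg : ∃ s ∈ Set.Ioo a b, σ s < 0
    · obtain ⟨s, hs, hs0⟩ := hneg
      have : {s ∈ Set.Ioo a b | σ s < 0} = Set.Ioo a b := by
        refine Set.Subset.antisymm (fun _ h => h.1) fun r hr => ⟨hr, ?_⟩
        by_contra hr0
        obtain ⟨t, ht, ht0⟩ := isPreconnected_Ioo.intermediate_value hs hr hσc
          ⟨hs0.le, not_lt.1 hr0⟩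
        exact hz ⟨t, ht, ht0⟩
      rw [this, setIntegral_Ioo_deriv hf hf' hab, ha, hb, sub_zero]
    · have : {s ∈ Set.Ioo a b | σ s < 0} = ∅ :=
        Set.eq_empty_of_forall_notMem fun s hs => hneg ⟨s, hs.1, hs.2⟩
      rw [this]; simp

end OneDim

/-! ### Fubini in one coordinate, and comparison of a Hausdorff measure with its projection. -/

section Slices

variable {n : ℕ}

/-- The coordinates of a point other than the `k`-th one. -/
def dropCoord (k : Fin (n + 1)) (x : EuclideanSpace ℝ (Fin (n + 1))) : Fin n → ℝ :=
  fun j => x (k.succAbove j)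

/-- The point with `k`-th coordinate `t` and the other coordinates `y`. -/
def insertCoord (k : Fin (n + 1)) (t : ℝ) (y : Fin n → ℝ) : EuclideanSpace ℝ (Fin (n + 1)) :=
  WithLp.toLp 2 (k.insertNth t y)

@[simp] lemma insertCoord_same (k : Fin (n + 1)) (t : ℝ) (y : Fin n → ℝ) :
    insertCoord k t y k = t := by simp [insertCoord]

@[simp] lemma insertCoord_succAbove (k : Fin (n + 1)) (t : ℝ) (y : Fin n → ℝ) (j : Fin n) :
    insertCoord k t y (k.succAbove j) = y j := by simp [insertCoord]

@[simp] lemma dropCoord_insertCoord (k : Fin (n + 1)) (t : ℝ) (y : Fin n → ℝ) :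
    dropCoord k (insertCoord k t y) = y := by ext j; simp [dropCoord]

lemma hasDerivAt_insertCoord (k : Fin (n + 1)) (t : ℝ) (y : Fin n → ℝ) :
    HasDerivAt (fun s => insertCoord k s y) (EuclideanSpace.single k 1) t := by
  have h : (fun s => insertCoord k s y)
      = fun s => insertCoord k 0 y + s • EuclideanSpace.single k (1 : ℝ) := by
    ext s i
    rcases Fin.eq_self_or_eq_succAbove k i with rfl | ⟨j, rfl⟩
    · simp
    · simp
  rw [h]
  simpa using ((hasDerivAt_id t).smul_const (EuclideanSpace.single k (1 : ℝ))).const_add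
    (insertCoord k 0 y)

lemma hasDerivAt_comp_insertCoord {f : EuclideanSpace ℝ (Fin (n + 1)) → ℝ} (k : Fin (n + 1))
    {t : ℝ} {y : Fin n → ℝ} (hf : DifferentiableAt ℝ f (insertCoord k t y)) :
    HasDerivAt (fun s => f (insertCoord k s y)) (partialDeriv k f (insertCoord k t y)) t :=
  hf.hasFDerivAt.comp_hasDerivAt t (hasDerivAt_insertCoord k t y)

lemma continuous_insertCoord_left (k : Fin (n + 1)) (y : Fin n → ℝ) :
    Continuous fun t => insertCoord k t y :=
  continuous_iff_continuousAt.2 fun t => (hasDerivAt_insertCoord k t y).continuousAt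

lemma lipschitzWith_dropCoord (k : Fin (n + 1)) : LipschitzWith 1 (dropCoord k) := by
  refine LipschitzWith.of_dist_le_mul fun x y => ?_
  rw [NNReal.coe_one, one_mul]
  refine (dist_pi_le_iff dist_nonneg).2 fun j => ?_
  exact PiLp.dist_apply_le x y _

/-- Splitting off the `k`-th coordinate, as a measurable equivalence. -/
def splitCoord (k : Fin (n + 1)) : EuclideanSpace ℝ (Fin (n + 1)) ≃ᵐ ℝ × (Fin n → ℝ) :=
  (MeasurableEquiv.toLp 2 (Fin (n + 1) → ℝ)).symm.trans
    (MeasurableEquiv.piFinSuccAbove (fun _ => ℝ) k)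

lemma measurePreserving_splitCoord (k : Fin (n + 1)) :
    MeasurePreserving (splitCoord k) volume volume :=
  (EuclideanSpace.volume_preserving_symm_measurableEquiv_toLp _).trans
    (volume_preserving_piFinSuccAbove (fun _ => ℝ) k)

lemma integrable_comp_insertCoord (k : Fin (n + 1)) {f : EuclideanSpace ℝ (Fin (n + 1)) → ℝ}
    (hf : Integrable f) :
    Integrable (fun z : ℝ × (Fin n → ℝ) => f (insertCoord k z.1 z.2))
      ((volume : Measure ℝ).prod (volume : Measure (Fin n → ℝ))) :=
  ((measurePreserving_splitCoord k).symm.integrable_comp_emb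
    (splitCoord k).symm.measurableEmbedding).2 hf

lemma integral_eq_integral_slices (k : Fin (n + 1)) {f : EuclideanSpace ℝ (Fin (n + 1)) → ℝ}
    (hf : Integrable f) : ∫ x, f x = ∫ y, ∫ t, f (insertCoord k t y) := by
  rw [← integral_prod_symm _ (integrable_comp_insertCoord k hf),
    ← (measurePreserving_splitCoord k).symm.integral_comp
      (splitCoord k).symm.measurableEmbedding f]
  rfl

/-- By the layer cake formula it is enough to compare superlevel sets: `{g > t}` lies in the
projection of `{f > t} ∩ s`, and a 1-Lipschitz map does not increase Hausdorff measure. No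
measurable choice of the point `x` over `y` is needed. The target carries the sup norm, for which
`n`-dimensional Hausdorff measure is Lebesgue measure with no constant. -/
lemma lintegral_le_of_forall_section (k : Fin (n + 1))
    {s : Set (EuclideanSpace ℝ (Fin (n + 1)))}
    {f : EuclideanSpace ℝ (Fin (n + 1)) → ℝ} (hf : Measurable f) (hf0 : ∀ x, 0 ≤ f x)
    {g : (Fin n → ℝ) → ℝ} (hg : AEMeasurable g) (hg0 : ∀ y, 0 ≤ g y)
    (h : ∀ y, g y = 0 ∨ ∃ x ∈ s, dropCoord k x = y ∧ g y ≤ f x) :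
    ∫⁻ y, ENNReal.ofReal (g y)
      ≤ ∫⁻ x, ENNReal.ofReal (f x) ∂((Measure.hausdorffMeasure (n : ℝ)).restrict s) := by
  rw [lintegral_eq_lintegral_meas_lt _ (Eventually.of_forall hg0) hg,
    lintegral_eq_lintegral_meas_lt _ (Eventually.of_forall hf0) hf.aemeasurable]
  refine setLIntegral_mono' measurableSet_Ioi fun t ht => ?_
  rw [Measure.restrict_apply (measurableSet_lt measurable_const hf)]
  have hvol : (volume : Measure (Fin n → ℝ)) = Measure.hausdorffMeasure (n : ℝ) := by
    rw [← hausdorffMeasure_pi_real, Fintype.card_fin]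
  rw [hvol]
  calc Measure.hausdorffMeasure (n : ℝ) {y | t < g y}
      ≤ Measure.hausdorffMeasure (n : ℝ) (dropCoord k '' ({x | t < f x} ∩ s)) := by
        refine measure_mono fun y hy => ?_
        have hy' : t < g y := hy
        have ht' : (0 : ℝ) < t := ht
        rcases h y with h0 | ⟨x, hxs, hxy, hle⟩
        · linarith
        · exact ⟨x, ⟨hy'.trans_le hle, hxs⟩, hxy⟩
    _ ≤ _ := by
        simpa using (lipschitzWith_dropCoord k).lipschitzOnWith.hausdorffMeasure_image_le
          (s := {x | t < f x} ∩ s) n.cast_nonneg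

end Slices

/-! ### Coordinate boxes at boundary points -/

section Charts

variable {d : ℕ}

/-- The open cube with centre `p` and half-side `ε`. -/
def coordBox (p : EuclideanSpace ℝ (Fin d)) (ε : ℝ) : Set (EuclideanSpace ℝ (Fin d)) :=
  {x | ∀ j, |x j - p j| < ε}

lemma isOpen_coordBox (p : EuclideanSpace ℝ (Fin d)) (ε : ℝ) : IsOpen (coordBox p ε) := by
  have : coordBox p ε = ⋂ j, {x | |x j - p j| < ε} := by ext; simp [coordBox]
  rw [this]
  exact isOpen_iInter_of_finite fun j => isOpen_lt (by fun_prop) continuous_const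

lemma mem_coordBox_self (p : EuclideanSpace ℝ (Fin d)) {ε : ℝ} (hε : 0 < ε) :
    p ∈ coordBox p ε := by
  intro j; simpa using hε

lemma exists_coordBox_subset {p : EuclideanSpace ℝ (Fin d)} {U : Set (EuclideanSpace ℝ (Fin d))}
    (hU : U ∈ 𝓝 p) : ∃ ε > 0, coordBox p ε ⊆ U := by
  obtain ⟨δ, hδ, hδU⟩ := Metric.mem_nhds_iff.1 hU
  -- With `d + 1` in place of a square root, `d (δ / (d + 1))² < δ²` holds also for `d = 0`.
  refine ⟨δ / (d + 1), by positivity, fun x hx => hδU ?_⟩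
  rw [Metric.mem_ball, dist_eq_norm, EuclideanSpace.norm_eq]
  have hd1 : (0 : ℝ) < d + 1 := by positivity
  have hsum : ∑ i, ‖(x - p) i‖ ^ 2 ≤ d * (δ / (d + 1)) ^ 2 := by
    calc ∑ i, ‖(x - p) i‖ ^ 2 ≤ ∑ _i : Fin d, (δ / (d + 1)) ^ 2 := by
          refine Finset.sum_le_sum fun i _ => ?_
          have := hx i
          rw [Real.norm_eq_abs]
          exact pow_le_pow_left₀ (abs_nonneg _) (by simpa using this.le) 2
      _ = _ := by simp
  rw [Real.sqrt_lt' hδ]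
  refine hsum.trans_lt ?_
  rw [div_pow, ← mul_div_assoc, div_lt_iff₀ (by positivity)]
  nlinarith [sq_pos_of_pos hδ, (Nat.cast_nonneg d : (0 : ℝ) ≤ d),
    mul_nonneg (Nat.cast_nonneg d : (0 : ℝ) ≤ d) (sq_nonneg δ),
    mul_nonneg (sq_nonneg (d : ℝ)) (sq_nonneg δ)]

/-- A box around a boundary point in which `Ω` is the sublevel set of a smooth function `ρ` whose
derivative in the `k`-th coordinate direction does not vanish. -/
structure IsBoundaryBox (Ω : Set (EuclideanSpace ℝ (Fin d))) (Q : Set (EuclideanSpace ℝ (Fin d)))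
    (k : Fin d) (ρ : EuclideanSpace ℝ (Fin d) → ℝ) : Prop where
  exists_eq : ∃ (p : EuclideanSpace ℝ (Fin d)) (ε : ℝ), Q = coordBox p ε
  contDiffAt : ∀ x ∈ Q, ContDiffAt ℝ ∞ ρ x
  partialDeriv_ne : ∀ x ∈ Q, partialDeriv k ρ x ≠ 0
  mem_iff : ∀ x ∈ Q, x ∈ Ω ↔ ρ x < 0
  normal : ∀ x ∈ Q, x ∈ frontier Ω →
    IsOutwardUnitNormal Ω x (‖gradient ρ x‖⁻¹ • gradient ρ x)

lemma IsBoundaryBox.isOpen {Ω Q : Set (EuclideanSpace ℝ (Fin d))} {k : Fin d}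
    {ρ : EuclideanSpace ℝ (Fin d) → ℝ} (h : IsBoundaryBox Ω Q k ρ) : IsOpen Q := by
  obtain ⟨p, ε, rfl⟩ := h.exists_eq
  exact isOpen_coordBox p ε

lemma exists_isBoundaryBox {Ω : Set (EuclideanSpace ℝ (Fin d))} (hΩ : HasSmoothBoundary Ω)
    {p : EuclideanSpace ℝ (Fin d)} (hp : p ∈ frontier Ω) :
    ∃ Q k ρ, p ∈ Q ∧ IsBoundaryBox Ω Q k ρ := by
  obtain ⟨U, ρ, hpU, h⟩ := hΩ p hp
  have hcd : ∀ x ∈ U, ContDiffAt ℝ ∞ ρ x := fun x hx =>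
    h.contDiffOn.contDiffAt (h.isOpen.mem_nhds hx)
  obtain ⟨k, hk⟩ : ∃ k, partialDeriv k ρ p ≠ 0 := by
    by_contra hcon
    push Not at hcon
    refine h.gradient_ne_zero p hpU ?_
    ext i
    rw [gradient_apply, hcon i]; rfl
  have hev : ∀ᶠ x in 𝓝 p, partialDeriv k ρ x ≠ 0 :=
    (contDiffAt_partialDeriv k (hcd p hpU)).continuousAt.eventually_ne hk
  obtain ⟨ε, hε, hεU⟩ := exists_coordBox_subset (inter_mem (h.isOpen.mem_nhds hpU) hev)
  refine ⟨coordBox p ε, k, ρ, mem_coordBox_self p hε, ⟨p, ε, rfl⟩,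
    fun x hx => hcd x (hεU hx).1, fun x hx => (hεU hx).2, fun x hx => ?_, fun x hx hxf =>
    ⟨hxf, U, ρ, (hεU hx).1, h, rfl⟩⟩
  have : x ∈ Ω ∩ U ↔ x ∈ {x ∈ U | ρ x < 0} := by rw [h.inter_eq]
  simpa [(hεU hx).1] using this

/-- If a zero of `ρ` were outside `closure Ω`, then `ρ ≥ 0` near it, so it would be a local minimum
of `ρ`, against `∂_k ρ ≠ 0`. -/
lemma IsBoundaryBox.mem_frontier {Ω Q : Set (EuclideanSpace ℝ (Fin d))} {k : Fin d}
    {ρ : EuclideanSpace ℝ (Fin d) → ℝ} (h : IsBoundaryBox Ω Q k ρ)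
    {x : EuclideanSpace ℝ (Fin d)} (hx : x ∈ Q) (h0 : ρ x = 0) : x ∈ frontier Ω := by
  have hxΩ : x ∉ Ω := fun hm => by
    have := (h.mem_iff x hx).1 hm
    linarith
  refine ⟨?_, fun hi => hxΩ (interior_subset hi)⟩
  by_contra hcl
  have hmin : IsLocalMin ρ x := by
    filter_upwards [h.isOpen.mem_nhds hx, isClosed_closure.isOpen_compl.mem_nhds hcl] with y hyQ hy
    rw [h0]
    by_contra hneg
    exact hy (subset_closure ((h.mem_iff y hyQ).2 (not_le.1 hneg)))
  refine h.partialDeriv_ne x hx ?_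
  rw [partialDeriv, hmin.fderiv_eq_zero]; rfl

end Charts

/-! ### Slices of a boundary box in the transversal direction. -/

section Slab

variable {n : ℕ} {Ω Q : Set (EuclideanSpace ℝ (Fin (n + 1)))} {k : Fin (n + 1)}
  {ρ : EuclideanSpace ℝ (Fin (n + 1)) → ℝ}

lemma insertCoord_mem_coordBox {p : EuclideanSpace ℝ (Fin (n + 1))} {ε t : ℝ} {y : Fin n → ℝ} :
    insertCoord k t y ∈ coordBox p ε ↔
      t ∈ Set.Ioo (p k - ε) (p k + ε) ∧ ∀ j, |y j - p (k.succAbove j)| < ε := by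
  simp only [coordBox, Set.mem_ofPred_eq, Fin.forall_iff_succAbove k, insertCoord_same,
    insertCoord_succAbove, abs_lt, Set.mem_Ioo]
  constructor
  · rintro ⟨h1, h2⟩
    exact ⟨⟨by linarith, by linarith⟩, h2⟩
  · rintro ⟨h1, h2⟩
    exact ⟨⟨by linarith, by linarith⟩, h2⟩

/-- On each line in direction `k` the function `ρ` is strictly monotone, so `Ω` meets the box in an
interval with at most one endpoint inside the box; the other contribution vanishes with `w` on the
faces of the box. -/
lemma slice_integral_le (hQ : IsBoundaryBox Ω Q k ρ) {w : EuclideanSpace ℝ (Fin (n + 1)) → ℝ}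
    (hw : ContDiff ℝ ∞ w) (hwQ : tsupport w ⊆ Q) (y : Fin n → ℝ) :
    (∫ t, Ω.indicator (partialDeriv k w) (insertCoord k t y) = 0) ∨
      ∃ x ∈ frontier Ω, dropCoord k x = y ∧
        |∫ t, Ω.indicator (partialDeriv k w) (insertCoord k t y)| ≤ |w x| := by
  obtain ⟨p, ε, rfl⟩ := hQ.exists_eq
  have hzero : ∀ x, x ∉ coordBox p ε → w x = 0 ∧ partialDeriv k w x = 0 := fun x hx =>
    ⟨image_eq_zero_of_notMem_tsupport fun h => hx (hwQ h),
      partialDeriv_eq_zero_of_notMem k fun h => hx (hwQ h)⟩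
  -- The condition `0 ≤ ε` matters for `n = 0`, where the condition on `y` is empty and does not
  -- exclude an empty box.
  by_cases hy : (∀ j, |y j - p (k.succAbove j)| < ε) ∧ 0 ≤ ε
  swap
  · left
    have : ∀ t, Ω.indicator (partialDeriv k w) (insertCoord k t y) = 0 := fun t => by
      have hnot : insertCoord k t y ∉ coordBox p ε := fun h => by
        rw [insertCoord_mem_coordBox] at h
        refine hy ⟨h.2, ?_⟩
        have := h.1.1.trans h.1.2
        linarith
      simp [Set.indicator, (hzero _ hnot).2]
    simp [this]
  obtain ⟨hy, hε⟩ := hy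
  set a := p k - ε
  set b := p k + ε
  have hmem : ∀ t ∈ Set.Ioo a b, insertCoord k t y ∈ coordBox p ε := fun t ht =>
    insertCoord_mem_coordBox.2 ⟨ht, hy⟩
  have hnmem : ∀ t ∉ Set.Ioo a b, insertCoord k t y ∉ coordBox p ε := fun t ht h =>
    ht (insertCoord_mem_coordBox.1 h).1
  have hderiv : ∀ t ∈ Set.Ioo a b, HasDerivAt (fun s => ρ (insertCoord k s y))
      (partialDeriv k ρ (insertCoord k t y)) t := fun t ht =>
    hasDerivAt_comp_insertCoord k ((hQ.contDiffAt _ (hmem t ht)).differentiableAt (by simp))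
  have hcont : ContinuousOn (fun s => ρ (insertCoord k s y)) (Set.Ioo a b) := fun t ht =>
    (hderiv t ht).continuousAt.continuousWithinAt
  have hmono : StrictMonoOn (fun s => ρ (insertCoord k s y)) (Set.Ioo a b) ∨
      StrictAntiOn (fun s => ρ (insertCoord k s y)) (Set.Ioo a b) := by
    -- Darboux: a derivative without zeros on an interval has constant sign.
    rcases hasDerivWithinAt_forall_lt_or_forall_gt_of_forall_ne (convex_Ioo a b)
      (fun t ht => (hderiv t ht).hasDerivWithinAt)
      (fun t ht => hQ.partialDeriv_ne _ (hmem t ht)) with hneg | hpos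
    · exact Or.inr (strictAntiOn_of_deriv_neg (convex_Ioo a b) hcont fun t ht => by
        rw [interior_Ioo] at ht
        rw [(hderiv t ht).deriv]
        exact hneg t ht)
    · exact Or.inl (strictMonoOn_of_deriv_pos (convex_Ioo a b) hcont fun t ht => by
        rw [interior_Ioo] at ht
        rw [(hderiv t ht).deriv]
        exact hpos t ht)
  have hint : ∫ t, Ω.indicator (partialDeriv k w) (insertCoord k t y)
      = ∫ t in {t ∈ Set.Ioo a b | ρ (insertCoord k t y) < 0},
          partialDeriv k w (insertCoord k t y) := by
    have hopen : IsOpen {t ∈ Set.Ioo a b | ρ (insertCoord k t y) < 0} :=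
      hcont.isOpen_inter_preimage isOpen_Ioo isOpen_Iio
    rw [← integral_indicator hopen.measurableSet]
    congr 1
    ext t
    by_cases ht : t ∈ Set.Ioo a b
    · have := hQ.mem_iff _ (hmem t ht)
      simp only [Set.indicator, this, Set.mem_ofPred_eq, ht, true_and]
    · simp [Set.indicator, (hzero _ (hnmem t ht)).2]
  rw [hint]
  rcases setIntegral_deriv_sublevel (f := fun t => w (insertCoord k t y))
    (f' := fun t => partialDeriv k w (insertCoord k t y))
    (fun t => hasDerivAt_comp_insertCoord k (differentiableAt_of_smooth hw))
    ((contDiff_partialDeriv k hw).continuous.comp (continuous_insertCoord_left k y))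
    (show a ≤ b by simp only [a, b]; linarith)
    (hzero _ (hnmem a (by simp))).1 (hzero _ (hnmem b (by simp))).1 hcont hmono with h | h
  · exact Or.inl h
  · obtain ⟨t, ht, ht0, hle⟩ := h
    exact Or.inr ⟨insertCoord k t y, hQ.mem_frontier (hmem t ht) ht0, by simp, hle⟩

lemma slice_integral_support {w : EuclideanSpace ℝ (Fin (n + 1)) → ℝ} (hwQ : tsupport w ⊆ Q) :
    Function.support (fun y => ∫ t, Ω.indicator (partialDeriv k w) (insertCoord k t y))
      ⊆ dropCoord k '' Q := by
  intro y hy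
  by_contra hyQ
  refine hy ?_
  have : ∀ t, Ω.indicator (partialDeriv k w) (insertCoord k t y) = 0 := fun t => by
    have hnot : insertCoord k t y ∉ Q := fun h => hyQ ⟨_, h, by simp⟩
    have : partialDeriv k w (insertCoord k t y) = 0 :=
      partialDeriv_eq_zero_of_notMem k fun h => hnot (hwQ h)
    simp [Set.indicator, this]
  simp [this]

lemma volume_dropCoord_image_lt_top (hQ : IsBoundaryBox Ω Q k ρ) :
    volume (dropCoord k '' Q) < ⊤ := by
  obtain ⟨p, ε, rfl⟩ := hQ.exists_eq
  refine Bornology.IsBounded.measure_lt_top ?_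
  refine (Metric.isBounded_closedBall (x := dropCoord k p) (r := |ε|)).subset ?_
  rintro _ ⟨x, hx, rfl⟩
  refine (dist_pi_le_iff (abs_nonneg ε)).2 fun j => ?_
  exact (hx _).le.trans (le_abs_self ε)

/-- The integral over `Ω` of the derivative in the transversal direction is controlled by the
boundary values. -/
lemma exists_bound_setIntegral_partialDeriv_transversal (hΩ : IsOpen Ω)
    (hQ : IsBoundaryBox Ω Q k ρ) :
    ∃ C : ℝ≥0∞, C ≠ ⊤ ∧ ∀ w : EuclideanSpace ℝ (Fin (n + 1)) → ℝ, ContDiff ℝ ∞ w →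
      HasCompactSupport w → tsupport w ⊆ Q →
        ‖∫ x in Ω, partialDeriv k w x‖ₑ ≤ C * eLpNorm w 2 (surfaceMeasure Ω) := by
  refine ⟨volume (dropCoord k '' Q) ^ (1 / 2 : ℝ),
    (ENNReal.rpow_lt_top_of_nonneg (by positivity) (volume_dropCoord_image_lt_top hQ).ne).ne, ?_⟩
  intro w hw hwc hwQ
  have hint : Integrable (Ω.indicator (partialDeriv k w)) :=
    (integrable_of_test (contDiff_partialDeriv k hw).continuous
      (hasCompactSupport_partialDeriv k hwc)).indicator hΩ.measurableSet
  set I : (Fin n → ℝ) → ℝ := fun y => ∫ t, Ω.indicator (partialDeriv k w) (insertCoord k t y)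
    with hI
  have hIi : Integrable I := (integrable_comp_insertCoord k hint).integral_prod_right
  have hIm : AEStronglyMeasurable I := hIi.aestronglyMeasurable
  -- The slice integrals are dominated by boundary values lying over the same `y`, so their `L²`
  -- norm is at most the surface `L²` norm of `w`. Hölder on the bounded projection of the box,
  -- below, passes from `L¹` to `L²` and produces the constant.
  have h2 : eLpNorm I 2 volume ≤ eLpNorm w 2 (surfaceMeasure Ω) := by
    rw [eLpNorm_eq_lintegral_rpow_enorm_toReal (by simp) (by simp),
      eLpNorm_eq_lintegral_rpow_enorm_toReal (by simp) (by simp)]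
    refine ENNReal.rpow_le_rpow ?_ (by positivity)
    have hconv : ∀ r : ℝ, ‖r‖ₑ ^ (2 : ℝ≥0∞).toReal = ENNReal.ofReal (r ^ 2) := fun r => by
      rw [← ofReal_norm, ENNReal.toReal_ofNat, Real.norm_eq_abs,
        ENNReal.ofReal_rpow_of_nonneg (abs_nonneg r) (by norm_num)]
      congr 1
      rw [show (2 : ℝ) = ((2 : ℕ) : ℝ) by norm_num, Real.rpow_natCast, sq_abs]
    simp only [hconv]
    have := lintegral_le_of_forall_section k (s := frontier Ω) (f := fun x => w x ^ 2)
      (g := fun y => I y ^ 2) (hw.continuous.measurable.pow_const 2) (fun _ => sq_nonneg _)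
      (hIm.aemeasurable.pow_const 2) (fun _ => sq_nonneg _) (fun y => by
        rcases slice_integral_le hQ hw hwQ y with h | ⟨x, hx, hxy, hle⟩
        · left; simp only [hI, h]; norm_num
        · exact Or.inr ⟨x, hx, hxy, sq_le_sq.2 hle⟩)
    rw [surfaceMeasure]
    simpa using this
  calc ‖∫ x in Ω, partialDeriv k w x‖ₑ = ‖∫ y, I y‖ₑ := by
        rw [← integral_indicator hΩ.measurableSet, integral_eq_integral_slices k hint]
    _ ≤ ∫⁻ y, ‖I y‖ₑ := enorm_integral_le_lintegral_enorm _
    _ = eLpNorm I 1 (volume.restrict (dropCoord k '' Q)) := by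
        rw [eLpNorm_restrict_eq_of_support_subset (slice_integral_support hwQ),
          eLpNorm_one_eq_lintegral_enorm]
    _ ≤ eLpNorm I 2 (volume.restrict (dropCoord k '' Q))
          * volume (dropCoord k '' Q) ^ (1 / 2 : ℝ) := by
        refine (eLpNorm_le_eLpNorm_mul_rpow_measure_univ (q := 2) (by norm_num)
          hIm.restrict).trans (le_of_eq ?_)
        rw [Measure.restrict_apply_univ]
        norm_num
    _ ≤ eLpNorm w 2 (surfaceMeasure Ω) * volume (dropCoord k '' Q) ^ (1 / 2 : ℝ) := by
        gcongr
        exact (eLpNorm_mono_measure _ Measure.restrict_le_self).trans h2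
    _ = _ := mul_comm _ _

end Slab

/-! ### Tangential vector fields integrate to zero. -/

section CrossDerivatives

variable {d : ℕ} {Ω Q : Set (EuclideanSpace ℝ (Fin d))} {k : Fin d}
  {ρ : EuclideanSpace ℝ (Fin d) → ℝ}

lemma IsBoundaryBox.contDiff_mul_partialDeriv (hQ : IsBoundaryBox Ω Q k ρ)
    {w : EuclideanSpace ℝ (Fin d) → ℝ} (hw : ContDiff ℝ ∞ w) (hwQ : tsupport w ⊆ Q) (i : Fin d) :
    ContDiff ℝ ∞ (fun x => w x * partialDeriv i ρ x) :=
  contDiff_mul_of_tsupport_subset hw hwQ fun x hx =>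
    contDiffAt_partialDeriv i (hQ.contDiffAt x hx)

lemma smoothTransition_mem (t : ℝ) : ‖Real.smoothTransition t‖ ≤ 1 := by
  rw [Real.norm_of_nonneg (Real.smoothTransition.nonneg t)]
  exact Real.smoothTransition.le_one t

/-- The vector fields tangential to the level sets of `ρ` integrate to zero over `Ω`. -/
lemma setIntegral_partialDeriv_mul_comm (hΩ : IsOpen Ω) (hQ : IsBoundaryBox Ω Q k ρ)
    {w : EuclideanSpace ℝ (Fin d) → ℝ} (hw : ContDiff ℝ ∞ w) (hwc : HasCompactSupport w)
    (hwQ : tsupport w ⊆ Q) (i j : Fin d) :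
    ∫ x in Ω, partialDeriv i (fun y => w y * partialDeriv j ρ y) x
      = ∫ x in Ω, partialDeriv j (fun y => w y * partialDeriv i ρ y) x := by
  have hg := fun a => hQ.contDiff_mul_partialDeriv hw hwQ a
  have hgc : ∀ a, HasCompactSupport (fun x => w x * partialDeriv a ρ x) := fun a => hwc.mul_right
  set D : EuclideanSpace ℝ (Fin d) → ℝ := fun x =>
    partialDeriv i (fun y => w y * partialDeriv j ρ y) x
      - partialDeriv j (fun y => w y * partialDeriv i ρ y) x with hD
  have hDi := integrable_of_test (contDiff_partialDeriv i (hg j)).continuous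
    (hasCompactSupport_partialDeriv i (hgc j))
  have hDj := integrable_of_test (contDiff_partialDeriv j (hg i)).continuous
    (hasCompactSupport_partialDeriv j (hgc i))
  have hDint : Integrable D := hDi.sub hDj
  have hD0 : ∀ x, x ∉ tsupport w → D x = 0 := fun x hx => by
    have h1 : ∀ a b, partialDeriv a (fun y => w y * partialDeriv b ρ y) x = 0 := fun a b =>
      partialDeriv_eq_zero_of_notMem a fun h => hx (tsupport_mul_subset_left' _ _ h)
    simp [hD, h1]
  -- A smooth function of `ρ` that vanishes for `ρ ≥ 0` and tends to the indicator of `{ρ < 0}`. Its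
  -- gradient is parallel to `∇ρ`, so in the antisymmetric combination of `hpt` the terms of size
  -- `N` cancel: `ρ_j ρ_i - ρ_i ρ_j = 0`. What is left is bounded by `|D|` uniformly in `N`, and
  -- dominated convergence applies.
  set χ : ℕ → EuclideanSpace ℝ (Fin d) → ℝ := fun N x => Real.smoothTransition (-(N : ℝ) * ρ x)
    with hχ
  have hχs : ∀ N, ∀ x ∈ Q, ContDiffAt ℝ ∞ (χ N) x := fun N x hx =>
    Real.smoothTransition.contDiffAt.comp x (contDiffAt_const.mul (hQ.contDiffAt x hx))
  have hprod : ∀ N a, ContDiff ℝ ∞ (fun x => (w x * partialDeriv a ρ x) * χ N x) := fun N a =>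
    contDiff_mul_of_tsupport_subset (hg a) ((tsupport_mul_subset_left' _ _).trans hwQ) (hχs N)
  have hprodc : ∀ N a, HasCompactSupport (fun x => (w x * partialDeriv a ρ x) * χ N x) :=
    fun N a => (hgc a).mul_right
  have hpt : ∀ N x, partialDeriv i (fun y => (w y * partialDeriv j ρ y) * χ N y) x
      - partialDeriv j (fun y => (w y * partialDeriv i ρ y) * χ N y) x = χ N x * D x := by
    intro N x
    by_cases hx : x ∈ tsupport w
    · have hxQ := hwQ hx
      have hχd := (hχs N x hxQ).differentiableAt (by simp)
      have hρd : DifferentiableAt ℝ ρ x := (hQ.contDiffAt x hxQ).differentiableAt (by simp)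
      have hst := (Real.smoothTransition.contDiff (n := 1)).contDiffAt.differentiableAt
        (by simp) (x := -(N : ℝ) * ρ x) |>.hasDerivAt
      have hχ' : ∀ a, partialDeriv a (χ N) x
          = deriv Real.smoothTransition (-(N : ℝ) * ρ x) * (-(N : ℝ) * partialDeriv a ρ x) := by
        intro a
        rw [← partialDeriv_const_mul a _ hρd]
        exact partialDeriv_comp (f := fun x => -(N : ℝ) * ρ x) a hst (hρd.const_mul _)
      rw [partialDeriv_mul i (differentiableAt_of_smooth (hg j)) hχd,
        partialDeriv_mul j (differentiableAt_of_smooth (hg i)) hχd, hχ' i, hχ' j, hD]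
      ring
    · have h1 : ∀ a b, partialDeriv a (fun y => (w y * partialDeriv b ρ y) * χ N y) x = 0 :=
        fun a b => partialDeriv_eq_zero_of_notMem a fun h =>
          hx (tsupport_mul_subset_left' _ _ (tsupport_mul_subset_left' _ _ h))
      rw [h1, h1, hD0 x hx]; ring
  have hI1 : ∀ N a b, Integrable (partialDeriv a (fun y => (w y * partialDeriv b ρ y) * χ N y)) :=
    fun N a b => integrable_of_test (contDiff_partialDeriv a (hprod N b)).continuous
      (hasCompactSupport_partialDeriv a (hprodc N b))
  have hzero : ∀ N, ∫ x, χ N x * D x = 0 := by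
    intro N
    simp only [← hpt N]
    rw [integral_sub (hI1 N i j) (hI1 N j i), integral_partialDeriv i (hprod N j) (hprodc N j),
      integral_partialDeriv j (hprod N i) (hprodc N i), sub_zero]
  have hlim : Tendsto (fun N => ∫ x, χ N x * D x) atTop (𝓝 (∫ x, Ω.indicator D x)) := by
    refine tendsto_integral_of_dominated_convergence (fun x => ‖D x‖) (fun N => ?_) hDint.norm
      (fun N => Eventually.of_forall fun x => ?_) (Eventually.of_forall fun x => ?_)
    · simp only [← hpt N]
      exact ((hI1 N i j).sub (hI1 N j i)).aestronglyMeasurable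
    · rw [norm_mul]
      exact mul_le_of_le_one_left (norm_nonneg _) (smoothTransition_mem _)
    · by_cases hx : x ∈ tsupport w
      · by_cases hxΩ : x ∈ Ω
        · have hneg : ρ x < 0 := (hQ.mem_iff x (hwQ hx)).1 hxΩ
          rw [Set.indicator_of_mem hxΩ]
          obtain ⟨N₀, hN₀⟩ := exists_nat_ge (1 / (-ρ x))
          refine tendsto_const_nhds.congr' ?_
          filter_upwards [eventually_ge_atTop N₀] with N hN
          have h1 : (1 : ℝ) ≤ -(N : ℝ) * ρ x := by
            have h2 : 1 / (-ρ x) ≤ (N : ℝ) := hN₀.trans (by exact_mod_cast hN)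
            rw [div_le_iff₀ (by linarith)] at h2
            linarith
          simp only [hχ, Real.smoothTransition.one_of_one_le h1, one_mul]
        · have hnn : 0 ≤ ρ x := by
            by_contra h
            exact hxΩ ((hQ.mem_iff x (hwQ hx)).2 (not_le.1 h))
          rw [Set.indicator_of_notMem hxΩ]
          refine tendsto_const_nhds.congr fun N => ?_
          have h1 : -(N : ℝ) * ρ x ≤ 0 := by
            have := mul_nonneg (Nat.cast_nonneg N : (0 : ℝ) ≤ N) hnn
            linarith
          simp only [hχ, Real.smoothTransition.zero_of_nonpos h1, zero_mul]
      · have : Ω.indicator D x = 0 := by simp [Set.indicator, hD0 x hx]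
        simp [this, hD0 x hx]
  have hfin : ∫ x, Ω.indicator D x = 0 := by
    simp only [hzero] at hlim
    exact tendsto_nhds_unique hlim tendsto_const_nhds |>.symm ▸ rfl
  rw [integral_indicator hΩ.measurableSet, hD, integral_sub hDi.restrict hDj.restrict,
    sub_eq_zero] at hfin
  exact hfin

lemma exists_bound_on_compact {K : Set (EuclideanSpace ℝ (Fin d))} (hK : IsCompact K)
    {f : EuclideanSpace ℝ (Fin d) → ℝ} (hf : ContinuousOn f K) :
    ∃ c : ℝ, 0 ≤ c ∧ ∀ x ∈ K, |f x| ≤ c := by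
  obtain ⟨c, hc⟩ := hK.exists_bound_of_continuousOn hf
  exact ⟨max c 0, le_max_right _ _, fun x hx => (hc x hx).trans (le_max_left _ _)⟩

end CrossDerivatives

/-! ### Boundary control of derivatives in every direction. -/

section Slab

variable {n : ℕ} {Ω Q : Set (EuclideanSpace ℝ (Fin (n + 1)))} {k : Fin (n + 1)}
  {ρ : EuclideanSpace ℝ (Fin (n + 1)) → ℝ}

/-- For smooth functions supported in a fixed compact subset of a boundary box, the integral over
`Ω` of any partial derivative is controlled by the boundary values. -/
lemma exists_bound_setIntegral_partialDeriv (hΩ : IsOpen Ω) (hQ : IsBoundaryBox Ω Q k ρ)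
    {K : Set (EuclideanSpace ℝ (Fin (n + 1)))} (hK : IsCompact K) (hKQ : K ⊆ Q)
    (i : Fin (n + 1)) :
    ∃ C : ℝ≥0∞, C ≠ ⊤ ∧ ∀ w : EuclideanSpace ℝ (Fin (n + 1)) → ℝ, ContDiff ℝ ∞ w →
      tsupport w ⊆ K → ‖∫ x in Ω, partialDeriv i w x‖ₑ ≤ C * eLpNorm w 2 (surfaceMeasure Ω) := by
  obtain ⟨C, hC, hbound⟩ := exists_bound_setIntegral_partialDeriv_transversal hΩ hQ
  have hsm : ∀ x ∈ Q, ContDiffAt ℝ ∞ (fun x => (partialDeriv k ρ x)⁻¹) x := fun x hx =>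
    (contDiffAt_partialDeriv k (hQ.contDiffAt x hx)).inv (hQ.partialDeriv_ne x hx)
  have hsm2 : ∀ x ∈ Q, ContDiffAt ℝ ∞
      (fun x => (partialDeriv k ρ x)⁻¹ * partialDeriv i ρ x) x := fun x hx =>
    (hsm x hx).mul (contDiffAt_partialDeriv i (hQ.contDiffAt x hx))
  -- The quotient `ρ_i / ρ_k` is bounded only on compact subsets of the box; this is why the
  -- supports are confined to a fixed `K`.
  obtain ⟨c, hc0, hc⟩ := exists_bound_on_compact hK
    (f := fun x => (partialDeriv k ρ x)⁻¹ * partialDeriv i ρ x) fun x hx =>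
    (hsm2 x (hKQ hx)).continuousAt.continuousWithinAt
  refine ⟨C * ENNReal.ofReal c, ENNReal.mul_ne_top hC ENNReal.ofReal_ne_top, fun w hw hwK => ?_⟩
  have hwc : HasCompactSupport w := hK.of_isClosed_subset (isClosed_tsupport w) hwK
  have hwQ := hwK.trans hKQ
  -- With `w' = w / ρ_k`, the tangential identity gives `∫_Ω ∂_i w = ∫_Ω ∂_i (w' ρ_k) = ∫_Ω ∂_k (w'
  -- ρ_i)`, which is a transversal derivative of `w ρ_i / ρ_k`.
  have hw's : ContDiff ℝ ∞ (fun x => w x * (partialDeriv k ρ x)⁻¹) :=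
    contDiff_mul_of_tsupport_subset hw hwQ hsm
  have hw'c : HasCompactSupport (fun x => w x * (partialDeriv k ρ x)⁻¹) := hwc.mul_right
  have hw'Q : tsupport (fun x => w x * (partialDeriv k ρ x)⁻¹) ⊆ Q :=
    (tsupport_mul_subset_left' _ _).trans hwQ
  have h1 : (fun x => (w x * (partialDeriv k ρ x)⁻¹) * partialDeriv k ρ x) = w := by
    ext x
    by_cases hx : x ∈ tsupport w
    · rw [mul_assoc, inv_mul_cancel₀ (hQ.partialDeriv_ne x (hwQ hx)), mul_one]
    · simp [image_eq_zero_of_notMem_tsupport hx]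
  have h2 := setIntegral_partialDeriv_mul_comm hΩ hQ hw's hw'c hw'Q i k
  rw [h1] at h2
  rw [h2]
  refine (hbound _ (hQ.contDiff_mul_partialDeriv hw's hw'Q i) hw'c.mul_right
    ((tsupport_mul_subset_left' _ _).trans hw'Q)).trans ?_
  rw [mul_assoc]
  gcongr
  refine eLpNorm_le_mul_eLpNorm_of_ae_le_mul (Eventually.of_forall fun x => ?_) 2
  by_cases hx : x ∈ tsupport w
  · rw [mul_assoc, norm_mul, mul_comm]
    exact mul_le_mul_of_nonneg_right (hc x (hwK hx)) (norm_nonneg _)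
  · simp [image_eq_zero_of_notMem_tsupport hx]

end Slab

/-! ### The defect in the weak derivative of an extension by zero -/

section Defect

variable {d : ℕ} {Ω : Set (EuclideanSpace ℝ (Fin d))}

/-- The functional measuring the failure of the extension of `w` by zero to be the weak derivative
of the extension of `u` by zero. -/
noncomputable def weakDefect (Ω : Set (EuclideanSpace ℝ (Fin d))) (i : Fin d)
    (u w ψ : EuclideanSpace ℝ (Fin d) → ℝ) : ℝ :=
  (∫ x in Ω, u x * partialDeriv i ψ x) + ∫ x in Ω, w x * ψ x

lemma integrable_mul_test {μ : Measure (EuclideanSpace ℝ (Fin d))} [IsFiniteMeasureOnCompacts μ]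
    {u ψ : EuclideanSpace ℝ (Fin d) → ℝ} (hu : MemLp u 2 μ) (hψ : Continuous ψ)
    (hψc : HasCompactSupport ψ) : Integrable (fun x => u x * ψ x) μ :=
  hu.integrable_mul (hψ.memLp_of_hasCompactSupport hψc (p := 2))

lemma weakDefect_sum {ι : Type*} (s : Finset ι) (i : Fin d)
    {u w : EuclideanSpace ℝ (Fin d) → ℝ} (hu : MemLp u 2 (volume.restrict Ω))
    (hw : MemLp w 2 (volume.restrict Ω)) {ψ : ι → EuclideanSpace ℝ (Fin d) → ℝ}
    (hψ : ∀ a, ContDiff ℝ ∞ (ψ a)) (hψc : ∀ a, HasCompactSupport (ψ a)) :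
    weakDefect Ω i u w (fun x => ∑ a ∈ s, ψ a x) = ∑ a ∈ s, weakDefect Ω i u w (ψ a) := by
  simp only [weakDefect]
  have h : ∀ x, partialDeriv i (fun x => ∑ a ∈ s, ψ a x) x = ∑ a ∈ s, partialDeriv i (ψ a) x :=
    fun x => partialDeriv_sum s i fun a _ => differentiableAt_of_smooth (hψ a)
  simp only [h, Finset.mul_sum]
  rw [integral_finsetSum _ fun a _ => integrable_mul_test hu
      (contDiff_partialDeriv i (hψ a)).continuous (hasCompactSupport_partialDeriv i (hψc a)),
    integral_finsetSum _ fun a _ => integrable_mul_test hw (hψ a).continuous (hψc a),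
    Finset.sum_add_distrib]

/-- The functional is linear in the test function, so a smooth partition of unity on the support of
`ψ` reduces the claim to small supports; compactness leaves only finitely many nonzero pieces. -/
lemma weakDefect_eq_zero_of_local (i : Fin d) {u w : EuclideanSpace ℝ (Fin d) → ℝ}
    (hu : MemLp u 2 (volume.restrict Ω)) (hw : MemLp w 2 (volume.restrict Ω))
    (hloc : ∀ p, ∃ O, IsOpen O ∧ p ∈ O ∧ ∀ ψ : EuclideanSpace ℝ (Fin d) → ℝ, ContDiff ℝ ∞ ψ →
      HasCompactSupport ψ → tsupport ψ ⊆ O → weakDefect Ω i u w ψ = 0)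
    {ψ : EuclideanSpace ℝ (Fin d) → ℝ} (hψ : ContDiff ℝ ∞ ψ) (hψc : HasCompactSupport ψ) :
    weakDefect Ω i u w ψ = 0 := by
  choose O hO hpO hvan using hloc
  obtain ⟨f, hf⟩ := SmoothPartitionOfUnity.exists_isSubordinate
    (modelWithCornersSelf ℝ (EuclideanSpace ℝ (Fin d))) (isClosed_tsupport ψ) O hO
    (fun p _ => Set.mem_iUnion.2 ⟨p, hpO p⟩)
  have hfin := f.locallyFinite.finite_nonempty_inter_compact hψc
  have hsm : ∀ a, ContDiff ℝ ∞ (fun x => f a x * ψ x) := fun a =>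
    (contMDiff_iff_contDiff.1 (f a).contMDiff).mul hψ
  have hsum : ψ = fun x => ∑ a ∈ hfin.toFinset, f a x * ψ x := by
    ext x
    rw [← Finset.sum_mul]
    by_cases hx : x ∈ tsupport ψ
    · have h1 := f.sum_eq_one hx
      rw [finsum_eq_sum_of_support_subset (s := hfin.toFinset) _ (fun a ha => by
        simpa using ⟨x, ha, hx⟩)] at h1
      rw [h1, one_mul]
    · rw [image_eq_zero_of_notMem_tsupport hx, mul_zero]
  rw [hsum, weakDefect_sum _ i hu hw hsm fun a => hψc.mul_left]
  exact Finset.sum_eq_zero fun a _ => hvan a _ (hsm a) hψc.mul_left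
    ((tsupport_mul_subset_left' _ _).trans (hf a))

lemma tendsto_integral_mul_test {μ : Measure (EuclideanSpace ℝ (Fin d))}
    [IsFiniteMeasureOnCompacts μ] {u ψ : EuclideanSpace ℝ (Fin d) → ℝ}
    {φ : ℕ → EuclideanSpace ℝ (Fin d) → ℝ} (hu : MemLp u 2 μ) (hφ : ∀ n, Continuous (φ n))
    (hψ : Continuous ψ) (hψc : HasCompactSupport ψ)
    (hlim : Tendsto (fun n => eLpNorm (fun x => φ n x - u x) 2 μ) atTop (𝓝 0)) :
    Tendsto (fun n => ∫ x, φ n x * ψ x ∂μ) atTop (𝓝 (∫ x, u x * ψ x ∂μ)) := by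
  have hψL : MemLp ψ 2 μ := hψ.memLp_of_hasCompactSupport hψc
  have hi : ∀ n, Integrable (fun x => φ n x * ψ x) μ := fun n =>
    ((hφ n).mul hψ).integrable_of_hasCompactSupport hψc.mul_left
  have hui := integrable_mul_test hu hψ hψc
  rw [tendsto_iff_edist_tendsto_0]
  have hup : Tendsto (fun n => eLpNorm (fun x => φ n x - u x) 2 μ * eLpNorm ψ 2 μ) atTop (𝓝 0) := by
    simpa using ENNReal.Tendsto.mul_const hlim (Or.inr hψL.eLpNorm_ne_top)
  refine tendsto_of_tendsto_of_tendsto_of_le_of_le tendsto_const_nhds hup (fun _ => zero_le)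
    fun n => ?_
  rw [edist_eq_enorm_sub, ← integral_sub (hi n) hui]
  refine (enorm_integral_le_lintegral_enorm _).trans ?_
  rw [← eLpNorm_one_eq_lintegral_enorm]
  have := eLpNorm_smul_le_mul_eLpNorm (p := 2) (q := 2) (r := 1) (μ := μ) (f := ψ)
    (φ := fun x => φ n x - u x) hψL.1 ((hφ n).aestronglyMeasurable.sub hu.1)
  refine (le_of_eq ?_).trans this
  congr 1
  ext x
  simp [sub_mul]

/-- The defect is the limit of the boundary terms of smooth approximations. -/
lemma tendsto_setIntegral_partialDeriv_mul (i : Fin d) {u w ψ : EuclideanSpace ℝ (Fin d) → ℝ}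
    {φ : ℕ → EuclideanSpace ℝ (Fin d) → ℝ} (hu : MemLp u 2 (volume.restrict Ω))
    (hw : MemLp w 2 (volume.restrict Ω)) (hφ : ∀ n, ContDiff ℝ ∞ (φ n))
    (hψ : ContDiff ℝ ∞ ψ) (hψc : HasCompactSupport ψ)
    (hlim : Tendsto (fun n => eLpNorm (fun x => φ n x - u x) 2 (volume.restrict Ω)) atTop (𝓝 0))
    (hlim' : Tendsto (fun n => eLpNorm (fun x => partialDeriv i (φ n) x - w x) 2
      (volume.restrict Ω)) atTop (𝓝 0)) :
    Tendsto (fun n => ∫ x in Ω, partialDeriv i (fun y => φ n y * ψ y) x) atTop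
      (𝓝 (weakDefect Ω i u w ψ)) := by
  have hψ' := contDiff_partialDeriv i hψ
  have hψ'c := hasCompactSupport_partialDeriv i hψc
  refine ((tendsto_integral_mul_test hu (fun n => (hφ n).continuous) hψ'.continuous hψ'c hlim).add
    (tendsto_integral_mul_test hw (fun n => (contDiff_partialDeriv i (hφ n)).continuous)
      hψ.continuous hψc hlim')).congr fun n => ?_
  have h1 : Integrable (fun x => φ n x * partialDeriv i ψ x) (volume.restrict Ω) :=
    ((hφ n).continuous.mul hψ'.continuous).integrable_of_hasCompactSupport hψ'c.mul_left
  have h2 : Integrable (fun x => partialDeriv i (φ n) x * ψ x) (volume.restrict Ω) :=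
    ((contDiff_partialDeriv i (hφ n)).continuous.mul
      hψ.continuous).integrable_of_hasCompactSupport hψc.mul_left
  rw [← integral_add h1 h2]
  congr 1
  ext x
  rw [partialDeriv_mul i (differentiableAt_of_smooth (hφ n)) (differentiableAt_of_smooth hψ)]
  exact add_comm _ _

lemma weakDefect_eq_zero_of_interior {i : Fin d} {u w : EuclideanSpace ℝ (Fin d) → ℝ}
    (h : HasWeakPartial Ω i u w) {ψ : EuclideanSpace ℝ (Fin d) → ℝ} (hψ : ContDiff ℝ ∞ ψ)
    (hψc : HasCompactSupport ψ) (hψΩ : tsupport ψ ⊆ Ω) : weakDefect Ω i u w ψ = 0 := by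
  rw [weakDefect, h ψ hψ hψc hψΩ, neg_add_cancel]

lemma weakDefect_eq_zero_of_exterior (i : Fin d)
    (u w : EuclideanSpace ℝ (Fin d) → ℝ)
    {ψ : EuclideanSpace ℝ (Fin d) → ℝ} (hψΩ : tsupport ψ ⊆ (closure Ω)ᶜ) :
    weakDefect Ω i u w ψ = 0 := by
  have hx : ∀ x ∈ Ω, x ∉ tsupport ψ := fun x hx h => hψΩ h (subset_closure hx)
  rw [weakDefect, setIntegral_eq_zero_of_forall_eq_zero fun x hxΩ => by
      rw [partialDeriv_eq_zero_of_notMem i (hx x hxΩ), mul_zero],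
    setIntegral_eq_zero_of_forall_eq_zero fun x hxΩ => by
      rw [image_eq_zero_of_notMem_tsupport (hx x hxΩ), mul_zero], add_zero]

/-- It suffices to treat the defect in boundary boxes. -/
lemma weakDefect_eq_zero_of_boundary (hΩ : IsOpen Ω) (hs : HasSmoothBoundary Ω) (i : Fin d)
    {u w : EuclideanSpace ℝ (Fin d) → ℝ} (hu : MemLp u 2 (volume.restrict Ω))
    (hw : MemLp w 2 (volume.restrict Ω)) (hweak : HasWeakPartial Ω i u w)
    (hbd : ∀ Q k ρ, IsBoundaryBox Ω Q k ρ → ∀ ψ : EuclideanSpace ℝ (Fin d) → ℝ, ContDiff ℝ ∞ ψ →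
      HasCompactSupport ψ → tsupport ψ ⊆ Q → weakDefect Ω i u w ψ = 0)
    {ψ : EuclideanSpace ℝ (Fin d) → ℝ} (hψ : ContDiff ℝ ∞ ψ) (hψc : HasCompactSupport ψ) :
    weakDefect Ω i u w ψ = 0 := by
  refine weakDefect_eq_zero_of_local i hu hw (fun p => ?_) hψ hψc
  by_cases hp : p ∈ Ω
  · exact ⟨Ω, hΩ, hp, fun ψ h1 h2 h3 => weakDefect_eq_zero_of_interior hweak h1 h2 h3⟩
  by_cases hp' : p ∈ closure Ω
  · obtain ⟨Q, k, ρ, hpQ, hQ⟩ := exists_isBoundaryBox hs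
      (show p ∈ frontier Ω from ⟨hp', fun h => hp (interior_subset h)⟩)
    exact ⟨Q, hQ.isOpen, hpQ, hbd Q k ρ hQ⟩
  · exact ⟨(closure Ω)ᶜ, isClosed_closure.isOpen_compl, hp', fun ψ _ _ h3 =>
      weakDefect_eq_zero_of_exterior i u w h3⟩

end Defect

/-! ### Functions with vanishing Cauchy data extend by zero -/

section Traces

variable {n : ℕ} {Ω Q : Set (EuclideanSpace ℝ (Fin (n + 1)))} {k : Fin (n + 1)}
  {ρ : EuclideanSpace ℝ (Fin (n + 1)) → ℝ}

lemma tendsto_setIntegral_partialDeriv_zero (hΩ : IsOpen Ω) (hQ : IsBoundaryBox Ω Q k ρ)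
    {K : Set (EuclideanSpace ℝ (Fin (n + 1)))} (hK : IsCompact K) (hKQ : K ⊆ Q)
    (i : Fin (n + 1)) {W : ℕ → EuclideanSpace ℝ (Fin (n + 1)) → ℝ}
    (hW : ∀ m, ContDiff ℝ ∞ (W m)) (hWK : ∀ m, tsupport (W m) ⊆ K)
    (hlim : Tendsto (fun m => eLpNorm (W m) 2 (surfaceMeasure Ω)) atTop (𝓝 0)) :
    Tendsto (fun m => ∫ x in Ω, partialDeriv i (W m) x) atTop (𝓝 0) := by
  obtain ⟨C, hC, hb⟩ := exists_bound_setIntegral_partialDeriv hΩ hQ hK hKQ i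
  rw [tendsto_iff_edist_tendsto_0]
  have hup : Tendsto (fun m => C * eLpNorm (W m) 2 (surfaceMeasure Ω)) atTop (𝓝 0) := by
    simpa using ENNReal.Tendsto.const_mul hlim (Or.inr hC)
  refine tendsto_of_tendsto_of_tendsto_of_le_of_le tendsto_const_nhds hup (fun _ => zero_le)
    fun m => ?_
  rw [edist_zero_right]
  exact hb (W m) (hW m) (hWK m)

/-- For approximations `φ m` from the trace, the defect is the limit of `∫_Ω ∂_i (φ m ψ)`, and this
is controlled by the `L²(∂Ω)` norm of `φ m ψ`, which tends to zero. -/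
lemma weakDefect_eq_zero_of_hasTrace_zero (hΩ : IsOpen Ω) (hQ : IsBoundaryBox Ω Q k ρ)
    {u : EuclideanSpace ℝ (Fin (n + 1)) → ℝ} {Du : Fin (n + 1) → EuclideanSpace ℝ (Fin (n + 1)) → ℝ}
    (hu : MemLp u 2 (volume.restrict Ω)) (hDu : ∀ i, MemLp (Du i) 2 (volume.restrict Ω))
    (htr : HasTrace Ω u Du fun _ => 0) (i : Fin (n + 1))
    {ψ : EuclideanSpace ℝ (Fin (n + 1)) → ℝ} (hψ : ContDiff ℝ ∞ ψ) (hψc : HasCompactSupport ψ)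
    (hψQ : tsupport ψ ⊆ Q) : weakDefect Ω i u (Du i) ψ = 0 := by
  obtain ⟨-, φ, hφ, hφu, hφDu, hφ0⟩ := htr
  simp only [sub_zero] at hφ0
  obtain ⟨c, hc⟩ := hψc.exists_bound_of_continuous hψ.continuous
  refine tendsto_nhds_unique
    (tendsto_setIntegral_partialDeriv_mul i hu (hDu i) hφ hψ hψc hφu (hφDu i))
    (tendsto_setIntegral_partialDeriv_zero hΩ hQ hψc hψQ i (fun m => (hφ m).mul hψ)
      (fun m => tsupport_mul_subset_right' _ _) ?_)
  have hup : Tendsto (fun m => ENNReal.ofReal c * eLpNorm (φ m) 2 (surfaceMeasure Ω)) atTop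
      (𝓝 0) := by
    simpa using ENNReal.Tendsto.const_mul hφ0 (Or.inr ENNReal.ofReal_ne_top)
  refine tendsto_of_tendsto_of_tendsto_of_le_of_le tendsto_const_nhds hup (fun _ => zero_le)
    fun m => ?_
  refine eLpNorm_le_mul_eLpNorm_of_ae_le_mul (Eventually.of_forall fun x => ?_) 2
  rw [norm_mul, mul_comm]
  exact mul_le_mul_of_nonneg_right (hc x) (norm_nonneg _)

/-- The tangential part of the trace theory: the defects of `u` in two directions are related
through the normal. -/
lemma weakDefect_mul_comm (hΩ : IsOpen Ω) (hQ : IsBoundaryBox Ω Q k ρ)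
    {u : EuclideanSpace ℝ (Fin (n + 1)) → ℝ} {Du : Fin (n + 1) → EuclideanSpace ℝ (Fin (n + 1)) → ℝ}
    (hu : MemLp u 2 (volume.restrict Ω)) (hDu : ∀ i, MemLp (Du i) 2 (volume.restrict Ω))
    {g : EuclideanSpace ℝ (Fin (n + 1)) → ℝ} (htr : HasTrace Ω u Du g) (i j : Fin (n + 1))
    {θ : EuclideanSpace ℝ (Fin (n + 1)) → ℝ} (hθ : ContDiff ℝ ∞ θ) (hθc : HasCompactSupport θ)
    (hθQ : tsupport θ ⊆ Q) :
    weakDefect Ω i u (Du i) (fun x => θ x * partialDeriv j ρ x)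
      = weakDefect Ω j u (Du j) (fun x => θ x * partialDeriv i ρ x) := by
  obtain ⟨-, φ, hφ, hφu, hφDu, -⟩ := htr
  have h1 := tendsto_setIntegral_partialDeriv_mul i hu (hDu i) hφ
    (hQ.contDiff_mul_partialDeriv hθ hθQ j) hθc.mul_right hφu (hφDu i)
  have h2 := tendsto_setIntegral_partialDeriv_mul j hu (hDu j) hφ
    (hQ.contDiff_mul_partialDeriv hθ hθQ i) hθc.mul_right hφu (hφDu j)
  refine tendsto_nhds_unique h1 (h2.congr fun m => ?_)
  have := setIntegral_partialDeriv_mul_comm hΩ hQ ((hφ m).mul hθ) (hθc.mul_left)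
    ((tsupport_mul_subset_right' _ _).trans hθQ) i j
  simp only [mul_assoc] at this
  exact this.symm

lemma sum_normal_mul_eq_zero (hQ : IsBoundaryBox Ω Q k ρ) {g : Fin (n + 1) → ℝ}
    {p : EuclideanSpace ℝ (Fin (n + 1))} (hp : p ∈ Q) (hpf : p ∈ frontier Ω)
    (h : ∀ ν, IsOutwardUnitNormal Ω p ν → ∑ i, ν i * g i = 0) :
    ∑ i, partialDeriv i ρ p * g i = 0 := by
  have h1 := h _ (hQ.normal p hp hpf)
  have hne : ‖gradient ρ p‖⁻¹ ≠ 0 := by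
    refine inv_ne_zero (norm_ne_zero_iff.2 fun h0 => hQ.partialDeriv_ne p hp ?_)
    rw [← gradient_apply, h0]; rfl
  simp only [PiLp.smul_apply, gradient_apply, smul_eq_mul, mul_assoc, ← Finset.mul_sum] at h1
  exact (mul_eq_zero.1 h1).resolve_left hne

/-- The combination of the defects of the partial derivatives along the normal vanishes when the
normal derivative does. -/
lemma sum_weakDefect_normal_eq_zero (hΩ : IsOpen Ω) (hQ : IsBoundaryBox Ω Q k ρ)
    {Dv : Fin (n + 1) → EuclideanSpace ℝ (Fin (n + 1)) → ℝ}
    {D2v : Fin (n + 1) → Fin (n + 1) → EuclideanSpace ℝ (Fin (n + 1)) → ℝ}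
    (hDv : ∀ i, MemLp (Dv i) 2 (volume.restrict Ω))
    (hD2v : ∀ i j, MemLp (D2v i j) 2 (volume.restrict Ω))
    (hnd : HasNormalDerivative Ω Dv D2v fun _ => 0) (i : Fin (n + 1))
    {χ : EuclideanSpace ℝ (Fin (n + 1)) → ℝ} (hχ : ContDiff ℝ ∞ χ) (hχc : HasCompactSupport χ)
    (hχQ : tsupport χ ⊆ Q) :
    ∑ j, weakDefect Ω i (Dv j) (D2v j i) (fun x => χ x * partialDeriv j ρ x) = 0 := by
  obtain ⟨g, hg, hn⟩ := hnd
  have hgm : ∀ j, AEStronglyMeasurable (g j) (surfaceMeasure Ω) := fun j => (hg j).1.1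
  choose φ hφ hφu hφDu hφg using fun j => (hg j).2
  have hs := fun j => hQ.contDiff_mul_partialDeriv hχ hχQ j
  have hsc : ∀ j, HasCompactSupport (fun x => χ x * partialDeriv j ρ x) := fun j => hχc.mul_right
  have hlim := tendsto_finsetSum Finset.univ fun j (_ : j ∈ Finset.univ) =>
    tendsto_setIntegral_partialDeriv_mul i (hDv j) (hD2v j i) (hφ j) (hs j) (hsc j) (hφu j)
      (hφDu j i)
  -- The components must be combined before passing to the boundary: individually the `φ j m` tend
  -- to traces `g j` that are not yet known to vanish, but the normal combination tends to zero in
  -- `L²(∂Ω)`.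
  set W : ℕ → EuclideanSpace ℝ (Fin (n + 1)) → ℝ := fun m x =>
    ∑ j, φ j m x * (χ x * partialDeriv j ρ x) with hWdef
  have hterm : ∀ m j, ContDiff ℝ ∞ (fun x => φ j m x * (χ x * partialDeriv j ρ x)) := fun m j =>
    (hφ j m).mul (hs j)
  have hWs : ∀ m, ContDiff ℝ ∞ (W m) := fun m => ContDiff.sum fun j _ => hterm m j
  have hχ0 : ∀ x, x ∉ tsupport χ → χ x = 0 := fun x hx => image_eq_zero_of_notMem_tsupport hx
  have hWK : ∀ m, tsupport (W m) ⊆ tsupport χ := fun m => by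
    refine closure_minimal (fun x hx => ?_) (isClosed_tsupport χ)
    by_contra hx'
    exact hx (by simp [hWdef, hχ0 x hx'])
  have hWint : ∀ m, ∫ x in Ω, partialDeriv i (W m) x
      = ∑ j, ∫ x in Ω, partialDeriv i (fun y => φ j m y * (χ y * partialDeriv j ρ y)) x := by
    intro m
    rw [← integral_finsetSum _ fun j _ =>
      (integrable_of_test (contDiff_partialDeriv i (hterm m j)).continuous
        (hasCompactSupport_partialDeriv i (hsc j).mul_left)).restrict]
    congr 1
    ext x
    exact partialDeriv_sum _ i fun j _ => differentiableAt_of_smooth (hterm m j)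
  simp only [← hWint] at hlim
  refine tendsto_nhds_unique hlim
    (tendsto_setIntegral_partialDeriv_zero hΩ hQ hχc hχQ i hWs hWK ?_)
  have hbd : ∀ j, ∃ c, ∀ x, ‖χ x * partialDeriv j ρ x‖ ≤ c := fun j =>
    (hsc j).exists_bound_of_continuous (hs j).continuous
  choose c hc using hbd
  have hup : Tendsto (fun m => ∑ j, ENNReal.ofReal (c j)
      * eLpNorm (fun x => φ j m x - g j x) 2 (surfaceMeasure Ω)) atTop (𝓝 0) := by
    have := tendsto_finsetSum Finset.univ fun j (_ : j ∈ Finset.univ) =>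
      ENNReal.Tendsto.const_mul (a := ENNReal.ofReal (c j)) (hφg j)
        (Or.inr ENNReal.ofReal_ne_top)
    simpa using this
  refine tendsto_of_tendsto_of_tendsto_of_le_of_le tendsto_const_nhds hup (fun _ => zero_le)
    fun m => ?_
  -- On the boundary `∑ g j ρ_j = 0` almost everywhere, so the traces can be subtracted for free.
  have hae : W m =ᵐ[surfaceMeasure Ω]
      ∑ j, fun x => (φ j m x - g j x) * (χ x * partialDeriv j ρ x) := by
    have hfr : ∀ᵐ p ∂(surfaceMeasure Ω), p ∈ frontier Ω :=
      ae_restrict_mem isClosed_frontier.measurableSet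
    filter_upwards [hn, hfr] with p hp hpf
    rw [Finset.sum_apply]
    by_cases hpχ : p ∈ tsupport χ
    · have h0 := sum_normal_mul_eq_zero hQ (g := fun j => g j p) (hχQ hpχ) hpf hp
      have h1 : ∑ j, g j p * (χ p * partialDeriv j ρ p) = 0 := by
        rw [show ∑ j, g j p * (χ p * partialDeriv j ρ p)
          = χ p * ∑ j, partialDeriv j ρ p * g j p by
            rw [Finset.mul_sum]; exact Finset.sum_congr rfl fun j _ => by ring, h0, mul_zero]
      simp only [hWdef, sub_mul, Finset.sum_sub_distrib, h1, sub_zero]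
    · simp [hWdef, hχ0 p hpχ]
  rw [eLpNorm_congr_ae hae]
  refine (eLpNorm_sum_le (fun j _ => ((hφ j m).continuous.aestronglyMeasurable.sub (hgm j)).mul
    (hs j).continuous.aestronglyMeasurable) (by norm_num)).trans (Finset.sum_le_sum fun j _ => ?_)
  refine eLpNorm_le_mul_eLpNorm_of_ae_le_mul (Eventually.of_forall fun x => ?_) 2
  rw [Pi.mul_apply, Pi.sub_apply, norm_mul, mul_comm]
  exact mul_le_mul_of_nonneg_right (hc j x) (norm_nonneg _)

/-- Formally, `D_l(∂_i v)(ψ) = ∫_{∂Ω} g_i ν_l ψ`. The hypothesis `hsymm` says `g_i ν_j = g_j ν_i`,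
which encodes that tangential derivatives of the zero trace of `v` vanish; together with `∑ ν_j g_j
= 0` it kills every `g_i`. -/
lemma weakDefect_grad_eq_zero (hΩ : IsOpen Ω) (hQ : IsBoundaryBox Ω Q k ρ)
    {Dv : Fin (n + 1) → EuclideanSpace ℝ (Fin (n + 1)) → ℝ}
    {D2v : Fin (n + 1) → Fin (n + 1) → EuclideanSpace ℝ (Fin (n + 1)) → ℝ}
    (hDv : ∀ i, MemLp (Dv i) 2 (volume.restrict Ω))
    (hD2v : ∀ i j, MemLp (D2v i j) 2 (volume.restrict Ω))
    (hnd : HasNormalDerivative Ω Dv D2v fun _ => 0)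
    (hsymm : ∀ i j ψ, ContDiff ℝ ∞ ψ → HasCompactSupport ψ →
      weakDefect Ω j (Dv i) (D2v i j) ψ = weakDefect Ω i (Dv j) (D2v j i) ψ)
    (i l : Fin (n + 1)) {ψ : EuclideanSpace ℝ (Fin (n + 1)) → ℝ} (hψ : ContDiff ℝ ∞ ψ)
    (hψc : HasCompactSupport ψ) (hψQ : tsupport ψ ⊆ Q) :
    weakDefect Ω l (Dv i) (D2v i l) ψ = 0 := by
  set N : EuclideanSpace ℝ (Fin (n + 1)) → ℝ := fun x => ∑ j, partialDeriv j ρ x ^ 2 with hN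
  have hNne : ∀ x ∈ Q, N x ≠ 0 := fun x hx => by
    refine (lt_of_lt_of_le (pow_two_pos_of_ne_zero (hQ.partialDeriv_ne x hx))
      (Finset.single_le_sum (f := fun j => partialDeriv j ρ x ^ 2) (fun j _ => sq_nonneg _)
        (Finset.mem_univ k))).ne'
  have hNs : ∀ x ∈ Q, ContDiffAt ℝ ∞ (fun x => (N x)⁻¹) x := fun x hx =>
    (ContDiffAt.sum fun j _ => (contDiffAt_partialDeriv j (hQ.contDiffAt x hx)).pow 2).inv
      (hNne x hx)
  -- Dividing by `|∇ρ|²` lets `ψ` be written as `∑_j θ ρ_j ρ_j`.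
  set θ : EuclideanSpace ℝ (Fin (n + 1)) → ℝ := fun x => ψ x * (N x)⁻¹ with hθ
  have hθs : ContDiff ℝ ∞ θ := contDiff_mul_of_tsupport_subset hψ hψQ hNs
  have hθc : HasCompactSupport θ := hψc.mul_right
  have hθQ : tsupport θ ⊆ Q := (tsupport_mul_subset_left' _ _).trans hψQ
  have hθNs := fun j => hQ.contDiff_mul_partialDeriv hθs hθQ j
  have hθNc : ∀ j, HasCompactSupport (fun x => θ x * partialDeriv j ρ x) := fun j => hθc.mul_right
  have hθNQ : ∀ j, tsupport (fun x => θ x * partialDeriv j ρ x) ⊆ Q := fun j =>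
    (tsupport_mul_subset_left' _ _).trans hθQ
  have hψeq : ψ = fun x => ∑ j, (θ x * partialDeriv j ρ x) * partialDeriv j ρ x := by
    ext x
    by_cases hx : x ∈ tsupport ψ
    · have : ∑ j, (θ x * partialDeriv j ρ x) * partialDeriv j ρ x = θ x * N x := by
        rw [hN, Finset.mul_sum]; exact Finset.sum_congr rfl fun j _ => by ring
      rw [this, hθ, mul_assoc, inv_mul_cancel₀ (hNne x (hψQ hx)), mul_one]
    · simp [hθ, image_eq_zero_of_notMem_tsupport hx]
  obtain ⟨g, hg, -⟩ := id hnd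
  rw [hψeq, weakDefect_sum _ l (hDv i) (hD2v i l)
    (fun j => hQ.contDiff_mul_partialDeriv (hθNs j) (hθNQ j) j) (fun j => (hθNc j).mul_right)]
  -- Termwise in `j`: exchange direction `l` with the factor `ρ_j` by the tangential identity, then
  -- exchange `i` and `j` by `hsymm`. The sum becomes the normal combination tested with `χ = θ
  -- ρ_l`.
  rw [← sum_weakDefect_normal_eq_zero hΩ hQ hDv hD2v hnd i (hθNs l) (hθNc l) (hθNQ l)]
  refine Finset.sum_congr rfl fun j _ => ?_
  rw [weakDefect_mul_comm hΩ hQ (hDv i) (hD2v i) (hg i) l j (hθNs j) (hθNc j) (hθNQ j)]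
  have hcomm : (fun x => θ x * partialDeriv j ρ x * partialDeriv l ρ x)
      = fun x => θ x * partialDeriv l ρ x * partialDeriv j ρ x := by
    ext x; ring
  rw [hcomm]
  exact hsymm i j _ (hQ.contDiff_mul_partialDeriv (hθNs l) (hθNQ l) j) (hθNc l).mul_right

end Traces

/-! ### The zero extension in `H²`. -/

section ZeroExtension

variable {d : ℕ} {Ω : Set (EuclideanSpace ℝ (Fin d))}

/-- Both mixed derivatives, tested with `g`, equal `∫_Ω v ∂_i ∂_j g`; the fundamental lemma of the
calculus of variations concludes. -/
lemma hessian_symm_ae (hΩ : IsOpen Ω) {v : EuclideanSpace ℝ (Fin d) → ℝ}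
    {Dv : Fin d → EuclideanSpace ℝ (Fin d) → ℝ}
    {D2v : Fin d → Fin d → EuclideanSpace ℝ (Fin d) → ℝ} (h : IsSobolevH2 Ω v Dv D2v)
    (i j : Fin d) : ∀ᵐ x ∂(volume.restrict Ω), D2v i j x = D2v j i x := by
  have hexpand : ∀ i j, ∀ g : EuclideanSpace ℝ (Fin d) → ℝ, ContDiff ℝ ∞ g → HasCompactSupport g →
      tsupport g ⊆ Ω → ∫ x in Ω, D2v i j x * g x
        = ∫ x in Ω, v x * partialDeriv i (partialDeriv j g) x := by
    intro i j g hg hgc hgΩ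
    have h1 := h.weak_hess i j g hg hgc hgΩ
    have h2 := h.weak_grad i (partialDeriv j g) (contDiff_partialDeriv j hg)
      (hasCompactSupport_partialDeriv j hgc) ((tsupport_partialDeriv_subset j g).trans hgΩ)
    linarith
  have hae := hΩ.ae_eq_zero_of_integral_contDiff_smul_eq_zero (μ := volume)
    (f := fun x => D2v i j x - D2v j i x)
    (locallyIntegrableOn_of_locallyIntegrable_restrict
      (((h.memLp_hess i j).sub (h.memLp_hess j i)).locallyIntegrable (by norm_num)))
    (fun g hg hgc hgΩ => by
      rw [← setIntegral_eq_integral_of_forall_compl_eq_zero (s := Ω) fun x hx => by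
        simp [image_eq_zero_of_notMem_tsupport fun hm => hx (hgΩ hm)]]
      have hsub : ∀ x, g x • (D2v i j x - D2v j i x) = D2v i j x * g x - D2v j i x * g x :=
        fun x => by rw [smul_eq_mul]; ring
      simp only [hsub]
      rw [integral_sub (integrable_mul_test (h.memLp_hess i j) hg.continuous hgc)
        (integrable_mul_test (h.memLp_hess j i) hg.continuous hgc), hexpand i j g hg hgc hgΩ,
        hexpand j i g hg hgc hgΩ]
      simp only [partialDeriv_comm i j hg.contDiffAt, sub_self])
  rw [ae_restrict_iff' hΩ.measurableSet]
  filter_upwards [hae] with x hx hxΩ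
  exact sub_eq_zero.1 (hx hxΩ)

/-- A function in `H²(Ω)` with vanishing Cauchy data, extended by zero, belongs to `H²(ℝᵈ)`. -/
theorem weakDefect_eq_zero_of_cauchyData (hd : 1 ≤ d) (hΩ : IsOpen Ω) (hs : HasSmoothBoundary Ω)
    {v : EuclideanSpace ℝ (Fin d) → ℝ} {Dv : Fin d → EuclideanSpace ℝ (Fin d) → ℝ}
    {D2v : Fin d → Fin d → EuclideanSpace ℝ (Fin d) → ℝ} (h : IsSobolevH2 Ω v Dv D2v)
    (htr : HasTrace Ω v Dv fun _ => 0) (hnd : HasNormalDerivative Ω Dv D2v fun _ => 0) :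
    (∀ i ψ, ContDiff ℝ ∞ ψ → HasCompactSupport ψ → weakDefect Ω i v (Dv i) ψ = 0) ∧
    ∀ i j ψ, ContDiff ℝ ∞ ψ → HasCompactSupport ψ → weakDefect Ω j (Dv i) (D2v i j) ψ = 0 := by
  obtain ⟨n, rfl⟩ : ∃ n, d = n + 1 := ⟨d - 1, by omega⟩
  have hfirst : ∀ i ψ, ContDiff ℝ ∞ ψ → HasCompactSupport ψ → weakDefect Ω i v (Dv i) ψ = 0 :=
    fun i ψ hψ hψc => weakDefect_eq_zero_of_boundary hΩ hs i h.memLp (h.memLp_grad i)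
      (h.weak_grad i) (fun Q k ρ hQ ψ hψ hψc hψQ => weakDefect_eq_zero_of_hasTrace_zero hΩ hQ
        h.memLp h.memLp_grad htr i hψ hψc hψQ) hψ hψc
  -- Testing the first order identities for `v` with `∂_j ψ` and `∂_i ψ` gives `∫_Ω ∂_i v ∂_j ψ =
  -- ∫_Ω ∂_j v ∂_i ψ` even for `ψ` that does not vanish on `∂Ω`; the Hessian terms agree by
  -- symmetry.
  have hsymm : ∀ i j ψ, ContDiff ℝ ∞ ψ → HasCompactSupport ψ →
      weakDefect Ω j (Dv i) (D2v i j) ψ = weakDefect Ω i (Dv j) (D2v j i) ψ := by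
    intro i j ψ hψ hψc
    have h1 := hfirst i (partialDeriv j ψ) (contDiff_partialDeriv j hψ)
      (hasCompactSupport_partialDeriv j hψc)
    have h2 := hfirst j (partialDeriv i ψ) (contDiff_partialDeriv i hψ)
      (hasCompactSupport_partialDeriv i hψc)
    have h3 : ∫ x in Ω, D2v i j x * ψ x = ∫ x in Ω, D2v j i x * ψ x :=
      integral_congr_ae ((hessian_symm_ae hΩ h i j).mono fun x hx => by simp only [hx])
    simp only [weakDefect] at h1 h2 ⊢
    simp only [partialDeriv_comm j i hψ.contDiffAt] at h2
    linarith
  exact ⟨hfirst, fun i j ψ hψ hψc => weakDefect_eq_zero_of_boundary hΩ hs j (h.memLp_grad i)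
    (h.memLp_hess i j) (h.weak_hess i j) (fun Q k ρ hQ ψ hψ hψc hψQ =>
      weakDefect_grad_eq_zero hΩ hQ h.memLp_grad h.memLp_hess hnd hsymm i j hψ hψc hψQ) hψ hψc⟩

end ZeroExtension

/-! ### Mollification -/

section Mollify

variable {d : ℕ}

/-- The convolution of a function with a normalized smooth bump. -/
noncomputable def mollify (η : ContDiffBump (0 : EuclideanSpace ℝ (Fin d)))
    (V : EuclideanSpace ℝ (Fin d) → ℝ) : EuclideanSpace ℝ (Fin d) → ℝ :=
  convolution (η.normed volume) V (ContinuousLinearMap.lsmul ℝ ℝ) volume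

variable (η : ContDiffBump (0 : EuclideanSpace ℝ (Fin d)))
  {V G : EuclideanSpace ℝ (Fin d) → ℝ}

lemma mollify_apply_swap (x : EuclideanSpace ℝ (Fin d)) :
    mollify η V x = ∫ y, η.normed volume (x - y) * V y := by
  rw [mollify, convolution_eq_swap]; rfl

lemma locallyIntegrable_of_memLp_two (hV : MemLp V 2) : LocallyIntegrable V :=
  hV.locallyIntegrable (by norm_num)

lemma contDiff_mollify (hV : MemLp V 2) : ContDiff ℝ ∞ (mollify η V) :=
  η.hasCompactSupport_normed.contDiff_convolution_left _ η.contDiff_normed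
    (locallyIntegrable_of_memLp_two hV)

/-- The derivative falls on the kernel, and `y ↦ η(x - y)` is an admissible test function for the
weak derivative; the reflection in `y` cancels the sign. -/
lemma partialDeriv_mollify (i : Fin d) (hV : MemLp V 2)
    (hVG : ∀ ψ, ContDiff ℝ ∞ ψ → HasCompactSupport ψ →
      ∫ x, V x * partialDeriv i ψ x = -∫ x, G x * ψ x) :
    partialDeriv i (mollify η V) = mollify η G := by
  ext x
  have hη : ContDiff ℝ ∞ (η.normed volume) := η.contDiff_normed
  have hηc := η.hasCompactSupport_normed (μ := volume)
  have hVl := locallyIntegrable_of_memLp_two hV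
  have h1 := (hηc.hasFDerivAt_convolution_left (ContinuousLinearMap.lsmul ℝ ℝ)
    (hη.of_le (by simp)) hVl x).fderiv
  have h2 : partialDeriv i (mollify η V) x = ∫ t, partialDeriv i (η.normed volume) t * V (x - t) := by
    have hex := (hηc.fderiv (𝕜 := ℝ)).convolutionExists_left
      (ContinuousLinearMap.precompL (EuclideanSpace ℝ (Fin d)) (ContinuousLinearMap.lsmul ℝ ℝ))
      (hη.continuous_fderiv (by simp)) hVl x
    rw [partialDeriv, mollify, h1, convolution_def, ContinuousLinearMap.integral_apply hex]
    rfl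
  have h3 : ∫ t, partialDeriv i (η.normed volume) t * V (x - t)
      = ∫ y, partialDeriv i (η.normed volume) (x - y) * V y := by
    rw [← integral_sub_left_eq_self _ volume x]
    simp
  set ψ : EuclideanSpace ℝ (Fin d) → ℝ := fun y => η.normed volume (x - y) with hψ
  have hψs : ContDiff ℝ ∞ ψ := hη.comp (contDiff_const.sub contDiff_id)
  have hψc : HasCompactSupport ψ := hηc.comp_homeomorph (Homeomorph.subLeft x)
  have hψ' : ∀ y, partialDeriv i ψ y = -partialDeriv i (η.normed volume) (x - y) := by
    intro y
    have hd : HasFDerivAt ψ ((fderiv ℝ (η.normed volume) (x - y)).comp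
        (-ContinuousLinearMap.id ℝ (EuclideanSpace ℝ (Fin d)))) y :=
      HasFDerivAt.comp y (differentiableAt_of_smooth hη).hasFDerivAt
        ((hasFDerivAt_id y).const_sub x)
    rw [partialDeriv, hd.fderiv]
    simp [partialDeriv]
  have h4 := hVG ψ hψs hψc
  simp only [hψ', mul_neg, integral_neg, neg_inj] at h4
  rw [h2, h3, mollify_apply_swap]
  simp only [mul_comm _ (V _)]
  rw [h4]
  simp only [hψ, mul_comm]

lemma exists_dist_lt_of_mollify_ne_zero {x : EuclideanSpace ℝ (Fin d)}
    (hx : mollify η V x ≠ 0) : ∃ y, V y ≠ 0 ∧ dist x y < η.rOut := by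
  by_contra! hcon
  refine hx ?_
  rw [mollify_apply_swap]
  refine integral_eq_zero_of_ae (Eventually.of_forall fun y => ?_)
  by_cases hy : V y = 0
  · simp [hy]
  · have : x - y ∉ Function.support (η.normed volume) := by
      rw [η.support_normed_eq, mem_ball_zero_iff, ← dist_eq_norm]
      exact not_lt.2 (hcon y hy)
    simp [Function.notMem_support.1 this]

/-- Translation is continuous in `L²`. -/
lemma tendsto_eLpNorm_translate (hV : MemLp V 2) :
    Tendsto (fun t => eLpNorm (fun x => V (t + x) - V x) 2 volume) (𝓝 0) (𝓝 0) := by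
  have : Fact ((2 : ℝ≥0∞) ≠ ⊤) := ⟨by simp⟩
  have hc : Continuous fun t : EuclideanSpace ℝ (Fin d) => DomAddAct.mk t +ᵥ hV.toLp V := by
    have : Continuous fun t : EuclideanSpace ℝ (Fin d) => DomAddAct.mk t :=
      DomAddAct.continuous_mk
    exact this.vadd continuous_const
  have h0 := hc.tendsto 0
  rw [tendsto_iff_edist_tendsto_0] at h0
  refine h0.congr fun t => ?_
  have hz : DomAddAct.mk (0 : EuclideanSpace ℝ (Fin d)) +ᵥ hV.toLp V = hV.toLp V := by
    rw [DomAddAct.mk_zero, zero_vadd]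
  rw [hz, DomAddAct.mk_vadd_toLp, Lp.edist_toLp_toLp]
  rfl

lemma sq_lintegral_le_of_isProbabilityMeasure {α : Type*} [MeasurableSpace α] (P : Measure α)
    [IsProbabilityMeasure P] {f : α → ℝ≥0∞} (hf : AEMeasurable f P) :
    (∫⁻ a, f a ∂P) ^ (2 : ℝ) ≤ ∫⁻ a, f a ^ (2 : ℝ) ∂P := by
  have h := ENNReal.lintegral_mul_le_Lp_mul_Lq P Real.HolderConjugate.two_two hf
    (aemeasurable_const (b := (1 : ℝ≥0∞)))
  simp only [Pi.mul_apply, mul_one, ENNReal.one_rpow, lintegral_const, measure_univ] at h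
  calc (∫⁻ a, f a ∂P) ^ (2 : ℝ) ≤ ((∫⁻ a, f a ^ (2 : ℝ) ∂P) ^ (1 / 2 : ℝ)) ^ (2 : ℝ) :=
        ENNReal.rpow_le_rpow h (by norm_num)
    _ = _ := by rw [← ENNReal.rpow_mul]; norm_num

lemma eLpNorm_two_rpow_two {α : Type*} [MeasurableSpace α] (μ : Measure α) (f : α → ℝ) :
    eLpNorm f 2 μ ^ (2 : ℝ) = ∫⁻ a, ‖f a‖ₑ ^ (2 : ℝ) ∂μ := by
  rw [eLpNorm_eq_lintegral_rpow_enorm_toReal (by simp) (by simp), ← ENNReal.rpow_mul]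
  norm_num

/-- The difference is an average of `V(· - t) - V` over the probability measure with density `η`;
Jensen and Tonelli bound its `L²` norm by the worst translate. Strong measurability serves the joint
measurability in Tonelli, and is removed afterwards by passing to a representative. -/
lemma eLpNorm_mollify_sub_le_of_stronglyMeasurable (hV : MemLp V 2) (hVm : StronglyMeasurable V)
    {ε : ℝ≥0∞} (hε : ∀ t ∈ Metric.ball (0 : EuclideanSpace ℝ (Fin d)) η.rOut,
      eLpNorm (fun x => V (-t + x) - V x) 2 volume ≤ ε) :
    eLpNorm (fun x => mollify η V x - V x) 2 volume ≤ ε := by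
  have hη : Continuous (η.normed volume) := (η.contDiff_normed (n := 0)).continuous
  set κ : EuclideanSpace ℝ (Fin d) → ℝ≥0∞ := fun t => ENNReal.ofReal (η.normed volume t) with hκ
  have hκm : Measurable κ := hη.measurable.ennreal_ofReal
  set P : Measure (EuclideanSpace ℝ (Fin d)) := volume.withDensity κ with hP
  have : IsProbabilityMeasure P := ⟨by
    rw [hP, withDensity_apply _ MeasurableSet.univ, Measure.restrict_univ,
      ← ofReal_integral_eq_lintegral_ofReal η.integrable_normed
        (Eventually.of_forall fun x => η.nonneg_normed x), η.integral_normed, ENNReal.ofReal_one]⟩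
  have hjoint : Measurable fun z : EuclideanSpace ℝ (Fin d) × EuclideanSpace ℝ (Fin d) =>
      ‖V (-z.2 + z.1) - V z.1‖ₑ :=
    ((hVm.measurable.comp (measurable_snd.neg.add measurable_fst)).sub
      (hVm.measurable.comp measurable_fst)).enorm
  have hslice : ∀ x, Measurable fun t => ‖V (-t + x) - V x‖ₑ := fun x =>
    ((hVm.measurable.comp (measurable_neg.add_const x)).sub_const (V x)).enorm
  have hpt : ∀ x, ‖mollify η V x - V x‖ₑ ≤ ∫⁻ t, ‖V (-t + x) - V x‖ₑ ∂P := by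
    intro x
    have hex : Integrable fun t => η.normed volume t * V (x - t) :=
      (η.hasCompactSupport_normed.convolutionExists_left (ContinuousLinearMap.lsmul ℝ ℝ) hη
        (locallyIntegrable_of_memLp_two hV)) x
    have hconst : Integrable fun t => η.normed volume t * V x := η.integrable_normed.mul_const _
    have h1 : mollify η V x - V x = ∫ t, η.normed volume t * (V (x - t) - V x) := by
      simp only [mul_sub]
      rw [integral_sub hex hconst, integral_mul_const, η.integral_normed, one_mul]
      rfl
    rw [h1, hP, lintegral_withDensity_eq_lintegral_mul _ hκm (hslice x)]
    refine (enorm_integral_le_lintegral_enorm _).trans (lintegral_mono fun t => ?_)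
    rw [enorm_mul, Real.enorm_of_nonneg (η.nonneg_normed t), show x - t = -t + x from sub_eq_neg_add x t]
    rfl
  have hsq : eLpNorm (fun x => mollify η V x - V x) 2 volume ^ (2 : ℝ) ≤ ε ^ (2 : ℝ) := by
    rw [eLpNorm_two_rpow_two]
    calc ∫⁻ x, ‖mollify η V x - V x‖ₑ ^ (2 : ℝ)
        ≤ ∫⁻ x, ∫⁻ t, ‖V (-t + x) - V x‖ₑ ^ (2 : ℝ) ∂P := by
          refine lintegral_mono fun x => ?_
          exact (ENNReal.rpow_le_rpow (hpt x) (by norm_num)).trans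
            (sq_lintegral_le_of_isProbabilityMeasure P
              (hslice x).aemeasurable)
      _ = ∫⁻ t, (∫⁻ x, ‖V (-t + x) - V x‖ₑ ^ (2 : ℝ)) ∂P :=
          lintegral_lintegral_swap (hjoint.pow_const _).aemeasurable
      _ ≤ ∫⁻ _t, ε ^ (2 : ℝ) ∂P := by
          refine lintegral_mono_ae ?_
          rw [hP, ae_withDensity_iff hκm]
          refine Eventually.of_forall fun t ht => ?_
          have htb : t ∈ Metric.ball (0 : EuclideanSpace ℝ (Fin d)) η.rOut := by
            rw [← η.support_normed_eq (μ := volume)]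
            intro h0
            exact ht (by simp [hκ, h0])
          rw [← eLpNorm_two_rpow_two]
          exact ENNReal.rpow_le_rpow (hε t htb) (by norm_num)
      _ = ε ^ (2 : ℝ) := by simp
  exact (ENNReal.rpow_le_rpow_iff (by norm_num)).1 hsq

lemma eLpNorm_mollify_sub_le (hV : MemLp V 2)
    {ε : ℝ≥0∞} (hε : ∀ t ∈ Metric.ball (0 : EuclideanSpace ℝ (Fin d)) η.rOut,
      eLpNorm (fun x => V (-t + x) - V x) 2 volume ≤ ε) :
    eLpNorm (fun x => mollify η V x - V x) 2 volume ≤ ε := by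
  set V' := hV.1.mk V
  have hae : V =ᵐ[volume] V' := hV.1.ae_eq_mk
  have hm : mollify η V = mollify η V' := convolution_congr _ (ae_eq_refl _) hae
  have hV' : MemLp V' 2 := hV.ae_eq hae
  have h1 : (fun x => mollify η V x - V x) =ᵐ[volume] fun x => mollify η V' x - V' x := by
    filter_upwards [hae] with x hx
    rw [hm, hx]
  rw [eLpNorm_congr_ae h1]
  refine eLpNorm_mollify_sub_le_of_stronglyMeasurable η hV' hV.1.stronglyMeasurable_mk fun t ht => ?_
  refine (le_of_eq (eLpNorm_congr_ae ?_)).trans (hε t ht)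
  have htr := (measurePreserving_add_left volume (-t)).quasiMeasurePreserving.ae_eq hae
  filter_upwards [hae, htr] with x hx hx'
  simp only [Function.comp_apply] at hx'
  rw [hx, hx']

lemma tendsto_mollify (hV : MemLp V 2)
    {η : ℕ → ContDiffBump (0 : EuclideanSpace ℝ (Fin d))}
    (hη : Tendsto (fun n => (η n).rOut) atTop (𝓝 0)) :
    Tendsto (fun n => eLpNorm (fun x => mollify (η n) V x - V x) 2 volume) atTop (𝓝 0) := by
  rw [ENNReal.tendsto_nhds_zero]
  intro ε hε
  have h1 := (ENNReal.tendsto_nhds_zero.1 (tendsto_eLpNorm_translate hV)) ε hε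
  obtain ⟨δ, hδ, hball⟩ := Metric.eventually_nhds_iff_ball.1 h1
  filter_upwards [hη.eventually_lt_const hδ] with n hn
  refine eLpNorm_mollify_sub_le (η n) hV fun t ht => hball (-t) ?_
  rw [mem_ball_zero_iff] at ht ⊢
  rw [norm_neg]
  exact ht.trans hn

end Mollify

/-! ### The power weight -/

section Weight

variable {d : ℕ}

/-- The squared distance to `x₀`. -/
def sqDist (x₀ x : EuclideanSpace ℝ (Fin d)) : ℝ := ∑ j, (x j - x₀ j) ^ 2

lemma sqDist_eq (x₀ x : EuclideanSpace ℝ (Fin d)) : sqDist x₀ x = dist x x₀ ^ 2 := by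
  rw [dist_eq_norm, EuclideanSpace.norm_sq_eq]
  simp [sqDist]

lemma hasFDerivAt_coord (j : Fin d) (x : EuclideanSpace ℝ (Fin d)) :
    HasFDerivAt (fun y : EuclideanSpace ℝ (Fin d) => y j)
      (EuclideanSpace.proj j : EuclideanSpace ℝ (Fin d) →L[ℝ] ℝ) x :=
  (EuclideanSpace.proj j : EuclideanSpace ℝ (Fin d) →L[ℝ] ℝ).hasFDerivAt

lemma contDiff_coord_sub (j : Fin d) (x₀ : EuclideanSpace ℝ (Fin d)) :
    ContDiff ℝ ∞ fun y : EuclideanSpace ℝ (Fin d) => y j - x₀ j :=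
  (EuclideanSpace.proj j : EuclideanSpace ℝ (Fin d) →L[ℝ] ℝ).contDiff.sub contDiff_const

lemma partialDeriv_coord_sub (i j : Fin d) (x₀ x : EuclideanSpace ℝ (Fin d)) :
    partialDeriv i (fun y => y j - x₀ j) x = if j = i then 1 else 0 := by
  rw [partialDeriv, ((hasFDerivAt_coord j x).sub_const (x₀ j)).fderiv]
  simp

lemma contDiff_sqDist (x₀ : EuclideanSpace ℝ (Fin d)) : ContDiff ℝ ∞ (sqDist x₀) :=
  ContDiff.sum fun j _ => (contDiff_coord_sub j x₀).pow 2

lemma partialDeriv_sqDist (i : Fin d) (x₀ x : EuclideanSpace ℝ (Fin d)) :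
    partialDeriv i (sqDist x₀) x = 2 * (x i - x₀ i) := by
  have hd : ∀ j, DifferentiableAt ℝ (fun y : EuclideanSpace ℝ (Fin d) => y j - x₀ j) x :=
    fun j => differentiableAt_of_smooth (contDiff_coord_sub j x₀)
  have h : sqDist x₀ = fun y => ∑ j, (y j - x₀ j) * (y j - x₀ j) := by
    ext y; simp only [sqDist, pow_two]
  rw [h, partialDeriv_sum _ i fun j _ => (hd j).fun_mul (hd j)]
  simp only [partialDeriv_mul i (hd _) (hd _), partialDeriv_coord_sub]
  simp [Finset.sum_add_distrib, two_mul]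

lemma partialDeriv_sqDist_rpow (a : ℝ) (i : Fin d) {x₀ x : EuclideanSpace ℝ (Fin d)}
    (hx : 0 < sqDist x₀ x) :
    partialDeriv i (fun y => sqDist x₀ y ^ a) x
      = a * sqDist x₀ x ^ (a - 1) * (2 * (x i - x₀ i)) := by
  rw [partialDeriv_comp i (Real.hasDerivAt_rpow_const (Or.inl hx.ne'))
    (differentiableAt_of_smooth (contDiff_sqDist x₀)), partialDeriv_sqDist]

lemma partialDeriv_weight (B a : ℝ) (i : Fin d) {x₀ x : EuclideanSpace ℝ (Fin d)}
    (hx : 0 < sqDist x₀ x) :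
    partialDeriv i (fun y => B * sqDist x₀ y ^ a) x
      = (2 * B * a) * (sqDist x₀ x ^ (a - 1) * (x i - x₀ i)) := by
  have hd : DifferentiableAt ℝ (fun y => sqDist x₀ y ^ a) x :=
    (differentiableAt_of_smooth (contDiff_sqDist x₀)).rpow_const (Or.inl hx.ne')
  rw [partialDeriv_const_mul i B hd, partialDeriv_sqDist_rpow a i hx]
  ring

lemma eventually_sqDist_pos {x₀ x : EuclideanSpace ℝ (Fin d)} (hx : 0 < sqDist x₀ x) :
    ∀ᶠ y in 𝓝 x, 0 < sqDist x₀ y :=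
  (contDiff_sqDist x₀).continuous.continuousAt.eventually_const_lt hx

lemma partialDeriv_partialDeriv_weight (B a : ℝ) (i j : Fin d) {x₀ x : EuclideanSpace ℝ (Fin d)}
    (hx : 0 < sqDist x₀ x) :
    partialDeriv j (partialDeriv i (fun y => B * sqDist x₀ y ^ a)) x
      = (2 * B * a) * (2 * (a - 1) * sqDist x₀ x ^ (a - 1 - 1) * (x i - x₀ i) * (x j - x₀ j)
        + sqDist x₀ x ^ (a - 1) * if i = j then 1 else 0) := by
  have h : partialDeriv i (fun y => B * sqDist x₀ y ^ a) =ᶠ[𝓝 x]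
      fun y => (2 * B * a) * (sqDist x₀ y ^ (a - 1) * (y i - x₀ i)) := by
    filter_upwards [eventually_sqDist_pos hx] with y hy
    exact partialDeriv_weight B a i hy
  have hd : DifferentiableAt ℝ (fun y => sqDist x₀ y ^ (a - 1)) x :=
    (differentiableAt_of_smooth (contDiff_sqDist x₀)).rpow_const (Or.inl hx.ne')
  have hc : DifferentiableAt ℝ (fun y : EuclideanSpace ℝ (Fin d) => y i - x₀ i) x :=
    differentiableAt_of_smooth (contDiff_coord_sub i x₀)
  rw [partialDeriv_congr j h, partialDeriv_const_mul j _ (hd.fun_mul hc),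
    partialDeriv_mul j hd hc, partialDeriv_sqDist_rpow _ j hx, partialDeriv_coord_sub]
  ring

/-- The rank one part has the sign of `a - 1` when `B` and `a` are positive, so for `a ≥ 1` the form
is bounded below by its multiple of the identity. -/
lemma weight_hessian_form (B a : ℝ) {x₀ x : EuclideanSpace ℝ (Fin d)} (hx : 0 < sqDist x₀ x)
    (ξ : Fin d → ℝ) :
    ∑ i, ∑ j, ξ i * partialDeriv j (partialDeriv i (fun y => B * sqDist x₀ y ^ a)) x * ξ j
      = (2 * B * a) * (2 * (a - 1) * sqDist x₀ x ^ (a - 1 - 1) * (∑ i, (x i - x₀ i) * ξ i) ^ 2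
        + sqDist x₀ x ^ (a - 1) * ∑ i, ξ i ^ 2) := by
  have hdiag : ∑ i, ξ i ^ 2 = ∑ i, ∑ j, ξ i * (if i = j then 1 else 0) * ξ j := by
    refine Finset.sum_congr rfl fun i _ => ?_
    simp [pow_two]
  rw [hdiag, pow_two, Finset.sum_mul_sum, mul_add]
  simp only [Finset.mul_sum, ← Finset.sum_add_distrib]
  refine Finset.sum_congr rfl fun i _ => Finset.sum_congr rfl fun j _ => ?_
  rw [partialDeriv_partialDeriv_weight B a i j hx]
  ring

/-- There is a smooth compactly supported function that agrees with `b ^ (-β) r ^ β` on a shell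
around `x₀` and is uniformly convex without critical points there. -/
lemma exists_carleman_weight (x₀ : EuclideanSpace ℝ (Fin d)) {b β : ℝ} (hb : 0 < b) (hβ : 2 ≤ β) :
    ∃ φ : EuclideanSpace ℝ (Fin d) → ℝ, ContDiff ℝ ∞ φ ∧ HasCompactSupport φ ∧
      (∀ x, 1 / 2 ≤ dist x x₀ → dist x x₀ ≤ b + 1 → φ x = b ^ (-β) * dist x x₀ ^ β) ∧
      ∃ m : ℝ, 0 < m ∧ ∀ x, 1 / 2 ≤ dist x x₀ → dist x x₀ ≤ b + 1 →
        (∀ ξ : Fin d → ℝ,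
          m * ∑ i, ξ i ^ 2 ≤ ∑ i, ∑ j, ξ i * partialDeriv j (partialDeriv i φ) x * ξ j) ∧
        m ≤ ∑ i, partialDeriv i φ x ^ 2 := by
  set B := b ^ (-β) with hB
  have hB0 : 0 < B := Real.rpow_pos_of_pos hb _
  set a := β / 2 with ha
  have ha1 : 1 ≤ a := by rw [ha]; linarith
  have hpos : ∀ x, 0 < dist x x₀ → 0 < sqDist x₀ x := fun x hx => by
    rw [sqDist_eq]; positivity
  set w : EuclideanSpace ℝ (Fin d) → ℝ := fun y => B * sqDist x₀ y ^ a with hw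
  have hwd : ∀ x, w x = B * dist x x₀ ^ β := fun x => by
    rw [hw]
    simp only [sqDist_eq]
    rw [← Real.rpow_natCast, ← Real.rpow_mul dist_nonneg, ha]
    congr 2
    push_cast
    ring
  have hws : ∀ x, 0 < dist x x₀ → ContDiffAt ℝ ∞ w x := fun x hx =>
    contDiffAt_const.mul ((contDiff_sqDist x₀).contDiffAt.rpow_const_of_ne (hpos x hx).ne')
  -- The difference of bumps is one near the closed shell `1/2 ≤ r ≤ b + 1`, so derivatives there
  -- are those of the power; it vanishes near `x₀`, where the power need not be smooth, and far
  -- away.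
  let χ₁ : ContDiffBump x₀ := ⟨b + 2, b + 3, by linarith, by linarith⟩
  let χ₂ : ContDiffBump x₀ := ⟨1 / 8, 1 / 4, by norm_num, by norm_num⟩
  set φ : EuclideanSpace ℝ (Fin d) → ℝ := fun x => (χ₁ x - χ₂ x) * w x with hφ
  have heq : ∀ x, 1 / 2 ≤ dist x x₀ → dist x x₀ ≤ b + 1 → φ =ᶠ[𝓝 x] w := by
    intro x h1 h2
    have hc : Continuous fun y : EuclideanSpace ℝ (Fin d) => dist y x₀ := by fun_prop
    filter_upwards [hc.continuousAt.eventually_const_lt (show 1 / 4 < dist x x₀ by linarith),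
      hc.continuousAt.eventually_lt_const (show dist x x₀ < b + 2 by linarith)] with y hy1 hy2
    have e1 : χ₁ y = 1 := χ₁.one_of_mem_closedBall (by
      rw [Metric.mem_closedBall]; exact hy2.le)
    have e2 : χ₂ y = 0 := χ₂.zero_of_le_dist hy1.le
    rw [hφ]
    simp only [e1, e2, sub_zero, one_mul]
  have hφs : ContDiff ℝ ∞ φ := by
    rw [contDiff_iff_contDiffAt]
    intro x
    rcases (dist_nonneg (x := x) (y := x₀)).eq_or_lt with h0 | h0
    · have hx : x = x₀ := dist_eq_zero.1 h0.symm
      have : φ =ᶠ[𝓝 x] fun _ => 0 := by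
        rw [hx]
        filter_upwards [Metric.closedBall_mem_nhds x₀ (show (0 : ℝ) < 1 / 8 by norm_num)] with y hy
        have e2 : χ₂ y = 1 := χ₂.one_of_mem_closedBall hy
        have e1 : χ₁ y = 1 := χ₁.one_of_mem_closedBall
          (Metric.closedBall_subset_closedBall (show (1 / 8 : ℝ) ≤ b + 2 by linarith) hy)
        simp [hφ, e1, e2]
      exact contDiffAt_const.congr_of_eventuallyEq this
    · exact (χ₁.contDiffAt.sub χ₂.contDiffAt).mul (hws x h0)
  have hφc : HasCompactSupport φ := by
    refine HasCompactSupport.mul_right ?_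
    exact χ₁.hasCompactSupport.sub χ₂.hasCompactSupport
  -- The value `1/4` is the minimum of `r²` on the shell. It bounds the Hessian below by `m₁`, and
  -- `|∇φ|² = (2 B a r^(2(a-1)))² r²` below by `m₁² / 4`.
  set m₁ := 2 * B * a * (1 / 4 : ℝ) ^ (a - 1) with hm₁
  have hm₁0 : 0 < m₁ := by
    have : (0 : ℝ) < (1 / 4 : ℝ) ^ (a - 1) := Real.rpow_pos_of_pos (by norm_num) _
    positivity
  refine ⟨φ, hφs, hφc, fun x h1 h2 => by rw [(heq x h1 h2).eq_of_nhds, hwd], min m₁ (m₁ ^ 2 / 4),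
    lt_min hm₁0 (by positivity), fun x h1 h2 => ?_⟩
  have hx : 0 < sqDist x₀ x := hpos x (by linarith)
  have hq : 1 / 4 ≤ sqDist x₀ x := by rw [sqDist_eq]; nlinarith
  have hlow : m₁ ≤ 2 * B * a * sqDist x₀ x ^ (a - 1) := by
    rw [hm₁]
    exact mul_le_mul_of_nonneg_left (Real.rpow_le_rpow (by norm_num) hq (by linarith))
      (by positivity)
  have hev : ∀ᶠ y in 𝓝 x, φ =ᶠ[𝓝 y] w := eventually_eventuallyEq_nhds.2 (heq x h1 h2)
  refine ⟨fun ξ => ?_, ?_⟩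
  · have h2' : ∀ i j, partialDeriv j (partialDeriv i φ) x = partialDeriv j (partialDeriv i w) x :=
      fun i j => partialDeriv_congr j (hev.mono fun y hy => partialDeriv_congr i hy)
    simp only [h2']
    rw [hw, weight_hessian_form B a hx ξ]
    have hs : 0 ≤ ∑ i, ξ i ^ 2 := Finset.sum_nonneg fun i _ => sq_nonneg _
    have e1 : 0 ≤ (2 * B * a) * (2 * (a - 1) * sqDist x₀ x ^ (a - 1 - 1)
        * (∑ i, (x i - x₀ i) * ξ i) ^ 2) := by
      have : 0 ≤ a - 1 := by linarith
      have := Real.rpow_nonneg hx.le (a - 1 - 1)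
      positivity
    have e2 := mul_le_mul_of_nonneg_right ((min_le_left m₁ (m₁ ^ 2 / 4)).trans hlow) hs
    nlinarith
  · have h1' : ∀ i, partialDeriv i φ x = 2 * B * a * (sqDist x₀ x ^ (a - 1) * (x i - x₀ i)) :=
      fun i => by rw [partialDeriv_congr i (heq x h1 h2), hw, partialDeriv_weight B a i hx]
    simp only [h1']
    have hsum : ∑ i, (2 * B * a * (sqDist x₀ x ^ (a - 1) * (x i - x₀ i))) ^ 2
        = (2 * B * a * sqDist x₀ x ^ (a - 1)) ^ 2 * sqDist x₀ x := by
      conv_rhs => rw [sqDist, Finset.mul_sum]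
      refine Finset.sum_congr rfl fun i _ => ?_
      rw [sqDist]
      ring
    rw [hsum]
    refine (min_le_right _ _).trans ?_
    have h3 : m₁ ^ 2 ≤ (2 * B * a * sqDist x₀ x ^ (a - 1)) ^ 2 :=
      pow_le_pow_left₀ hm₁0.le hlow 2
    have h4 := mul_le_mul h3 hq (by norm_num) (sq_nonneg _)
    linarith

end Weight

/-! ### Passage to the limit -/

section Limit

variable {d : ℕ}

lemma toReal_eLpNorm_sq {f : EuclideanSpace ℝ (Fin d) → ℝ} (hf : MemLp f 2) :
    (eLpNorm f 2 volume).toReal ^ 2 = ∫ x, f x ^ 2 := by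
  rw [integral_eq_lintegral_of_nonneg_ae (Eventually.of_forall fun x => sq_nonneg _)
    (hf.1.pow 2), ← ENNReal.toReal_pow, ← ENNReal.rpow_natCast]
  congr 1
  rw [show ((2 : ℕ) : ℝ) = 2 by norm_num, eLpNorm_two_rpow_two]
  refine lintegral_congr fun x => ?_
  rw [show (2 : ℝ) = ((2 : ℕ) : ℝ) by norm_num, ENNReal.rpow_natCast, Real.enorm_eq_ofReal_abs,
    ← ENNReal.ofReal_pow (abs_nonneg _), sq_abs]

lemma tendsto_integral_sq {F : EuclideanSpace ℝ (Fin d) → ℝ}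
    {f : ℕ → EuclideanSpace ℝ (Fin d) → ℝ} (hF : MemLp F 2) (hf : ∀ n, MemLp (f n) 2)
    (hlim : Tendsto (fun n => eLpNorm (f n - F) 2 volume) atTop (𝓝 0)) :
    Tendsto (fun n => ∫ x, f n x ^ 2) atTop (𝓝 (∫ x, F x ^ 2)) := by
  have h := (((Lp.tendsto_Lp_iff_tendsto_eLpNorm'' f hf F hF).2 hlim).norm).pow 2
  simpa only [Lp.norm_toLp, toReal_eLpNorm_sq hF, toReal_eLpNorm_sq (hf _)] using h

/-- The weight is absorbed as `√e`, a bounded continuous multiplier on `L²`, and the norm is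
continuous. -/
lemma tendsto_integral_weight_sq {e : EuclideanSpace ℝ (Fin d) → ℝ} (he : Continuous e)
    (he0 : ∀ x, 0 ≤ e x) {M : ℝ} (hM : ∀ x, e x ≤ M)
    {F : EuclideanSpace ℝ (Fin d) → ℝ} {f : ℕ → EuclideanSpace ℝ (Fin d) → ℝ} (hF : MemLp F 2)
    (hf : ∀ n, MemLp (f n) 2)
    (hlim : Tendsto (fun n => eLpNorm (fun x => f n x - F x) 2 volume) atTop (𝓝 0)) :
    Tendsto (fun n => ∫ x, e x * f n x ^ 2) atTop (𝓝 (∫ x, e x * F x ^ 2)) := by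
  have hs : Continuous fun x => √(e x) := he.sqrt
  have hbd : ∀ x (t : ℝ), ‖√(e x) * t‖ ≤ √M * ‖t‖ := fun x t => by
    rw [norm_mul, Real.norm_of_nonneg (Real.sqrt_nonneg _)]
    exact mul_le_mul_of_nonneg_right (Real.sqrt_le_sqrt (hM x)) (norm_nonneg _)
  have hmem : ∀ g : EuclideanSpace ℝ (Fin d) → ℝ, MemLp g 2 → MemLp (fun x => √(e x) * g x) 2 :=
    fun g hg => MemLp.of_le_mul hg (hs.aestronglyMeasurable.mul hg.1) (c := √M)
      (Eventually.of_forall fun x => hbd x _)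
  have hsq : ∀ x t, e x * t ^ 2 = (√(e x) * t) ^ 2 := fun x t => by
    rw [mul_pow, Real.sq_sqrt (he0 x)]
  simp only [hsq]
  refine tendsto_integral_sq (hmem F hF) (fun n => hmem _ (hf n)) ?_
  have hup : Tendsto (fun n => ENNReal.ofReal √M * eLpNorm (fun x => f n x - F x) 2 volume) atTop
      (𝓝 0) := by
    simpa using ENNReal.Tendsto.const_mul hlim (Or.inr ENNReal.ofReal_ne_top)
  refine tendsto_of_tendsto_of_tendsto_of_le_of_le tendsto_const_nhds hup (fun _ => zero_le)
    fun n => ?_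
  refine eLpNorm_le_mul_eLpNorm_of_ae_le_mul (Eventually.of_forall fun x => ?_) 2
  rw [Pi.sub_apply, ← mul_sub]
  exact hbd x _

lemma integral_indicator_of_weakDefect {Ω : Set (EuclideanSpace ℝ (Fin d))}
    (hΩ : MeasurableSet Ω) {i : Fin d} {u w ψ : EuclideanSpace ℝ (Fin d) → ℝ}
    (h : weakDefect Ω i u w ψ = 0) :
    ∫ x, Ω.indicator u x * partialDeriv i ψ x = -∫ x, Ω.indicator w x * ψ x := by
  have hconv : ∀ f g : EuclideanSpace ℝ (Fin d) → ℝ,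
      ∫ x, Ω.indicator f x * g x = ∫ x in Ω, f x * g x := fun f g => by
    rw [← integral_indicator hΩ]
    congr 1
    ext x
    by_cases hx : x ∈ Ω <;> simp [hx]
  rw [hconv, hconv]
  rw [weakDefect] at h
  linarith

lemma integral_weight_indicator {Ω : Set (EuclideanSpace ℝ (Fin d))} (hΩ : MeasurableSet Ω)
    {e e' f : EuclideanSpace ℝ (Fin d) → ℝ} (he : ∀ x ∈ Ω, e x = e' x) :
    ∫ x, e x * Ω.indicator f x ^ 2 = ∫ x in Ω, e' x * f x ^ 2 := by
  rw [← integral_indicator hΩ]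
  congr 1
  ext x
  by_cases hx : x ∈ Ω
  · simp [hx, he x hx]
  · simp [hx]

/-- The Carleman estimate passes from smooth functions to functions in `H²(Ω)` whose extension by
zero belongs to `H²(ℝᵈ)`. -/
theorem carleman_of_zeroExtension {Ω K : Set (EuclideanSpace ℝ (Fin d))} (hΩ : MeasurableSet Ω)
    (hK : IsCompact K) {δ : ℝ} (hδ : 0 < δ) (hΩK : ∀ x, ∀ y ∈ Ω, dist x y < δ → x ∈ K)
    {φ : EuclideanSpace ℝ (Fin d) → ℝ} (hφ : ContDiff ℝ ∞ φ) (hφc : HasCompactSupport φ)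
    {C l : ℝ}
    (hcarl : ∀ u : EuclideanSpace ℝ (Fin d) → ℝ, ContDiff ℝ ∞ u →
      HasCompactSupport u → tsupport u ⊆ K →
        l⁻¹ * (∑ i, ∑ j, ∫ x, Real.exp (2 * l * φ x) * partialDeriv j (partialDeriv i u) x ^ 2)
          + l ^ 3 * (∫ x, Real.exp (2 * l * φ x) * u x ^ 2)
          + l * (∫ x, Real.exp (2 * l * φ x) * ∑ i, partialDeriv i u x ^ 2)
        ≤ C * ∫ x, Real.exp (2 * l * φ x) * (∑ i, partialDeriv i (partialDeriv i u) x) ^ 2)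
    {v : EuclideanSpace ℝ (Fin d) → ℝ} {Dv : Fin d → EuclideanSpace ℝ (Fin d) → ℝ}
    {D2v : Fin d → Fin d → EuclideanSpace ℝ (Fin d) → ℝ} (h : IsSobolevH2 Ω v Dv D2v)
    (h1 : ∀ i ψ, ContDiff ℝ ∞ ψ → HasCompactSupport ψ → weakDefect Ω i v (Dv i) ψ = 0)
    (h2 : ∀ i j ψ, ContDiff ℝ ∞ ψ → HasCompactSupport ψ →
      weakDefect Ω j (Dv i) (D2v i j) ψ = 0)
    {e' : EuclideanSpace ℝ (Fin d) → ℝ} (he' : ∀ x ∈ Ω, Real.exp (2 * l * φ x) = e' x) :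
    l⁻¹ * (∑ i, ∑ j, ∫ x in Ω, e' x * D2v i j x ^ 2) + l ^ 3 * (∫ x in Ω, e' x * v x ^ 2)
      + l * (∫ x in Ω, e' x * ∑ i, Dv i x ^ 2) ≤ C * ∫ x in Ω, e' x * (∑ i, D2v i i x) ^ 2 := by
  set V := Ω.indicator v with hV
  set G : Fin d → EuclideanSpace ℝ (Fin d) → ℝ := fun i => Ω.indicator (Dv i) with hG
  set H : Fin d → Fin d → EuclideanSpace ℝ (Fin d) → ℝ := fun i j => Ω.indicator (D2v i j) with hH
  have hVm : MemLp V 2 := (memLp_indicator_iff_restrict hΩ).2 h.memLp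
  have hGm : ∀ i, MemLp (G i) 2 := fun i => (memLp_indicator_iff_restrict hΩ).2 (h.memLp_grad i)
  have hHm : ∀ i j, MemLp (H i j) 2 := fun i j =>
    (memLp_indicator_iff_restrict hΩ).2 (h.memLp_hess i j)
  -- The radii tend to zero and stay at most `δ`, so every mollification is supported in `K` and the
  -- estimate for test functions applies from the first index on.
  let η : ℕ → ContDiffBump (0 : EuclideanSpace ℝ (Fin d)) := fun n =>
    ⟨δ / (n + 2) / 2, δ / (n + 2), by positivity, half_lt_self (by positivity)⟩
  have hηlim : Tendsto (fun n => (η n).rOut) atTop (𝓝 0) := by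
    refine Tendsto.div_atTop tendsto_const_nhds ?_
    exact tendsto_atTop_add_const_right _ _ tendsto_natCast_atTop_atTop
  have hηδ : ∀ n, (η n).rOut ≤ δ := fun n =>
    div_le_self hδ.le (by have : (0 : ℝ) ≤ n := n.cast_nonneg; linarith)
  have hsupp : ∀ n {f : EuclideanSpace ℝ (Fin d) → ℝ},
      tsupport (mollify (η n) (Ω.indicator f)) ⊆ K := fun n f => by
    refine closure_minimal (fun x hx => ?_) hK.isClosed
    obtain ⟨y, hy, hxy⟩ := exists_dist_lt_of_mollify_ne_zero (η n) hx
    exact hΩK x y (Set.mem_of_indicator_ne_zero hy) (hxy.trans_le (hηδ n))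
  have hcs : ∀ n {f : EuclideanSpace ℝ (Fin d) → ℝ},
      HasCompactSupport (mollify (η n) (Ω.indicator f)) := fun n f =>
    hK.of_isClosed_subset (isClosed_tsupport _) (hsupp n)
  have hmol : ∀ n {f : EuclideanSpace ℝ (Fin d) → ℝ}, MemLp (Ω.indicator f) 2 →
      MemLp (mollify (η n) (Ω.indicator f)) 2 := fun n f hf =>
    (contDiff_mollify (η n) hf).continuous.memLp_of_hasCompactSupport (hcs n)
  have hD1 : ∀ n i, partialDeriv i (mollify (η n) V) = mollify (η n) (G i) := fun n i =>
    partialDeriv_mollify (η n) i hVm fun ψ hψ hψc => integral_indicator_of_weakDefect hΩ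
      (h1 i ψ hψ hψc)
  have hD2 : ∀ n i j, partialDeriv j (partialDeriv i (mollify (η n) V))
      = mollify (η n) (H i j) := fun n i j => by
    rw [hD1]
    exact partialDeriv_mollify (η n) j (hGm i) fun ψ hψ hψc =>
      integral_indicator_of_weakDefect hΩ (h2 i j ψ hψ hψc)
  have he : Continuous fun x => Real.exp (2 * l * φ x) := (contDiff_exp_mul hφ (2 * l)).continuous
  obtain ⟨M, hM⟩ : ∃ M, ∀ x, Real.exp (2 * l * φ x) ≤ M := by
    obtain ⟨c, hc⟩ := hφc.exists_bound_of_continuous hφ.continuous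
    refine ⟨Real.exp (|2 * l| * c), fun x => Real.exp_le_exp.2 ?_⟩
    calc 2 * l * φ x ≤ |2 * l * φ x| := le_abs_self _
      _ = |2 * l| * ‖φ x‖ := by rw [abs_mul, Real.norm_eq_abs]
      _ ≤ |2 * l| * c := mul_le_mul_of_nonneg_left (hc x) (abs_nonneg _)
  have hlimit : ∀ {f : EuclideanSpace ℝ (Fin d) → ℝ}, MemLp (Ω.indicator f) 2 →
      Tendsto (fun n => ∫ x, Real.exp (2 * l * φ x) * mollify (η n) (Ω.indicator f) x ^ 2) atTop
        (𝓝 (∫ x in Ω, e' x * f x ^ 2)) := fun {f} hf => by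
    rw [← integral_weight_indicator hΩ he']
    exact tendsto_integral_weight_sq he (fun x => (Real.exp_pos _).le) hM hf (fun n => hmol n hf)
      (tendsto_mollify hf hηlim)
  have hLap : Tendsto (fun n => ∫ x, Real.exp (2 * l * φ x) * (∑ i, mollify (η n) (H i i) x) ^ 2)
      atTop (𝓝 (∫ x in Ω, e' x * (∑ i, D2v i i x) ^ 2)) := by
    have hsumind : Ω.indicator (fun x => ∑ i, D2v i i x) = fun x => ∑ i, H i i x := by
      ext x
      by_cases hx : x ∈ Ω <;> simp [hH, hx]
    rw [← integral_weight_indicator hΩ he', hsumind]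
    refine tendsto_integral_weight_sq he (fun x => (Real.exp_pos _).le) hM
      (memLp_finsetSum _ fun i _ => hHm i i)
      (fun n => memLp_finsetSum _ fun i _ => hmol n (hHm i i)) ?_
    have hup : Tendsto (fun n => ∑ i, eLpNorm (fun x => mollify (η n) (H i i) x - H i i x) 2 volume)
        atTop (𝓝 0) := by
      have := tendsto_finsetSum Finset.univ fun i (_ : i ∈ Finset.univ) =>
        tendsto_mollify (hHm i i) hηlim
      simpa using this
    refine tendsto_of_tendsto_of_tendsto_of_le_of_le tendsto_const_nhds hup (fun _ => zero_le)
      fun n => ?_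
    have hfun : (fun x => ∑ i, mollify (η n) (H i i) x - ∑ i, H i i x)
        = ∑ i, fun x => mollify (η n) (H i i) x - H i i x := by
      ext x
      rw [Finset.sum_apply, Finset.sum_sub_distrib]
    show eLpNorm (fun x => ∑ i, mollify (η n) (H i i) x - ∑ i, H i i x) 2 volume ≤ _
    rw [hfun]
    exact eLpNorm_sum_le (fun i _ => (hmol n (hHm i i)).1.sub (hHm i i).1) (by norm_num)
  have hgradsum : ∀ {F : Fin d → EuclideanSpace ℝ (Fin d) → ℝ} {e : EuclideanSpace ℝ (Fin d) → ℝ}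
      {μ : Measure (EuclideanSpace ℝ (Fin d))},
      (∀ i, Integrable (fun x => e x * F i x ^ 2) μ) →
      ∫ x, e x * ∑ i, F i x ^ 2 ∂μ = ∑ i, ∫ x, e x * F i x ^ 2 ∂μ := fun hint => by
    simp only [Finset.mul_sum]
    exact integral_finsetSum _ fun i _ => hint i
  have hintsq : ∀ {f : EuclideanSpace ℝ (Fin d) → ℝ}, MemLp f 2 →
      Integrable fun x => Real.exp (2 * l * φ x) * f x ^ 2 := fun hf =>
    hf.integrable_sq.bdd_mul he.aestronglyMeasurable (c := M) (Eventually.of_forall fun x => by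
      rw [Real.norm_of_nonneg (Real.exp_pos _).le]; exact hM x)
  have hgradΩ : ∀ i, Integrable (fun x => e' x * Dv i x ^ 2) (volume.restrict Ω) := fun i => by
    refine (integrable_indicator_iff hΩ).1 ?_
    refine (hintsq (hGm i)).congr (Eventually.of_forall fun x => ?_)
    by_cases hx : x ∈ Ω
    · simp [hG, hx, he' x hx]
    · simp [hG, hx]
  have hineq : ∀ n, l⁻¹ * (∑ i, ∑ j, ∫ x, Real.exp (2 * l * φ x) * mollify (η n) (H i j) x ^ 2)
      + l ^ 3 * (∫ x, Real.exp (2 * l * φ x) * mollify (η n) V x ^ 2)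
      + l * (∑ i, ∫ x, Real.exp (2 * l * φ x) * mollify (η n) (G i) x ^ 2)
      ≤ C * ∫ x, Real.exp (2 * l * φ x) * (∑ i, mollify (η n) (H i i) x) ^ 2 := fun n => by
    have := hcarl (mollify (η n) V) (contDiff_mollify (η n) hVm) (hcs n) (hsupp n)
    simp only [hD2] at this
    simp only [hD1] at this
    rw [hgradsum fun i => hintsq (hmol n (hGm i))] at this
    exact this
  rw [hgradsum hgradΩ]
  refine le_of_tendsto_of_tendsto' (((Tendsto.const_mul _ ?_).add ((hlimit hVm).const_mul _)).add
    (Tendsto.const_mul _ ?_)) (hLap.const_mul C) hineq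
  · exact tendsto_finsetSum _ fun i _ => tendsto_finsetSum _ fun j _ => hlimit (hHm i j)
  · exact tendsto_finsetSum _ fun i _ => hlimit (hGm i)

end Limit

end CarlemanH2

/-! ### The estimate on `Ω`. -/

theorem mainTheorem3 (d : ℕ) (hd : 1 ≤ d) (Ω : Set (EuclideanSpace ℝ (Fin d)))
    (hΩ_open : IsOpen Ω) (hΩ_bdd : Bornology.IsBounded Ω)
    (hΩ_smooth : CarlemanH2.HasSmoothBoundary Ω)
    (x₀ : EuclideanSpace ℝ (Fin d)) (hx₀ : x₀ ∉ closure Ω) (hr : ∀ x ∈ Ω, 1 < dist x x₀)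
    (b : ℝ) (hb : ∀ x ∈ closure Ω, dist x x₀ < b) :
    ∃ β₀ : ℝ, 0 < β₀ ∧ ∀ β : ℝ, β₀ ≤ β →
      ∃ C : ℝ, 0 < C ∧ ∃ lam₀ : ℝ, 1 < lam₀ ∧
        ∀ (v : EuclideanSpace ℝ (Fin d) → ℝ) (Dv : Fin d → EuclideanSpace ℝ (Fin d) → ℝ)
          (D2v : Fin d → Fin d → EuclideanSpace ℝ (Fin d) → ℝ),
          CarlemanH2.IsSobolevH2 Ω v Dv D2v →
          CarlemanH2.HasTrace Ω v Dv (fun _ => 0) →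
          CarlemanH2.HasNormalDerivative Ω Dv D2v (fun _ => 0) →
          ∀ lam : ℝ, lam₀ ≤ lam →
            C * lam⁻¹ * (∑ i, ∑ j,
                (∫ x in Ω, CarlemanH2.carlemanWeight x₀ b β lam x * (D2v i j x) ^ 2))
              + C * lam ^ 3 *
                (∫ x in Ω, CarlemanH2.carlemanWeight x₀ b β lam x * (v x) ^ 2)
              + C * lam *
                (∫ x in Ω, CarlemanH2.carlemanWeight x₀ b β lam x * (∑ i, (Dv i x) ^ 2))
            ≤ ∫ x in Ω, CarlemanH2.carlemanWeight x₀ b β lam x * (∑ i, D2v i i x) ^ 2 := by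
  -- From `β = 2` on, `r^β` is uniformly convex on shells away from `x₀`.
  refine ⟨2, two_pos, fun β hβ => ?_⟩
  -- For empty `Ω` nothing forces `b > 0`, but all integrals vanish.
  rcases Ω.eq_empty_or_nonempty with rfl | ⟨y₀, hy₀⟩
  · exact ⟨1, one_pos, 2, one_lt_two, fun v Dv D2v _ _ _ lam _ => by simp⟩
  have hb0 : 0 < b := by linarith [hr y₀ hy₀, hb y₀ (subset_closure hy₀)]
  obtain ⟨φ, hφ, hφc, hφeq, m, hm, hφm⟩ := CarlemanH2.exists_carleman_weight x₀ hb0 hβ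
  -- Since `1 < r < b` on `Ω`, the `1/2`-neighbourhood of `Ω` stays in this shell; that is the room
  -- needed for mollification.
  set K : Set (EuclideanSpace ℝ (Fin d)) := {x | 1 / 2 ≤ dist x x₀ ∧ dist x x₀ ≤ b + 1} with hK
  have hKc : IsCompact K := by
    refine (isCompact_closedBall x₀ (b + 1)).of_isClosed_subset ?_ fun x hx => hx.2
    exact (isClosed_le continuous_const (continuous_id.dist continuous_const)).inter
      (isClosed_le (continuous_id.dist continuous_const) continuous_const)
  have hΩK : ∀ x, ∀ y ∈ Ω, dist x y < 1 / 2 → x ∈ K := fun x y hy hxy => by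
    have h1 := hr y hy
    have h2 := hb y (subset_closure hy)
    have h3 := dist_triangle x y x₀
    have h4 := dist_triangle_left y x₀ x
    constructor <;> linarith
  obtain ⟨C, hC, l₀, hl₀, hcarl⟩ := CarlemanH2.carleman_smooth (K := K) hd hφ hφc hm
    (fun x hx => (hφm x hx.1 hx.2).1) (fun x hx => (hφm x hx.1 hx.2).2)
  refine ⟨C⁻¹, inv_pos.2 hC, l₀, hl₀, fun v Dv D2v h htr hnd lam hlam => ?_⟩
  obtain ⟨h1, h2⟩ := CarlemanH2.weakDefect_eq_zero_of_cauchyData hd hΩ_open hΩ_smooth h htr hnd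
  have he : ∀ x ∈ Ω, Real.exp (2 * lam * φ x) = CarlemanH2.carlemanWeight x₀ b β lam x :=
    fun x hx => by
      have hxK : x ∈ K := hΩK x x hx (by simp)
      rw [CarlemanH2.carlemanWeight, hφeq x hxK.1 hxK.2, ← mul_assoc]
  have key := CarlemanH2.carleman_of_zeroExtension hΩ_open.measurableSet hKc one_half_pos hΩK hφ hφc
    (fun u hu huc huK => hcarl u hu huc huK lam hlam) h h1 h2 he
  have := mul_le_mul_of_nonneg_left key (inv_pos.2 hC).le
  rw [inv_mul_cancel_left₀ hC.ne'] at this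
  refine le_trans (le_of_eq ?_) this
  ring
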